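/- **Setting.** There are $n\ge 2$ agents $V=[n]$ and a set $M$ of $m\ge 1$ items. A valuation $f:2^M\to\mathbb R$ satisfies $f(\emptyset)=0$ and is non-decreasing. For $\epsilon\ge 0$, $f$ is *$\epsilon$-leveled* (additive $\epsilon$-dichotomous) if it is additive, $f(S)+f(T)=f(S\cup T)$ for disjoint $S,T$, and every marginal $f(S\cup\{a\})-f(S)$ is $0$ or lies in $[1,1+\epsilon]$. The demand of an agent with valuation $f_v$ is $D_v=\{a\in M: f_v(\{a\})>0\}$. An allocation $A=(A_v)_{v\in V}$ consists of disjoint subsets of $M$ (items may stay unallocated); its welfare is $\sum_v f_v(A_v)$. It is *non-redundant* for $f=(f_v)_v$ if $f_v(A_v\setminus\{a\})<f_v(A_v)$ for all $v$ and $a\in A_v$, and *reasonable* if it is non-redundant and no non-redundant allocation allocates more items. The maximin share of $v$ is the maximum over partitions $(S_1,\dots,S_n)$ of $M$ of $\min_j f_v(S_j)$. **PE.** For utility vectors $u,w\in\mathbb R^n$, $u$ *Lorenz dominates* $w$ if for every $k\le n$ the sum of the $k$ smallest entries of $u$ is at least that of $w$; an allocation is Lorenz dominating if its utility vector Lorenz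 dominates that of every allocation. A *prioritized egalitarian (PE) mechanism* takes reported sets $R_1,\dots,R_n\subseteq M$ listed in order of priority ($1$ is the highest), with valuations $S\mapsto|S\cap R_i|$; it adds auxiliary items $a_1,\dots,a_n$, where $a_i$ contributes additively the value $i/n^2$ to agent $i$ and nothing to the others, and returns an allocation of $M$ (bundles listed in the same order) that is non-redundant for the reported valuations and is obtained from a Lorenz dominating allocation of $M\cup\{a_1,\dots,a_n\}$ by deleting the auxiliary items. The choice among such allocations is any fixed function of the list $(R_1,\dots,R_n)$. For an arbitrary priority order $\sigma$ the agents are relabeled by their places in $\sigma$. **The mechanism $\mathcal M^\epsilon$.** Each agent $v$ reports a set $R_v\subseteq M$. Draw $X[1]\in M$ uniformly; with probability $1-\frac1m$ draw also $X[2]\in M\setminus\{X[1]\}$ uniformly; independently draw a uniformly random priority order $\sigma$ of the agents. Allocate $M\setminus X$ by PE with order $\sigma$ and reports $R_v\setminus X$. Allocate $X$ using the reverse of $\sigma$: if some agent reported $X[1]$, it goes to the one of highest priority among them, who is then moved to the lowest priority; then, if $X[2]$ exists and some agent reported it, it goes to the highest-priority agent (in the updated order) who reported it. Each agent gets the union of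 her two bundles. A *realization* is a possible value of $(X,\sigma)$; "ex-post" means for every realization. Agent $v$ is *truthful* if $R_v=D_v$. **Theorem.** Let $0\le\epsilon<\frac1{nm^3}$ and let all agents be $\epsilon$-leveled. For every PE mechanism, $\mathcal M^\epsilon$ has the following properties. 1. *Truthful in expectation:* for every agent $v$ and all reports of the others, reporting $D_v$ maximizes $\mathbb E[f_v(A_v)]$ over all reports of $v$; if some item of $D_v$ is reported by another agent, then $D_v$ is the unique maximizer. *Ex-post $\epsilon$-truthful:* for every realization, all reports of the others and every report $S$ of $v$, if $A$ and $A'$ are the outcomes when $v$ reports $D_v$ and $S$, then $(1+\epsilon)f_v(A_v)\ge f_v(A'_v)$. 2. If all agents are truthful then, ex-post, the allocation is reasonable for $f$, and its welfare is at least $\frac1{1+\epsilon}$ times the maximum welfare. 3. For every truthful agent $v$, whatever the others report, ex-post: $f_v(A_v)$ is at least $\frac1{1+\epsilon}$ times the maximin share of $v$; and for every agent $w$ with $A_w\ne\emptyset$ there is $a\in A_w$ with $f_v(A_v)\ge\frac1{1+\epsilon}f_v(A_w\setminus\{a\})$ (that is, $\frac1{1+\epsilon}$-EF1). 4. For every truthful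 agent $v$, whatever the others report, $\mathbb E[f_v(A_v)]\ge\frac1n f_v(M)$. Moreover, PE mechanisms exist for all $n\ge2$, $m\ge1$, and can be chosen such that $\mathcal M^\epsilon$ runs in polynomial time in $n$ and $m$: there are one randomized random-access-machine program (unit-cost addition and truncated subtraction, and uniform random numbers from $\{0,\dots,k\}$) and one polynomial $q$ such that for all $n\ge 2$, $m\ge 1$ and all reports, the program, given $n$, $m$ and the reports, halts within $q(n+m)$ steps for every outcome of its random choices, and its output allocation has exactly the distribution of the output of $\mathcal M^\epsilon$. -/

import Mathlib

open Finset
open scoped NNReal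

noncomputable section

namespace FairAllocation

/-! ### Valuations -/

/-- A set function on bundles of items. -/
abbrev Valuation (ι : Type*) := Finset ι → ℝ

section Valuations

variable {ι : Type*} [DecidableEq ι]

/-- Normalized and non-decreasing, as is required of every valuation function. -/
def IsValuation (f : Valuation ι) : Prop :=
  f ∅ = 0 ∧ ∀ S T : Finset ι, S ⊆ T → f S ≤ f T

def IsAdditive (f : Valuation ι) : Prop :=
  ∀ S T : Finset ι, Disjoint S T → f S + f T = f (S ∪ T)

/-- The marginal value of the item `a` given the bundle `S`. -/
def marginal (f : Valuation ι) (a : ι) (S : Finset ι) : ℝ := f (insert a S) - f S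

def IsSubmodular (f : Valuation ι) : Prop :=
  ∀ (S T : Finset ι) (a : ι), S ⊆ T → marginal f a T ≤ marginal f a S

/-- A submodular valuation all of whose marginals are `0` or lie in `[1, 1 + ε]`. -/
def IsEpsDichotomous (ε : ℝ) (f : Valuation ι) : Prop :=
  IsValuation f ∧ IsSubmodular f ∧
    ∀ (S : Finset ι) (a : ι), marginal f a S = 0 ∨ marginal f a S ∈ Set.Icc 1 (1 + ε)

/-- An additive `ε`-dichotomous valuation. -/
def IsLeveled (ε : ℝ) (f : Valuation ι) : Prop :=
  IsAdditive f ∧ IsEpsDichotomous ε f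

/-- The set of items demanded by an agent with valuation `f`. -/
def demand [Fintype ι] (f : Valuation ι) : Finset ι :=
  univ.filter fun a => 0 < f {a}

/-- The additive dichotomous valuation whose demand is `R`. -/
def demandVal (R : Finset ι) : Valuation ι := fun S => ((S ∩ R).card : ℝ)

end Valuations

/-! ### Allocations (agents are `Fin n`) -/

section Allocations

variable {ι : Type*} [DecidableEq ι] {n : ℕ}

/-- An allocation gives disjoint bundles to the agents; items may remain unallocated. -/
def IsAllocation (A : Fin n → Finset ι) : Prop :=
  ∀ v w : Fin n, v ≠ w → Disjoint (A v) (A w)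

def welfare (f : Fin n → Valuation ι) (A : Fin n → Finset ι) : ℝ := ∑ v, f v (A v)

/-- No agent gets an item that has no marginal value in her bundle. -/
def IsNonRedundant (f : Fin n → Valuation ι) (A : Fin n → Finset ι) : Prop :=
  ∀ v : Fin n, ∀ a ∈ A v, f v ((A v).erase a) < f v (A v)

/-- A non-redundant allocation that allocates as many items as any non-redundant allocation. -/
def IsReasonable (f : Fin n → Valuation ι) (A : Fin n → Finset ι) : Prop :=
  IsAllocation A ∧ IsNonRedundant f A ∧
    ∀ B : Fin n → Finset ι, IsAllocation B → IsNonRedundant f B →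
      ∑ v, (B v).card ≤ ∑ v, (A v).card

/-- The maximin share among `n` agents: the maximum over all partitions of the items into `n`
bundles (a partition is a map from items to bundle numbers) of the minimum value of a bundle. -/
def maximinShare [Fintype ι] (n : ℕ) (f : Valuation ι) : ℝ :=
  ⨆ P : ι → Fin n, ⨅ j : Fin n, f (univ.filter fun a => P a = j)

/-- The `α`-EF1 condition for one agent `v` with valuation `f`. -/
def IsEF1For (α : ℝ) (f : Valuation ι) (A : Fin n → Finset ι) (v : Fin n) : Prop :=
  ∀ w : Fin n, (A w).Nonempty → ∃ a ∈ A w, α * f ((A w).erase a) ≤ f (A v)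

/-- The entries of `u` sorted from smallest to largest. -/
def sorted (u : Fin n → ℝ) : Fin n → ℝ := u ∘ Tuple.sort u

/-- Lorenz domination: every partial sum of the sorted vector of `u` is at least the
corresponding partial sum of the sorted vector of `w`. -/
def LorenzGE (u w : Fin n → ℝ) : Prop :=
  ∀ k : Fin n, ∑ i ∈ Finset.Iic k, sorted w i ≤ ∑ i ∈ Finset.Iic k, sorted u i

/-- An allocation that Lorenz dominates every allocation. -/
def IsLorenzDominating (f : Fin n → Valuation ι) (A : Fin n → Finset ι) : Prop :=
  IsAllocation A ∧ ∀ B : Fin n → Finset ι, IsAllocation B →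
    LorenzGE (fun v => f v (A v)) (fun v => f v (B v))

end Allocations

/-! ### The prioritized egalitarian (PE) mechanism

Agents are listed by priority: agent `0` has the highest priority and agent `n - 1` the lowest. -/

section PE

variable {n m : ℕ}

/-- The original items contained in a bundle of original items (`inl`) and
auxiliary items (`inr`). -/
def original (S : Finset (Fin m ⊕ Fin n)) : Finset (Fin m) :=
  univ.filter fun a => Sum.inl a ∈ S

/-- The valuations after adding `n` auxiliary items: the `i`-th auxiliary item (counted from `1`)
is worth `i / n²` to the `i`-th agent and nothing to the others. -/
def auxVal (f : Fin n → Valuation (Fin m)) (i : Fin n) : Valuation (Fin m ⊕ Fin n) :=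
  fun S => f i (original S) + if Sum.inr i ∈ S then ((i : ℝ) + 1) / (n : ℝ) ^ 2 else 0

/-- `A` is non-redundant, and arises from a Lorenz dominating allocation of the
original and the auxiliary items by removing the auxiliary items. -/
def IsPEOutcome (f : Fin n → Valuation (Fin m)) (A : Fin n → Finset (Fin m)) : Prop :=
  IsNonRedundant f A ∧
    ∃ A' : Fin n → Finset (Fin m ⊕ Fin n),
      IsLorenzDominating (auxVal f) A' ∧ ∀ i, A i = original (A' i)

/-- A rule that maps the reported demand sets, listed by priority, to the bundles of the agents,
listed by priority. -/
abbrev PERule (n m : ℕ) := (Fin n → Finset (Fin m)) → (Fin n → Finset (Fin m))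

/-- `pe` is a PE mechanism: on every profile of additive dichotomous reports it selects
one of the PE outcomes. -/
def IsPE (pe : PERule n m) : Prop :=
  ∀ R : Fin n → Finset (Fin m), IsPEOutcome (fun i => demandVal (R i)) (pe R)

/-- The PE mechanism run with the priority order `σ`, where `σ r` is the agent in place `r`
(place `0` is the highest priority): relabel the agents by their places. -/
def peWith (pe : PERule n m) (σ : Equiv.Perm (Fin n)) (R : Fin n → Finset (Fin m)) :
    Fin n → Finset (Fin m) :=
  fun v => pe (fun r => R (σ r)) (σ.symm v)

end PE

/-! ### The mechanism for the held-out items -/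

section HeldOut

variable {n m : ℕ}

/-- The highest priority agent that reports `x`, if any; the list `L` is in order of priority. -/
def winner (L : List (Fin n)) (R : Fin n → Finset (Fin m)) (x : Fin m) : Option (Fin n) :=
  L.find? fun v => decide (x ∈ R v)

/-- Move an agent to the lowest priority (`none`: nothing changes). -/
def demote (L : List (Fin n)) : Option (Fin n) → List (Fin n)
  | none => L
  | some v => L.erase v ++ [v]

/-- The held-out items: a first one, and possibly a second one. -/
abbrev HeldOut (m : ℕ) := Fin m × Option (Fin m)

def heldSet (X : HeldOut m) : Finset (Fin m) := insert X.1 X.2.toFinset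

/-- The first item goes to the highest priority agent reporting it, who then moves to the lowest
priority; the second item (if there is one) goes to the highest priority agent reporting it
in the new order. `τ r` is the agent in place `r`. -/
def heldOutMech (X : HeldOut m) (τ : Equiv.Perm (Fin n)) (R : Fin n → Finset (Fin m)) :
    Fin n → Finset (Fin m) :=
  let L := (List.finRange n).map τ
  let w₁ := winner L R X.1
  fun v =>
    (if w₁ = some v then {X.1} else ∅) ∪
      X.2.toFinset.filter fun y => winner (demote L w₁) R y = some v

end HeldOut

/-! ### The randomized mechanism -/

section Randomized

variable {n m : ℕ}

/-- A realization of the coin tosses: the held-out items and the priority order. -/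
abbrev Coins (n m : ℕ) := HeldOut m × Equiv.Perm (Fin n)

/-- With probability `1 - 1/m` a uniformly random item `y ≠ x`, and otherwise no second item.
If `m = 1` there is no such `y`, and `1 - 1/m = 0`. -/
def secondItem (x : Fin m) : PMF (Option (Fin m)) :=
  if h : (univ.erase x).Nonempty then
    (PMF.bernoulli (1 - 1 / (m : ℝ≥0)) tsub_le_self).bind fun b =>
      if b then (PMF.uniformOfFinset (univ.erase x) h).map some else PMF.pure none
  else PMF.pure none

/-- The distribution of the coin tosses: a uniform first item, possibly a second item, and
independently a uniformly random priority order. -/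
def coins (n m : ℕ) [NeZero m] : PMF (Coins n m) :=
  (PMF.uniformOfFintype (Fin m)).bind fun x =>
    (secondItem x).bind fun y =>
      (PMF.uniformOfFintype (Equiv.Perm (Fin n))).map fun σ => ((x, y), σ)

/-- The allocation that the mechanism returns on the reported demand sets `R` when the coin tosses
are `ω`: PE with order `σ` on the items not held out, and the held-out items by the
reverse order. -/
def mech (pe : PERule n m) (R : Fin n → Finset (Fin m)) (ω : Coins n m) :
    Fin n → Finset (Fin m) :=
  fun v =>
    peWith pe ω.2 (fun u => R u \ heldSet ω.1) v ∪
      heldOutMech ω.1 (Fin.revPerm.trans ω.2) (fun u => R u ∩ heldSet ω.1) v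

/-- The expected value, to an agent `v` with valuation `f`, of the bundle she receives when the
reports are `R`. -/
def expectedValue [NeZero m] (pe : PERule n m) (R : Fin n → Finset (Fin m)) (f : Valuation (Fin m))
    (v : Fin n) : ℝ :=
  ∑ ω : Coins n m, (coins n m ω).toReal * f (mech pe R ω v)

end Randomized

/-! ### A randomized random-access machine with a step count

The memory consists of two-dimensional tables of natural numbers; a program mentions finitely
many tables. There is addition and truncated subtraction but no multiplication, so that
`T` steps produce numbers of at most `O(T)` more bits and unit cost is polynomially equivalent to
bit cost. -/

/-- `mem t i j` is the entry `(i, j)` of the table `t`. -/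
abbrev Memory := ℕ → ℕ → ℕ → ℕ

inductive Expr where
  | const (k : ℕ) : Expr
  | get (t : ℕ) (i j : Expr) : Expr
  | add (e₁ e₂ : Expr) : Expr
  | sub (e₁ e₂ : Expr) : Expr

def Expr.eval (s : Memory) : Expr → ℕ
  | .const k => k
  | .get t i j => s t (i.eval s) (j.eval s)
  | .add e₁ e₂ => e₁.eval s + e₂.eval s
  | .sub e₁ e₂ => e₁.eval s - e₂.eval s

/-- Programs. `assign t i j e` writes the value of `e` to the entry `(i, j)` of the table `t`;
`rand t i j e` writes there a uniformly random number between `0` and the value of `e` (inclusive);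
`cond e p q` runs `p` if `e` is nonzero and `q` otherwise; `loop e p` repeats `p` while `e` is
nonzero. -/
inductive Program where
  | assign (t : ℕ) (i j e : Expr) : Program
  | rand (t : ℕ) (i j e : Expr) : Program
  | seq (p q : Program) : Program
  | cond (e : Expr) (p q : Program) : Program
  | loop (e : Expr) (p : Program) : Program

def Memory.write (s : Memory) (t i j k : ℕ) : Memory :=
  fun t' i' j' => if t' = t ∧ i' = i ∧ j' = j then k else s t' i' j'

/-- A configuration: the programs that remain to be run, in this order, and the memory.
The machine has halted when nothing remains to be run. -/
abbrev Config := List Program × Memory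

/-- One step of the machine. -/
def step : Config → PMF Config
  | ([], s) => PMF.pure ([], s)
  | (.assign t i j e :: K, s) => PMF.pure (K, s.write t (i.eval s) (j.eval s) (e.eval s))
  | (.rand t i j e :: K, s) =>
      (PMF.uniformOfFintype (Fin (e.eval s + 1))).map fun k =>
        (K, s.write t (i.eval s) (j.eval s) k)
  | (.seq p q :: K, s) => PMF.pure (p :: q :: K, s)
  | (.cond e p q :: K, s) => PMF.pure (if e.eval s ≠ 0 then (p :: K, s) else (q :: K, s))
  | (.loop e p :: K, s) =>
      PMF.pure (if e.eval s ≠ 0 then (p :: .loop e p :: K, s) else (K, s))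

/-- The distribution of the configuration after `T` steps. -/
def run : ℕ → Config → PMF Config
  | 0, c => PMF.pure c
  | T + 1, c => (step c).bind (run T)

section Encoding

variable {n m : ℕ}

/-- The input: `n` in table `0` and `m` in table `1` (at entry `(0, 0)`), and the reports as a
`0`/`1` matrix in table `2`; everything else is `0`. -/
def inputMemory (R : Fin n → Finset (Fin m)) : Memory := fun t i j =>
  if t = 0 ∧ i = 0 ∧ j = 0 then n
  else if t = 1 ∧ i = 0 ∧ j = 0 then m
  else if t = 2 ∧ ∃ (v : Fin n) (a : Fin m), v.val = i ∧ a.val = j ∧ a ∈ R v then 1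
  else 0

/-- The output: the allocation as a `0`/`1` matrix in table `3`. -/
def outputAllocation (s : Memory) : Fin n → Finset (Fin m) :=
  fun v => univ.filter fun a => s 3 v a = 1

end Encoding

/-- The program `P`, on the reports `R`, halts within `T` steps whatever the outcome of its random
choices, and its output is distributed as the output of the mechanism based on `pe`. -/
def RunsMechIn {n m : ℕ} [NeZero m] (P : Program) (T : ℕ) (pe : PERule n m)
    (R : Fin n → Finset (Fin m)) : Prop :=
  (∀ c ∈ (run T ([P], inputMemory R)).support, c.1 = []) ∧
    (run T ([P], inputMemory R)).map (fun c => (outputAllocation c.2 : Fin n → Finset (Fin m))) =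
      (coins n m).map (mech pe R)

end FairAllocation

end

/-!
# Truthful and fair allocation of items to leveled agents

**PE outcomes.** Everything about a PE mechanism is read off a combinatorial description of its
outcomes, `IsEgalitarian`: the bundles are disjoint sets of reported items, and every agent `i` lies
in a set `C` of agents that is *tight*, meaning that `C` holds all items that its members report,
while no member `j` of `C` is better off than `i` would be with one more item. Comparisons use the
numbers `n * #(A j) + j`, which order the utilities with auxiliary items. Such an allocation
Lorenz dominates all others: Lorenz domination amounts to a comparison of the total shortfalls from
every threshold, and these are bounded by linear programming duality, with weights taken from the
tight sets (`IsEgalitarian.sum_shortfall_le`). Conversely, the sorted utilities of all Lorenz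
dominating allocations agree, the auxiliary values tell the agents apart, and tightness depends only
on the sizes of the bundles; so if one egalitarian allocation exists, then every PE outcome is
egalitarian (`IsPEOutcome.isEgalitarian`). Existence comes from the greedy algorithm below.

**Ex-post properties.** In an egalitarian allocation no agent increases the number of items of her
demand by misreporting (`IsEgalitarian.card_inter_le`), all reported items are allocated, and an
agent who wants some item of a bundle holds at most one item less than that bundle. The mechanism
for the held-out items has the same properties, and since it uses the reverse order,
the two advantages of one item do not add up (`card_mech_inter_le_succ`). For a leveled valuation
numbers of demanded items and values agree up to the factor `1 + ε`, which gives the ex-post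
guarantees; the maximin share is bounded by the pigeonhole principle.

**Expectations.** The coins are equivalent to three independent uniform draws of two items, where a
repetition means that there is no second one, and of a priority order (`coins_eq_bind`). If
another agent competes for the demand of `v`, then every misreport of `v` loses a demanded item for
some held-out items and all orders in which `v` is the first to choose among them (`exists_gain`).
This event has probability at least `1 / (n * m ^ 2)`, which outweighs `ε * m`, the most that the
differences between the values of demanded items can amount to. Without competition
the truth yields the whole demand. Proportionality is similar: the sizes that an agent is guaranteed
in her place sum to the size of her demand over all places, and unless all reports coincide, in
which case symmetry gives an exact share, there is an event in which she gets one item more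
(`exists_bonus`).

**The program.** The PE rule is computed greedily. In rounds and by priority, each agent receives
one further item if an augmenting path from her to an unallocated item exists; if not, the agents
that a search from the unallocated items does not reach form a tight set, which certifies the agent
for good (`Greedy`). The priority order is obtained from a product of `n` random transpositions
(`map_shuffle_draws`). Programs are verified by rules for total correctness with time bounds
`L ^ k`, where `L = n + m + 10` (`Ends`), and by the fact that a run depends on, and changes, only
the tables that occur in the program. Since the random draws take a fixed number of steps and the
rest is deterministic, the distribution of the output is that of the mechanism
(`runsMechIn_mechProg`).
-/

namespace FairAllocation

/-! ### Egalitarian allocations -/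

section Egalitarian

variable {n m : ℕ}

/-- A set `C` of agents is tight in the allocation `A` if every item reported by a member of `C` is
held by a member of `C`. -/
def IsTight (R A : Fin n → Finset (Fin m)) (C : Finset (Fin n)) : Prop :=
  ∀ j ∈ C, R j ⊆ C.biUnion A

/-- Combinatorial form of the outcomes of a PE mechanism: every agent `i` lies in a tight set
none of whose members `j` is better off than `i` would be with one more item. Utilities are compared
by means of the numbers `n * #(A j) + j`, which encode the auxiliary items. -/
structure IsEgalitarian (R A : Fin n → Finset (Fin m)) : Prop where
  sub : ∀ i, A i ⊆ R i
  disj : IsAllocation A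
  cert : ∀ i, ∃ C : Finset (Fin n), i ∈ C ∧ IsTight R A C ∧
    ∀ j ∈ C, n * #(A j) + j ≤ n * #(A i) + n + i

lemma card_biUnion_eq_sum {A : Fin n → Finset (Fin m)} (hd : IsAllocation A)
    (C : Finset (Fin n)) : #(C.biUnion A) = ∑ j ∈ C, #(A j) :=
  card_biUnion fun i _ j _ hij => hd i j hij

lemma isTight_iff_card {R A : Fin n → Finset (Fin m)} (hs : ∀ i, A i ⊆ R i) (hd : IsAllocation A)
    (C : Finset (Fin n)) : IsTight R A C ↔ #(C.biUnion R) ≤ ∑ j ∈ C, #(A j) := by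
  rw [← card_biUnion_eq_sum hd]
  have h1 : C.biUnion A ⊆ C.biUnion R := biUnion_mono fun i _ => hs i
  constructor
  · intro h
    exact card_le_card (biUnion_subset.2 h)
  · intro h
    have := eq_of_subset_of_card_le h1 h
    intro j hj
    rw [this]
    exact subset_biUnion_of_mem R hj

/-- Tightness depends only on the numbers of items that the agents get. -/
lemma IsTight.congr_card {R A B : Fin n → Finset (Fin m)} {C : Finset (Fin n)}
    (h : IsTight R A C) (hA : ∀ i, A i ⊆ R i) (hdA : IsAllocation A) (hB : ∀ i, B i ⊆ R i)
    (hdB : IsAllocation B) (hc : ∀ j ∈ C, #(A j) = #(B j)) : IsTight R B C := by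
  rw [isTight_iff_card hB hdB, ← sum_congr rfl hc]
  exact (isTight_iff_card hA hdA C).1 h

lemma IsEgalitarian.congr_card {R A B : Fin n → Finset (Fin m)} (h : IsEgalitarian R A)
    (hB : ∀ i, B i ⊆ R i) (hdB : IsAllocation B) (hc : ∀ j, #(A j) = #(B j)) :
    IsEgalitarian R B := by
  refine ⟨hB, hdB, fun i => ?_⟩
  obtain ⟨C, hi, hC, hk⟩ := h.cert i
  exact ⟨C, hi, hC.congr_card h.sub h.disj hB hdB fun j _ => hc j, fun j hj => by
    rw [← hc j, ← hc i]; exact hk j hj⟩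

lemma IsEgalitarian.exists_owner {R A : Fin n → Finset (Fin m)} (h : IsEgalitarian R A)
    {i : Fin n} {a : Fin m} (ha : a ∈ R i) : ∃ j, a ∈ A j := by
  obtain ⟨C, hi, hC, -⟩ := h.cert i
  obtain ⟨j, -, hj⟩ := mem_biUnion.1 (hC i hi ha)
  exact ⟨j, hj⟩

/-- If `i` wants an item of `j`, then the bundle of `j` is not better than the one of `i` with one
more item. -/
lemma IsEgalitarian.key_le {R A : Fin n → Finset (Fin m)} (h : IsEgalitarian R A)
    {i j : Fin n} {a : Fin m} (ha : a ∈ R i) (hj : a ∈ A j) :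
    n * #(A j) + j ≤ n * #(A i) + n + i := by
  obtain ⟨C, hi, hC, hk⟩ := h.cert i
  obtain ⟨k, hkC, hka⟩ := mem_biUnion.1 (hC i hi ha)
  have : k = j := by
    by_contra hne
    exact disjoint_left.1 (h.disj k j hne) hka hj
  exact hk j (this ▸ hkC)

/-- Linear programming bound: if the weights never decrease from an agent to the holder of an item
that she wants, then no allocation has a larger weighted number of wanted items. -/
lemma sum_weight_le {R A B : Fin n → Finset (Fin m)} (hdB : IsAllocation B) (l : Fin n → ℝ)
    (h0 : ∀ i, 0 ≤ l i) (hown : ∀ i, ∀ a ∈ R i, ∃ j, a ∈ A j ∧ l i ≤ l j) :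
    ∑ i, l i * #(B i ∩ R i) ≤ ∑ i, l i * #(A i) := by
  classical
  let L : Fin m → ℝ := fun a => ∑ j, if a ∈ A j then l j else 0
  have hL0 : ∀ a, 0 ≤ L a := fun a => sum_nonneg fun j _ => by
    split_ifs
    exacts [h0 j, le_rfl]
  have e1 : ∑ i, l i * #(B i ∩ R i) ≤ ∑ i, ∑ a ∈ B i ∩ R i, L a := by
    refine sum_le_sum fun i _ => ?_
    rw [mul_comm, ← nsmul_eq_mul, ← sum_const]
    refine sum_le_sum fun a ha => ?_
    obtain ⟨j, hj, hij⟩ := hown i a (mem_inter.1 ha).2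
    refine hij.trans ?_
    have := single_le_sum (f := fun j => if a ∈ A j then l j else 0) (s := univ) (fun j _ => by
      split_ifs
      exacts [h0 j, le_rfl]) (mem_univ j)
    simpa [hj] using this
  have e2 : ∑ i, ∑ a ∈ B i ∩ R i, L a = ∑ a ∈ univ.biUnion (fun i => B i ∩ R i), L a := by
    refine (sum_biUnion fun i _ j _ hij => ?_).symm
    exact (hdB i j hij).mono inter_subset_left inter_subset_left
  have e3 : ∑ a ∈ univ.biUnion (fun i => B i ∩ R i), L a ≤ ∑ a, L a :=
    sum_le_sum_of_subset_of_nonneg (subset_univ _) fun a _ _ => hL0 a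
  have e4 : ∑ a, L a = ∑ i, l i * #(A i) := by
    simp only [L]
    rw [sum_comm]
    refine sum_congr rfl fun j _ => ?_
    rw [← sum_filter]
    simp [mul_comm]
  linarith

lemma IsEgalitarian.sum_card_le {R A B : Fin n → Finset (Fin m)} (h : IsEgalitarian R A)
    (hdB : IsAllocation B) : ∑ i, #(B i ∩ R i) ≤ ∑ i, #(A i) := by
  have := sum_weight_le (R := R) (A := A) hdB (fun _ => (1 : ℝ)) (fun _ => zero_le_one)
    (fun i a ha => (h.exists_owner ha).imp fun j hj => ⟨hj, le_rfl⟩)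
  simp only [one_mul] at this
  exact_mod_cast this

/-! ### Lorenz domination by way of shortfalls -/

/-- The amount by which `x` falls short of `t`. -/
def shortfall (t x : ℝ) : ℝ := max (t - x) 0

/-- By convexity, the line of slope `-l` through the shortfall at `u` stays below the shortfall at
all points `u + k` if `l` lies between the drops of the shortfall in the unit steps after and
before `u`. -/
lemma shortfall_add_int (t u : ℝ) (k : ℤ) (l : ℝ)
    (h1 : shortfall t u - shortfall t (u + 1) ≤ l)
    (h2 : l ≤ shortfall t (u - 1) - shortfall t u) :
    shortfall t u - l * k ≤ shortfall t (u + k) := by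
  unfold shortfall at *
  rcases lt_trichotomy k 0 with hk | rfl | hk
  · have hk' : (k : ℝ) ≤ -1 := by exact_mod_cast (by omega : k ≤ -1)
    rcases le_total (t - (u - 1)) 0 with h | h
    · rw [max_eq_right h, max_eq_right (by linarith)] at h2
      rw [max_eq_right (a := t - u) (by linarith)]
      nlinarith [le_max_right (t - (u + k)) 0]
    · rw [max_eq_left h] at h2
      rcases le_total (t - u) 0 with h' | h'
      · rw [max_eq_right h'] at *
        nlinarith [le_max_left (t - (u + k)) 0]
      · rw [max_eq_left h'] at *
        nlinarith [le_max_left (t - (u + k)) 0]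
  · simp
  · have hk' : (1 : ℝ) ≤ k := by exact_mod_cast hk
    rcases le_total (t - (u + 1)) 0 with h | h
    · rw [max_eq_right h] at h1
      rcases le_total (t - u) 0 with h' | h'
      · rw [max_eq_right h'] at *
        nlinarith [le_max_right (t - (u + k)) 0]
      · rw [max_eq_left h'] at *
        nlinarith [le_max_right (t - (u + k)) 0]
    · rw [max_eq_left h, max_eq_left (by linarith)] at h1
      rw [max_eq_left (a := t - u) (by linarith)]
      nlinarith [le_max_left (t - (u + k)) 0]

lemma shortfall_antitone (t : ℝ) : Antitone (shortfall t) := fun _ _ h =>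
  max_le_max (by linarith) le_rfl

lemma sum_comp_sorted (u : Fin n → ℝ) (g : ℝ → ℝ) : ∑ i, g (sorted u i) = ∑ i, g (u i) :=
  Equiv.sum_comp (Tuple.sort u) fun i => g (u i)

lemma sorted_mono (u : Fin n → ℝ) : Monotone (sorted u) := Tuple.monotone_sort u

/-- The sum of the `k` smallest entries of `u` is the maximum over `t` of `k * t` minus the total
shortfall from `t`, which is attained at the `k`-th smallest entry. -/
lemma lorenzGE_of_shortfall {u w : Fin n → ℝ}
    (h : ∀ t, ∑ i, shortfall t (u i) ≤ ∑ i, shortfall t (w i)) : LorenzGE u w := by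
  intro k
  set t := sorted w k with ht
  have e1 : ∑ i ∈ Iic k, sorted w i = #(Iic k) * t - ∑ i, shortfall t (w i) := by
    rw [← sum_comp_sorted w, ← sum_subset (subset_univ (Iic k)), ← nsmul_eq_mul, ← sum_const,
      ← sum_sub_distrib]
    · refine sum_congr rfl fun i hi => ?_
      have := sorted_mono w (mem_Iic.1 hi)
      rw [shortfall, max_eq_left (by linarith)]
      ring
    · intro i _ hi
      have := sorted_mono w (le_of_lt (not_le.1 (mt mem_Iic.2 hi)))
      rw [shortfall, max_eq_right (by linarith)]
  have e2 : #(Iic k) * t - ∑ i, shortfall t (u i) ≤ ∑ i ∈ Iic k, sorted u i := by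
    rw [← sum_comp_sorted u, sub_le_iff_le_add]
    calc (#(Iic k) * t : ℝ) = ∑ i ∈ Iic k, t := by simp
      _ ≤ ∑ i ∈ Iic k, (sorted u i + shortfall t (sorted u i)) := by
        refine sum_le_sum fun i _ => ?_
        have := le_max_left (t - sorted u i) 0
        unfold shortfall
        linarith
      _ = ∑ i ∈ Iic k, sorted u i + ∑ i ∈ Iic k, shortfall t (sorted u i) := sum_add_distrib
      _ ≤ _ := by
        refine add_le_add_right ?_ _
        exact sum_le_sum_of_subset_of_nonneg (subset_univ _) fun _ _ _ => le_max_right _ _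
  linarith [h t]

lemma sorted_eq_of_lorenzGE {u w : Fin n → ℝ} (h1 : LorenzGE u w) (h2 : LorenzGE w u) :
    sorted u = sorted w := by
  funext k
  induction k using WellFoundedLT.induction with
  | ind k ih =>
    have e : ∀ v : Fin n → ℝ, ∑ i ∈ Iic k, v i = v k + ∑ i ∈ Iio k, v i := by
      intro v
      rw [← Iio_insert k, sum_insert (by simp)]
    have := le_antisymm (h2 k) (h1 k)
    rw [e, e, sum_congr rfl fun i hi => ih i (mem_Iio.1 hi)] at this
    linarith

/-- The shortfalls are smallest in an egalitarian allocation, for every choice of auxiliary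
values `c`: the weight of `i` is the largest loss of shortfall that one more item
would bring to an agent whose tight set contains `i`. -/
lemma IsEgalitarian.sum_shortfall_le {R A B : Fin n → Finset (Fin m)} (h : IsEgalitarian R A)
    (hdB : IsAllocation B) (c : Fin n → ℝ)
    (hc : ∀ i j : Fin n, n * #(A j) + j ≤ n * #(A i) + n + i →
      (#(A j) : ℝ) + c j ≤ #(A i) + c i + 1) (t : ℝ) :
    ∑ i, shortfall t (#(A i) + c i) ≤ ∑ i, shortfall t (#(B i ∩ R i) + c i) := by
  classical
  choose C hmem hC hkey using h.cert
  let r : Fin n → ℝ := fun i => shortfall t (#(A i) + c i) - shortfall t (#(A i) + c i + 1)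
  have hr0 : ∀ i, 0 ≤ r i := fun i => sub_nonneg.2 (shortfall_antitone t (by linarith))
  have hne : ∀ i, (univ.filter fun k => i ∈ C k).Nonempty := fun i => ⟨i, by simp [hmem]⟩
  let l : Fin n → ℝ := fun i => (univ.filter fun k => i ∈ C k).sup' (hne i) r
  have hrl : ∀ i k, i ∈ C k → r k ≤ l i := fun i k hk => le_sup' r (by simp [hk])
  have hlin := sum_weight_le (R := R) (A := A) hdB l
    (fun i => (hr0 i).trans (hrl i i (hmem i))) (by
      intro i a ha
      obtain ⟨j, hj⟩ := h.exists_owner ha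
      refine ⟨j, hj, sup'_le _ _ fun k hk => hrl j k ?_⟩
      obtain ⟨j', hj', hj'a⟩ := mem_biUnion.1 (hC k i (by simpa using hk) ha)
      by_contra hcon
      have hne : j ≠ j' := by
        rintro rfl
        exact hcon hj'
      exact disjoint_left.1 (h.disj _ _ hne) hj hj'a)
  have hpt : ∀ i, shortfall t (#(A i) + c i) - l i * (#(B i ∩ R i) - #(A i)) ≤
      shortfall t (#(B i ∩ R i) + c i) := by
    intro i
    have := shortfall_add_int t (#(A i) + c i) ((#(B i ∩ R i) : ℤ) - #(A i)) (l i)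
      (hrl i i (hmem i)) (by
        refine sup'_le _ _ fun k hk => ?_
        have hik := hc k i (hkey k i (by simpa using hk))
        -- the shortfall is convex
        simp only [r, shortfall]
        rcases le_total (t - (#(A i) + c i)) 0 with h1 | h1 <;>
        rcases le_total (t - (#(A i) + c i - 1)) 0 with h2 | h2 <;>
        rcases le_total (t - (#(A k) + c k)) 0 with h3 | h3 <;>
        rcases le_total (t - (#(A k) + c k + 1)) 0 with h4 | h4 <;>
        simp only [max_eq_left, max_eq_right, h1, h2, h3, h4] <;> linarith)
    push_cast at this
    convert this using 2
    ring
  have := sum_le_sum fun i (_ : i ∈ univ) => hpt i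
  rw [sum_sub_distrib] at this
  simp only [mul_sub, sum_sub_distrib] at this
  linarith

end Egalitarian

/-! ### Outcomes of PE mechanisms are the egalitarian allocations -/

section PEOutcome

variable {n m : ℕ}

lemma original_disjSum (S : Finset (Fin m)) (T : Finset (Fin n)) : original (S.disjSum T) = S := by
  ext a
  simp [original]

lemma auxVal_demandVal (R : Fin n → Finset (Fin m)) (i : Fin n) (S : Finset (Fin m ⊕ Fin n)) :
    auxVal (fun i => demandVal (R i)) i S =
      #(original S ∩ R i) + if Sum.inr i ∈ S then ((i : ℝ) + 1) / (n : ℝ) ^ 2 else 0 := rfl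

lemma isAllocation_original {A : Fin n → Finset (Fin m ⊕ Fin n)} (h : IsAllocation A) :
    IsAllocation fun i => original (A i) := by
  intro i j hij
  rw [disjoint_left]
  intro a ha hb
  simp only [original, mem_filter, mem_univ, true_and] at ha hb
  exact disjoint_left.1 (h i j hij) ha hb

lemma demandVal_nonRedundant_iff {R A : Fin n → Finset (Fin m)} :
    IsNonRedundant (fun i => demandVal (R i)) A ↔ ∀ i, A i ⊆ R i := by
  constructor
  · intro h i a ha
    by_contra hR
    refine (h i a ha).ne ?_
    change (#((A i).erase a ∩ R i) : ℝ) = #(A i ∩ R i)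
    rw [erase_inter, erase_eq_of_notMem (by simp [hR])]
  · intro h i a ha
    change (#((A i).erase a ∩ R i) : ℝ) < #(A i ∩ R i)
    rw [erase_inter]
    exact_mod_cast card_erase_lt_of_mem (mem_inter.2 ⟨ha, h i ha⟩)

/-- The comparison of the numbers `n * #(A j) + j` in terms of utilities with auxiliary items. -/
lemma aux_le {i j : Fin n} {a b : ℕ} (h : n * b + j ≤ n * a + n + i) :
    (b : ℝ) + ((j : ℝ) + 1) / (n : ℝ) ^ 2 ≤ a + ((i : ℝ) + 1) / (n : ℝ) ^ 2 + 1 := by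
  have hn : 0 < n := i.pos
  have hi := i.2
  have hj := j.2
  have hn' : (0 : ℝ) < (n : ℝ) ^ 2 := by positivity
  have key : b * n ^ 2 + (j + 1) ≤ a * n ^ 2 + (i + 1) + n ^ 2 := by
    rcases lt_or_ge a b with h1 | h1
    · have : b = a + 1 := by
        by_contra hne
        have : a + 2 ≤ b := by omega
        have : n * (a + 2) ≤ n * b := Nat.mul_le_mul_left _ this
        nlinarith
      subst this
      nlinarith
    · have : b * n ^ 2 ≤ a * n ^ 2 := Nat.mul_le_mul_right _ h1
      nlinarith
  have key' : (b : ℝ) * n ^ 2 + (j + 1) ≤ a * n ^ 2 + (i + 1) + n ^ 2 := by exact_mod_cast key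
  rw [← mul_le_mul_iff_of_pos_right hn']
  field_simp
  linarith

/-- Distinct agents have auxiliary values that differ modulo one. -/
lemma aux_injective (hn : 2 ≤ n) {i j : Fin n} {a b : ℕ}
    (h : (b : ℝ) + ((j : ℝ) + 1) / (n : ℝ) ^ 2 = a + ((i : ℝ) + 1) / (n : ℝ) ^ 2) :
    j = i ∧ b = a := by
  have hn' : (0 : ℝ) < (n : ℝ) ^ 2 := by positivity
  have key : b * n ^ 2 + (j + 1) = a * n ^ 2 + (i + 1) := by
    field_simp at h
    have h' : (b : ℝ) * n ^ 2 + (j + 1) = a * n ^ 2 + (i + 1) := by linarith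
    exact_mod_cast h'
  have hi : (i : ℕ) + 1 < n ^ 2 := by nlinarith [i.2]
  have hj : (j : ℕ) + 1 < n ^ 2 := by nlinarith [j.2]
  have hab : b = a := by
    rcases lt_trichotomy a b with h1 | h1 | h1
    · have : (a + 1) * n ^ 2 ≤ b * n ^ 2 := Nat.mul_le_mul_right _ h1
      nlinarith
    · exact h1.symm
    · have : (b + 1) * n ^ 2 ≤ a * n ^ 2 := Nat.mul_le_mul_right _ h1
      nlinarith
  subst hab
  exact ⟨Fin.ext (by omega), rfl⟩

lemma IsEgalitarian.isLorenzDominating {R A : Fin n → Finset (Fin m)} (h : IsEgalitarian R A) :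
    IsLorenzDominating (auxVal fun i => demandVal (R i)) fun i => (A i).disjSum {i} := by
  refine ⟨fun i j hij => ?_, fun B hB => lorenzGE_of_shortfall fun t => ?_⟩
  · rw [disjoint_left]
    rintro (a | k) ha hb
    · simp only [inl_mem_disjSum] at ha hb
      exact disjoint_left.1 (h.disj i j hij) ha hb
    · simp only [inr_mem_disjSum, mem_singleton] at ha hb
      exact hij (ha.symm.trans hb)
  · have := h.sum_shortfall_le (isAllocation_original hB) (fun i => ((i : ℝ) + 1) / (n : ℝ) ^ 2)
      (fun i j hij => aux_le hij) t
    refine le_trans (le_of_eq ?_) (this.trans ?_)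
    · refine sum_congr rfl fun i _ => ?_
      rw [auxVal_demandVal, original_disjSum, inter_eq_left.2 (h.sub i), if_pos (by simp)]
    · refine sum_le_sum fun i _ => shortfall_antitone t ?_
      rw [auxVal_demandVal]
      gcongr
      split_ifs
      · exact le_rfl
      · positivity

theorem IsEgalitarian.isPEOutcome {R A : Fin n → Finset (Fin m)} (h : IsEgalitarian R A) :
    IsPEOutcome (fun i => demandVal (R i)) A :=
  ⟨demandVal_nonRedundant_iff.2 h.sub, _, h.isLorenzDominating,
    fun _ => (original_disjSum _ _).symm⟩

/-- A Lorenz dominating allocation has the same sorted utilities as the one obtained from an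
egalitarian allocation; the auxiliary values tell which agent has which utility. -/
theorem IsPEOutcome.isEgalitarian (hn : 2 ≤ n) {R A E : Fin n → Finset (Fin m)}
    (h : IsPEOutcome (fun i => demandVal (R i)) A) (hE : IsEgalitarian R E) :
    IsEgalitarian R A := by
  obtain ⟨hnr, A', ⟨hA', hdom⟩, hor⟩ := h
  have hsub := demandVal_nonRedundant_iff.1 hnr
  have hdA : IsAllocation A := by
    rw [funext hor]
    exact isAllocation_original hA'
  refine hE.congr_card hsub hdA fun i => ?_
  have hEd := hE.isLorenzDominating
  have hs := sorted_eq_of_lorenzGE (hdom _ hEd.1) (hEd.2 _ hA')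
  have huE : ∀ i, auxVal (fun i => demandVal (R i)) i ((E i).disjSum {i}) =
      #(E i) + ((i : ℝ) + 1) / (n : ℝ) ^ 2 := fun i => by
    rw [auxVal_demandVal, original_disjSum, inter_eq_left.2 (hE.sub i), if_pos (by simp)]
  have huA : ∀ i, auxVal (fun i => demandVal (R i)) i (A' i) =
      #(A i) + if Sum.inr i ∈ A' i then ((i : ℝ) + 1) / (n : ℝ) ^ 2 else 0 := fun i => by
    rw [auxVal_demandVal, ← hor, inter_eq_left.2 (hsub i)]
  have hle : ∑ i, (#(A i) : ℝ) ≤ ∑ i, (#(E i) : ℝ) := by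
    have := hE.sum_card_le hdA
    simp only [inter_eq_left.2 (hsub _)] at this
    exact_mod_cast this
  have hsum := sum_comp_sorted (fun i => auxVal (fun i => demandVal (R i)) i (A' i)) id
  rw [hs, sum_comp_sorted] at hsum
  simp only [id, huE, huA, sum_add_distrib] at hsum
  have hpos : ∀ i : Fin n, 0 < ((i : ℝ) + 1) / (n : ℝ) ^ 2 := fun i => by positivity
  have hall : ∀ i, Sum.inr i ∈ A' i := by
    by_contra! hcon
    obtain ⟨k, hk⟩ := hcon
    have : ∑ i, (if Sum.inr i ∈ A' i then ((i : ℝ) + 1) / (n : ℝ) ^ 2 else 0) <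
        ∑ i : Fin n, ((i : ℝ) + 1) / (n : ℝ) ^ 2 := by
      refine sum_lt_sum (fun i _ => ?_) ⟨k, mem_univ _, ?_⟩
      · split_ifs
        exacts [le_rfl, (hpos i).le]
      · rw [if_neg hk]
        exact hpos k
    linarith
  set uE : Fin n → ℝ := fun v => auxVal (fun i => demandVal (R i)) v ((E v).disjSum {v}) with hdefE
  set uA : Fin n → ℝ := fun v => auxVal (fun i => demandVal (R i)) v (A' v) with hdefA
  have hk := congrFun hs ((Tuple.sort uE).symm i)
  simp only [sorted, Function.comp, Equiv.apply_symm_apply] at hk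
  rw [hdefE, hdefA] at hk
  simp only [huE, huA, hall, if_true] at hk
  obtain ⟨e1, e2⟩ := aux_injective hn hk
  rw [e1] at e2
  exact e2.symm

end PEOutcome

/-! ### Truthfulness and envy in egalitarian allocations -/

section Truthful

variable {n m : ℕ}

/-- An agent does not get more items of her demand by misreporting. Otherwise let `C` be
her tight set under the truth, and `U` the union of the tight sets, under the misreport, of the
members of `C` who lose items. If she is not in `U`, then `C \ U` receives more items
under the misreport than it could hold under the truth; if she is, then the comparisons of
utilities that the two tight sets provide contradict each other. -/
theorem IsEgalitarian.card_inter_le {R A B : Fin n → Finset (Fin m)} {v : Fin n}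
    {D S : Finset (Fin m)} (hA : IsEgalitarian (Function.update R v D) A)
    (hB : IsEgalitarian (Function.update R v S) B) : #(B v ∩ D) ≤ #(A v) := by
  classical
  by_contra! hlt
  obtain ⟨C, hvC, hC, hkC⟩ := hA.cert v
  choose T hmem hT hkT using hB.cert
  have hRA : ∀ j, j ≠ v → Function.update R v D j = R j := fun j hj => by simp [hj]
  have hRB : ∀ j, j ≠ v → Function.update R v S j = R j := fun j hj => by simp [hj]
  let Z := C.filter fun z => #(B z) < #(A z)
  by_cases hz : ∃ z ∈ Z, v ∈ T z
  · obtain ⟨z, hzZ, hvz⟩ := hz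
    obtain ⟨hzC, hzlt⟩ := mem_filter.1 hzZ
    have k1 := hkC z hzC
    have k2 := hkT z v hvz
    have hBv : #(B v ∩ D) ≤ #(B v) := card_le_card inter_subset_left
    have k3 : n * (#(B z) + 1) ≤ n * #(A z) := Nat.mul_le_mul_left _ hzlt
    have k4 : n * (#(A v) + 1) ≤ n * #(B v) := Nat.mul_le_mul_left _ (by omega)
    have e : n * #(A z) + z = n * (#(A v) + 1) + v := by
      rw [mul_add, mul_one] at *
      omega
    have hzv : z = v := by
      have := congrArg (· % n) e
      simp only [Nat.mul_add_mod, Nat.mod_eq_of_lt z.2, Nat.mod_eq_of_lt v.2] at this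
      exact Fin.ext this
    subst hzv
    omega
  · push Not at hz
    let U := Z.biUnion T
    have hvU : v ∉ U := by simpa [U] using hz
    have hUown : ∀ j ∈ U, ∀ a ∈ A j, ∃ k ∈ U, a ∈ B k := by
      intro j hj a ha
      obtain ⟨z, hz, hjz⟩ := mem_biUnion.1 hj
      have hjv : j ≠ v := fun e => hvU (e ▸ hj)
      have haR : a ∈ Function.update R v S j := by
        rw [hRB j hjv, ← hRA j hjv]
        exact hA.sub j ha
      obtain ⟨k, hk, hak⟩ := mem_biUnion.1 (hT z j hjz haR)
      exact ⟨k, mem_biUnion.2 ⟨z, hz, hk⟩, hak⟩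
    let B' : Fin n → Finset (Fin m) := fun j => if j = v then B v ∩ D else B j
    have hB'sub : ∀ j, B' j ⊆ B j := fun j => by
      by_cases h : j = v
      · subst h
        simp [B']
      · simp [B', h]
    have hB'A : ∀ j, B' j ⊆ Function.update R v D j := fun j => by
      by_cases h : j = v
      · subst h
        simp [B']
      · simp only [B', h, if_false]
        rw [hRA j h, ← hRB j h]
        exact hB.sub j
    have hdB' : IsAllocation B' := fun i j hij => (hB.disj i j hij).mono (hB'sub i) (hB'sub j)
    have hsub : (C \ U).biUnion B' ⊆ (C \ U).biUnion A := by
      intro a ha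
      obtain ⟨j, hj, haj⟩ := mem_biUnion.1 ha
      obtain ⟨hjC, hjU⟩ := mem_sdiff.1 hj
      obtain ⟨k, hk, hak⟩ := mem_biUnion.1 (hC j hjC (hB'A j haj))
      refine mem_biUnion.2 ⟨k, mem_sdiff.2 ⟨hk, fun hkU => ?_⟩, hak⟩
      obtain ⟨l, hl, hal⟩ := hUown k hkU a hak
      have hjl : j ≠ l := fun e => hjU (e ▸ hl)
      exact disjoint_left.1 (hB.disj j l hjl) (hB'sub j haj) hal
    have hcard := card_le_card hsub
    rw [card_biUnion_eq_sum hdB', card_biUnion_eq_sum hA.disj] at hcard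
    refine absurd hcard (not_le.2 (sum_lt_sum (fun j hj => ?_) ⟨v, by simp [hvC, hvU], ?_⟩))
    · by_cases h : j = v
      · subst h
        simpa [B'] using hlt.le
      · simp only [B', h, if_false]
        by_contra! hcon
        have hjZ : j ∈ Z := mem_filter.2 ⟨(mem_sdiff.1 hj).1, hcon⟩
        exact (mem_sdiff.1 hj).2 (mem_biUnion.2 ⟨j, hjZ, hmem j⟩)
    · simpa [B'] using hlt

end Truthful

/-! ### The mechanism for the held-out items -/

section HeldOutFacts

variable {n m : ℕ}

/-- The winner in a list that is sorted by the injective key `key`. -/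
lemma winner_eq_some_iff {L : List (Fin n)} {key : Fin n → ℕ} (hinj : Function.Injective key)
    (hp : L.Pairwise fun u w => key u < key w) (hall : ∀ u, u ∈ L)
    (R : Fin n → Finset (Fin m)) (x : Fin m) (w : Fin n) :
    winner L R x = some w ↔ x ∈ R w ∧ ∀ u, key u < key w → x ∉ R u := by
  have hfwd : ∀ w, winner L R x = some w → x ∈ R w ∧ ∀ u, key u < key w → x ∉ R u := by
    intro w h
    obtain ⟨hw, as, bs, hL, has⟩ := List.find?_eq_some_iff_append.1 h
    refine ⟨by simpa using hw, fun u hu => ?_⟩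
    have huL := hall u
    rw [hL] at huL hp
    rcases List.mem_append.1 huL with h1 | h1
    · simpa using has u h1
    · rcases List.mem_cons.1 h1 with rfl | h1
      · exact absurd hu (lt_irrefl _)
      · have := List.rel_of_pairwise_cons (List.pairwise_append.1 hp).2.1 h1
        omega
  refine ⟨hfwd w, fun ⟨hw, hlt⟩ => ?_⟩
  cases h : winner L R x with
  | none =>
    have := List.find?_eq_none.1 h w (hall w)
    simp [hw] at this
  | some b =>
    obtain ⟨hb, hblt⟩ := hfwd b h
    rcases lt_trichotomy (key b) (key w) with h1 | h1 | h1
    · exact absurd hb (hlt b h1)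
    · rw [hinj h1]
    · exact absurd hw (hblt w h1)

/-- The agent `v` is the first one, in the order `τ`, who reports `x`. -/
def IsFirst (τ : Equiv.Perm (Fin n)) (R : Fin n → Finset (Fin m)) (x : Fin m) (v : Fin n) : Prop :=
  x ∈ R v ∧ ∀ u, τ.symm u < τ.symm v → x ∉ R u

lemma IsFirst.unique {τ : Equiv.Perm (Fin n)} {R : Fin n → Finset (Fin m)} {x : Fin m}
    {v w : Fin n} (hv : IsFirst τ R x v) (hw : IsFirst τ R x w) : v = w := by
  rcases lt_trichotomy (τ.symm v) (τ.symm w) with h | h | h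
  · exact absurd hv.1 (hw.2 v h)
  · exact τ.symm.injective h
  · exact absurd hw.1 (hv.2 w h)

open Classical in
/-- The places of the agents after the first one who reports `x` has been moved to the end. -/
noncomputable def updatedPlace (τ : Equiv.Perm (Fin n)) (R : Fin n → Finset (Fin m)) (x : Fin m)
    (v : Fin n) : ℕ :=
  if IsFirst τ R x v then n else τ.symm v

lemma updatedPlace_of_isFirst {τ : Equiv.Perm (Fin n)} {R : Fin n → Finset (Fin m)} {x : Fin m}
    {v : Fin n} (h : IsFirst τ R x v) : updatedPlace τ R x v = n := if_pos h

lemma updatedPlace_of_not {τ : Equiv.Perm (Fin n)} {R : Fin n → Finset (Fin m)} {x : Fin m}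
    {v : Fin n} (h : ¬ IsFirst τ R x v) : updatedPlace τ R x v = τ.symm v := if_neg h

lemma updatedPlace_injective (τ : Equiv.Perm (Fin n)) (R : Fin n → Finset (Fin m)) (x : Fin m) :
    Function.Injective (updatedPlace τ R x) := by
  intro v w h
  by_cases hv : IsFirst τ R x v <;> by_cases hw : IsFirst τ R x w
  · exact hv.unique hw
  · rw [updatedPlace_of_isFirst hv, updatedPlace_of_not hw] at h
    have := (τ.symm w).2
    omega
  · rw [updatedPlace_of_isFirst hw, updatedPlace_of_not hv] at h
    have := (τ.symm v).2
    omega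
  · rw [updatedPlace_of_not hv, updatedPlace_of_not hw] at h
    exact τ.symm.injective (Fin.ext h)

lemma pairwise_map_finRange (τ : Equiv.Perm (Fin n)) :
    ((List.finRange n).map τ).Pairwise fun u w => (τ.symm u : ℕ) < τ.symm w := by
  rw [List.pairwise_map]
  simpa using List.pairwise_lt_finRange n

lemma winner_first_iff (τ : Equiv.Perm (Fin n)) (R : Fin n → Finset (Fin m)) (x : Fin m)
    (v : Fin n) : winner ((List.finRange n).map τ) R x = some v ↔ IsFirst τ R x v :=
  winner_eq_some_iff (key := fun u => (τ.symm u : ℕ))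
    (fun _ _ h => τ.symm.injective (Fin.ext h)) (pairwise_map_finRange τ)
    (fun u => List.mem_map.2 ⟨τ.symm u, List.mem_finRange _, by simp⟩) R x v

lemma winner_second_iff (τ : Equiv.Perm (Fin n)) (R : Fin n → Finset (Fin m)) (x y : Fin m)
    (v : Fin n) :
    winner (demote ((List.finRange n).map τ) (winner ((List.finRange n).map τ) R x)) R y = some v ↔
      y ∈ R v ∧ ∀ u, updatedPlace τ R x u < updatedPlace τ R x v → y ∉ R u := by
  have hmem : ∀ u, u ∈ (List.finRange n).map τ :=
    fun u => List.mem_map.2 ⟨τ.symm u, List.mem_finRange _, by simp⟩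
  apply winner_eq_some_iff (updatedPlace_injective τ R x)
  · cases h : winner ((List.finRange n).map τ) R x with
    | none =>
      have hno : ∀ u, ¬ IsFirst τ R x u := fun u hu => by
        rw [← winner_first_iff, h] at hu
        cases hu
      simp only [demote, updatedPlace_of_not (hno _)]
      exact pairwise_map_finRange τ
    | some w =>
      have hw := (winner_first_iff τ R x w).1 h
      have hno : ∀ u, u ≠ w → ¬ IsFirst τ R x u := fun u huw hu => huw (hu.unique hw)
      have hnd : ((List.finRange n).map τ).Nodup :=
        (List.nodup_finRange n).map τ.injective
      simp only [demote]
      rw [List.pairwise_append]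
      refine ⟨?_, by simp, ?_⟩
      · refine ((pairwise_map_finRange τ).sublist List.erase_sublist).imp_of_mem ?_
        intro u u' hu hu' hlt
        rw [updatedPlace_of_not (hno u ((hnd.mem_erase_iff.1 hu).1)),
          updatedPlace_of_not (hno u' ((hnd.mem_erase_iff.1 hu').1))]
        exact hlt
      · intro u hu u' hu'
        rw [List.mem_singleton.1 hu', updatedPlace_of_isFirst hw,
          updatedPlace_of_not (hno u ((hnd.mem_erase_iff.1 hu).1))]
        exact (τ.symm u).2
  · intro u
    cases winner ((List.finRange n).map τ) R x with
    | none => exact hmem u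
    | some w =>
      by_cases huw : u = w
      · simp [demote, huw]
      · exact List.mem_append_left _ ((List.mem_erase_of_ne huw).2 (hmem u))

lemma mem_heldOutMech {X : HeldOut m} {τ : Equiv.Perm (Fin n)} {R : Fin n → Finset (Fin m)}
    {v : Fin n} {a : Fin m} :
    a ∈ heldOutMech X τ R v ↔ (a = X.1 ∧ IsFirst τ R X.1 v) ∨
      (X.2 = some a ∧ a ∈ R v ∧
        ∀ u, updatedPlace τ R X.1 u < updatedPlace τ R X.1 v → a ∉ R u) := by
  simp only [heldOutMech, mem_union, mem_filter, Option.mem_toFinset, Option.mem_def,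
    winner_second_iff]
  have : a ∈ (if winner ((List.finRange n).map τ) R X.1 = some v then {X.1} else ∅ :
      Finset (Fin m)) ↔ a = X.1 ∧ IsFirst τ R X.1 v := by
    by_cases h : IsFirst τ R X.1 v
    · rw [if_pos ((winner_first_iff ..).2 h)]
      simp [h]
    · rw [if_neg (mt (winner_first_iff ..).1 h)]
      simp [h]
  rw [this]

lemma mem_heldSet {X : HeldOut m} {a : Fin m} : a ∈ heldSet X ↔ a = X.1 ∨ X.2 = some a := by
  simp [heldSet]

lemma card_heldSet_le (X : HeldOut m) : #(heldSet X) ≤ 2 := by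
  refine (card_insert_le _ _).trans ?_
  have : #X.2.toFinset ≤ 1 := by
    cases X.2 <;> simp
  omega

/-- Only the reports on the held-out items matter. -/
lemma heldOutMech_inter (X : HeldOut m) (τ : Equiv.Perm (Fin n)) (R : Fin n → Finset (Fin m)) :
    heldOutMech X τ (fun u => R u ∩ heldSet X) = heldOutMech X τ R := by
  have h1 : X.1 ∈ heldSet X := mem_heldSet.2 (.inl rfl)
  have hF : ∀ u, IsFirst τ (fun u => R u ∩ heldSet X) X.1 u ↔ IsFirst τ R X.1 u := fun u => by
    simp [IsFirst, h1]
  have hU : updatedPlace τ (fun u => R u ∩ heldSet X) X.1 = updatedPlace τ R X.1 := by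
    funext u
    by_cases h : IsFirst τ R X.1 u
    · rw [updatedPlace_of_isFirst h, updatedPlace_of_isFirst ((hF u).2 h)]
    · rw [updatedPlace_of_not h, updatedPlace_of_not (mt (hF u).1 h)]
  funext v
  ext a
  rw [mem_heldOutMech, mem_heldOutMech, hU, hF]
  refine or_congr Iff.rfl (and_congr_right fun h => ?_)
  simp [mem_heldSet.2 (.inr h)]

lemma heldOutMech_subset (X : HeldOut m) (τ : Equiv.Perm (Fin n)) (R : Fin n → Finset (Fin m))
    (v : Fin n) : heldOutMech X τ R v ⊆ R v ∩ heldSet X := by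
  intro a ha
  rw [mem_inter, mem_heldSet]
  rcases mem_heldOutMech.1 ha with ⟨rfl, h⟩ | ⟨h, h', -⟩
  · exact ⟨h.1, .inl rfl⟩
  · exact ⟨h', .inr h⟩

lemma heldOutMech_isAllocation {X : HeldOut m} (hX : X.2 ≠ some X.1) (τ : Equiv.Perm (Fin n))
    (R : Fin n → Finset (Fin m)) : IsAllocation (heldOutMech X τ R) := by
  intro v w hvw
  rw [disjoint_left]
  intro a hv hw
  rcases mem_heldOutMech.1 hv with ⟨rfl, h⟩ | ⟨h, h1, h2⟩ <;>
    rcases mem_heldOutMech.1 hw with ⟨e, h'⟩ | ⟨h', h1', h2'⟩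
  · exact hvw (h.unique h')
  · exact hX h'
  · exact hX (e ▸ h)
  · rcases lt_trichotomy (updatedPlace τ R X.1 v) (updatedPlace τ R X.1 w) with h3 | h3 | h3
    · exact h2' v h3 h1
    · exact hvw (updatedPlace_injective τ R X.1 h3)
    · exact h2 w h3 h1'

lemma exists_isFirst {τ : Equiv.Perm (Fin n)} {R : Fin n → Finset (Fin m)} {a : Fin m}
    {u : Fin n} (h : a ∈ R u) : ∃ v, IsFirst τ R a v := by
  obtain ⟨v, hv, hmin⟩ := exists_min_image (univ.filter fun u => a ∈ R u) τ.symm ⟨u, by simp [h]⟩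
  refine ⟨v, by simpa using hv, fun w hw haw => ?_⟩
  exact absurd (hmin w (by simp [haw])) (not_le.2 hw)

lemma exists_mem_heldOutMech {X : HeldOut m} {τ : Equiv.Perm (Fin n)}
    {R : Fin n → Finset (Fin m)} {a : Fin m} (ha : a ∈ heldSet X) {u : Fin n} (h : a ∈ R u) :
    ∃ v, a ∈ heldOutMech X τ R v := by
  rcases mem_heldSet.1 ha with rfl | ha
  · obtain ⟨v, hv⟩ := exists_isFirst (τ := τ) h
    exact ⟨v, mem_heldOutMech.2 (.inl ⟨rfl, hv⟩)⟩
  · obtain ⟨v, hv, hmin⟩ := exists_min_image (univ.filter fun u => a ∈ R u)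
      (updatedPlace τ R X.1) ⟨u, by simp [h]⟩
    refine ⟨v, mem_heldOutMech.2 (.inr ⟨ha, by simpa using hv, fun w hw haw => ?_⟩)⟩
    exact absurd (hmin w (by simp [haw])) (not_le.2 hw)

lemma isFirst_update_of {τ : Equiv.Perm (Fin n)} {R : Fin n → Finset (Fin m)} {v : Fin n}
    {S D : Finset (Fin m)} {x : Fin m} (hx : x ∈ D)
    (h : IsFirst τ (Function.update R v S) x v) : IsFirst τ (Function.update R v D) x v := by
  refine ⟨by simpa using hx, fun u hu => ?_⟩
  have huv : u ≠ v := fun e => (e ▸ hu).ne rfl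
  simpa [huv] using h.2 u hu

/-- An agent does not win more held-out items of her demand by misreporting. -/
lemma card_heldOutMech_inter_le (X : HeldOut m) (τ : Equiv.Perm (Fin n))
    (R : Fin n → Finset (Fin m)) (v : Fin n) (D S : Finset (Fin m)) :
    #(heldOutMech X τ (Function.update R v S) v ∩ D) ≤
      #(heldOutMech X τ (Function.update R v D) v) := by
  set RS := Function.update R v S with hRS
  set RD := Function.update R v D with hRD
  have hSv : RS v = S := by simp [hRS]
  have hDv : RD v = D := by simp [hRD]
  have hne : ∀ u, u ≠ v → RS u = RD u := fun u hu => by simp [hRS, hRD, hu]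
  by_cases hF : IsFirst τ RD X.1 v
  · have hx : X.1 ∈ heldOutMech X τ RD v := mem_heldOutMech.2 (.inl ⟨rfl, hF⟩)
    by_cases hFS : IsFirst τ RS X.1 v
    · -- both reports win the first item, so the orders for the second item agree
      refine card_le_card fun a ha => ?_
      obtain ⟨ha, haD⟩ := mem_inter.1 ha
      rcases mem_heldOutMech.1 ha with ⟨rfl, h⟩ | ⟨h, -, h2⟩
      · exact hx
      · refine mem_heldOutMech.2 (.inr ⟨h, hDv.symm ▸ haD, fun u hu => ?_⟩)
        have huv : u ≠ v := fun e => (e ▸ hu).ne rfl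
        rw [← hne u huv]
        refine h2 u ?_
        rw [updatedPlace_of_isFirst hFS,
          updatedPlace_of_not fun h => huv (h.unique hFS)]
        exact (τ.symm u).2
    · have h1 : #(heldOutMech X τ RS v ∩ D) ≤ 1 := by
        refine card_le_one.2 fun a ha b hb => ?_
        rcases mem_heldOutMech.1 (mem_inter.1 ha).1 with ⟨-, h⟩ | ⟨h, -⟩
        · exact absurd h hFS
        · rcases mem_heldOutMech.1 (mem_inter.1 hb).1 with ⟨-, h'⟩ | ⟨h', -⟩
          · exact absurd h' hFS
          · exact Option.some.inj (h.symm.trans h')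
      exact h1.trans (card_pos.2 ⟨_, hx⟩)
  · refine card_le_card fun a ha => ?_
    obtain ⟨ha, haD⟩ := mem_inter.1 ha
    rcases mem_heldOutMech.1 ha with ⟨rfl, h⟩ | ⟨h, -, h2⟩
    · exact absurd (isFirst_update_of haD h) hF
    · refine mem_heldOutMech.2 (.inr ⟨h, hDv.symm ▸ haD, fun u hu => ?_⟩)
      have huv : u ≠ v := fun e => (e ▸ hu).ne rfl
      rw [updatedPlace_of_not hF] at hu
      have hFu : ¬ IsFirst τ RD X.1 u := fun h => by
        rw [updatedPlace_of_isFirst h] at hu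
        have := (τ.symm v).2
        omega
      rw [updatedPlace_of_not hFu] at hu
      rw [← hne u huv]
      refine h2 u ?_
      have hFSu : ¬ IsFirst τ RS X.1 u := fun h => hFu ⟨hne u huv ▸ h.1, fun z hz => by
        have hzv : z ≠ v := by
          rintro rfl
          have := Fin.lt_def.1 hz
          omega
        rw [← hne z hzv]
        exact h.2 z hz⟩
      rw [updatedPlace_of_not hFSu]
      by_cases hFS : IsFirst τ RS X.1 v
      · rw [updatedPlace_of_isFirst hFS]
        exact (τ.symm u).2
      · rwa [updatedPlace_of_not hFS]

/-- No agent wins two held-out items that another agent wants. -/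
lemma card_heldOutMech_inter_le_one {X : HeldOut m} {τ : Equiv.Perm (Fin n)}
    {R : Fin n → Finset (Fin m)} {v w : Fin n} (hvw : v ≠ w) :
    #(heldOutMech X τ R w ∩ R v) ≤ 1 := by
  refine card_le_one.2 fun a ha b hb => ?_
  obtain ⟨ha, hav⟩ := mem_inter.1 ha
  obtain ⟨hb, hbv⟩ := mem_inter.1 hb
  have key : IsFirst τ R X.1 w → ∀ c ∈ R v, X.2 = some c →
      ¬ ∀ u, updatedPlace τ R X.1 u < updatedPlace τ R X.1 w → c ∉ R u := by
    intro hw c hc _ h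
    refine h v ?_ hc
    rw [updatedPlace_of_isFirst hw, updatedPlace_of_not fun h => hvw (h.unique hw)]
    exact (τ.symm v).2
  rcases mem_heldOutMech.1 ha with ⟨rfl, h⟩ | ⟨h, -, h2⟩ <;>
    rcases mem_heldOutMech.1 hb with ⟨e, h'⟩ | ⟨h', -, h2'⟩
  · exact e.symm
  · exact absurd h2' (key h b hbv h')
  · exact absurd h2 (key h' a hav h)
  · exact Option.some.inj (h.symm.trans h')

/-- Whoever wins an item wanted by an agent who wins nothing precedes that agent. -/
lemma lt_of_heldOutMech_eq_empty {X : HeldOut m} {τ : Equiv.Perm (Fin n)}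
    {R : Fin n → Finset (Fin m)} {v w : Fin n} (hvw : v ≠ w)
    (hne : (heldOutMech X τ R w ∩ R v).Nonempty) (hv : heldOutMech X τ R v = ∅) :
    τ.symm w < τ.symm v := by
  obtain ⟨a, ha⟩ := hne
  obtain ⟨ha, hav⟩ := mem_inter.1 ha
  have hFv : ¬ IsFirst τ R X.1 v := fun h => by
    have : X.1 ∈ heldOutMech X τ R v := mem_heldOutMech.2 (.inl ⟨rfl, h⟩)
    simp [hv] at this
  have hne' : τ.symm w ≠ τ.symm v := fun h => hvw (τ.symm.injective h).symm
  refine lt_of_le_of_ne (not_lt.1 fun hlt => ?_) hne'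
  rcases mem_heldOutMech.1 ha with ⟨rfl, h⟩ | ⟨-, -, h2⟩
  · exact h.2 v hlt hav
  · refine h2 v ?_ hav
    rw [updatedPlace_of_not hFv]
    by_cases hw : IsFirst τ R X.1 w
    · rw [updatedPlace_of_isFirst hw]
      exact (τ.symm v).2
    · rw [updatedPlace_of_not hw]
      exact hlt

/-- An agent in place `0` or `1` wins an item if she wants more held-out items than the number of
agents before her. -/
lemma heldOutMech_nonempty {X : HeldOut m} {τ : Equiv.Perm (Fin n)} {R : Fin n → Finset (Fin m)}
    {v : Fin n} (h : (τ.symm v : ℕ) < #(R v ∩ heldSet X)) : (heldOutMech X τ R v).Nonempty := by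
  by_cases hF : IsFirst τ R X.1 v
  · exact ⟨X.1, mem_heldOutMech.2 (.inl ⟨rfl, hF⟩)⟩
  have hle : #(R v ∩ heldSet X) ≤ 2 := (card_le_card inter_subset_right).trans (card_heldSet_le X)
  rcases Nat.eq_zero_or_pos (τ.symm v : ℕ) with h0 | hpos
  · rw [h0] at h
    obtain ⟨a, ha⟩ := card_pos.1 h
    obtain ⟨ha, haX⟩ := mem_inter.1 ha
    rcases mem_heldSet.1 haX with rfl | haX
    · exact absurd ⟨ha, fun u hu => absurd (Fin.lt_def.1 hu) (by omega)⟩ hF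
    · refine ⟨a, mem_heldOutMech.2 (.inr ⟨haX, ha, fun u hu => ?_⟩)⟩
      rw [updatedPlace_of_not hF] at hu
      omega
  · have h2 : heldSet X ⊆ R v := by
      have := eq_of_subset_of_card_le (inter_subset_right (s₁ := R v) (s₂ := heldSet X))
        ((card_heldSet_le X).trans (by omega))
      rw [← this]
      exact inter_subset_left
    have h3 : 2 ≤ #(heldSet X) := (by omega : 2 ≤ #(R v ∩ heldSet X)).trans
      (card_le_card inter_subset_right)
    cases hX : X.2 with
    | none => simp [heldSet, hX] at h3
    | some y =>
      refine ⟨y, mem_heldOutMech.2 (.inr ⟨hX, h2 (mem_heldSet.2 (.inr hX)), fun u hu => ?_⟩)⟩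
      obtain ⟨w, hw⟩ := exists_isFirst (τ := τ) (h2 (mem_heldSet.2 (.inl rfl)) : X.1 ∈ R v)
      -- the agent in place `0` has taken the first item
      have hwv : (τ.symm w : ℕ) < τ.symm v := by
        by_contra! hcon
        rcases hcon.lt_or_eq with h4 | h4
        · exact hw.2 v (Fin.lt_def.2 h4) (h2 (mem_heldSet.2 (.inl rfl)))
        · exact hF (τ.symm.injective (Fin.ext h4) ▸ hw)
      rw [updatedPlace_of_not hF] at hu
      by_cases huw : IsFirst τ R X.1 u
      · rw [updatedPlace_of_isFirst huw] at hu
        have := (τ.symm v).2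
        omega
      · rw [updatedPlace_of_not huw] at hu
        have : u = w := τ.symm.injective (Fin.ext (by omega))
        exact absurd (this ▸ hw) huw

/-- If a first reporter of the first item is not `v`, and all agents that remain before `v`
do not want the second item, then `v` wins it. -/
lemma mem_heldOutMech_second {b c : Fin m} {τ : Equiv.Perm (Fin n)} {R : Fin n → Finset (Fin m)}
    {v : Fin n} (hb : b ∉ R v) (hc : c ∈ R v)
    (h : ∀ u, τ.symm u < τ.symm v → IsFirst τ R b u) : c ∈ heldOutMech (b, some c) τ R v := by
  refine mem_heldOutMech.2 (.inr ⟨rfl, hc, fun u hu => ?_⟩)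
  have hF : ¬ IsFirst τ R b v := fun h => hb h.1
  simp only [updatedPlace_of_not hF] at hu
  by_cases huF : IsFirst τ R b u
  · rw [updatedPlace_of_isFirst huF] at hu
    have := (τ.symm v).2
    omega
  · rw [updatedPlace_of_not huF] at hu
    exact absurd (h u (Fin.lt_def.2 hu)) huF

/-- The winner of the first item wins the second one only if nobody else reports it. -/
lemma notMem_heldOutMech_second {b c : Fin m} {τ : Equiv.Perm (Fin n)}
    {R : Fin n → Finset (Fin m)} {v w : Fin n} (hbc : b ≠ c) (hF : IsFirst τ R b v) (hvw : w ≠ v)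
    (hc : c ∈ R w) : c ∉ heldOutMech (b, some c) τ R v := by
  intro h
  rcases mem_heldOutMech.1 h with ⟨e, -⟩ | ⟨-, -, h2⟩
  · exact hbc e.symm
  · refine h2 w ?_ hc
    rw [updatedPlace_of_isFirst hF, updatedPlace_of_not fun h => hvw (h.unique hF)]
    exact (τ.symm w).2

end HeldOutFacts

/-! ### The outcome of the mechanism for a single realization -/

section ExPost

variable {n m : ℕ} {pe : PERule n m}

lemma peWith_subset (hpe : ∀ R, IsEgalitarian R (pe R)) (σ : Equiv.Perm (Fin n))
    (R : Fin n → Finset (Fin m)) (v : Fin n) : peWith pe σ R v ⊆ R v := by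
  have := (hpe fun r => R (σ r)).sub (σ.symm v)
  simpa [peWith] using this

lemma peWith_isAllocation (hpe : ∀ R, IsEgalitarian R (pe R)) (σ : Equiv.Perm (Fin n))
    (R : Fin n → Finset (Fin m)) : IsAllocation (peWith pe σ R) := fun _ _ hvw =>
  (hpe fun r => R (σ r)).disj _ _ fun h => hvw (σ.symm.injective h)

lemma exists_mem_peWith (hpe : ∀ R, IsEgalitarian R (pe R)) (σ : Equiv.Perm (Fin n))
    {R : Fin n → Finset (Fin m)} {a : Fin m} {u : Fin n} (h : a ∈ R u) :
    ∃ v, a ∈ peWith pe σ R v := by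
  obtain ⟨j, hj⟩ := (hpe fun r => R (σ r)).exists_owner (i := σ.symm u) (a := a) (by simpa using h)
  exact ⟨σ j, by simpa [peWith] using hj⟩

lemma peWith_key_le (hpe : ∀ R, IsEgalitarian R (pe R)) (σ : Equiv.Perm (Fin n))
    {R : Fin n → Finset (Fin m)} {v w : Fin n} (h : (peWith pe σ R w ∩ R v).Nonempty) :
    n * #(peWith pe σ R w) + σ.symm w ≤ n * #(peWith pe σ R v) + n + σ.symm v := by
  obtain ⟨a, ha⟩ := h
  obtain ⟨h1, h2⟩ := mem_inter.1 ha
  exact (hpe fun r => R (σ r)).key_le (i := σ.symm v) (by simpa using h2) h1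

lemma card_peWith_le (hpe : ∀ R, IsEgalitarian R (pe R)) (σ : Equiv.Perm (Fin n))
    (R : Fin n → Finset (Fin m)) (v w : Fin n) :
    #(peWith pe σ R w ∩ R v) ≤ #(peWith pe σ R v) + if σ.symm w < σ.symm v then 1 else 0 := by
  rcases (peWith pe σ R w ∩ R v).eq_empty_or_nonempty with h | h
  · simp [h]
  have hk := peWith_key_le hpe σ h
  have hc : #(peWith pe σ R w ∩ R v) ≤ #(peWith pe σ R w) := card_le_card inter_subset_left
  have hv := (σ.symm v).2
  have hw := (σ.symm w).2
  rcases lt_trichotomy (σ.symm w) (σ.symm v) with hlt | heq | hlt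
  · rw [if_pos hlt]
    by_contra! hcon
    have : n * (#(peWith pe σ R v) + 2) ≤ n * #(peWith pe σ R w) := Nat.mul_le_mul_left _ (by omega)
    rw [mul_add] at this
    omega
  · rw [σ.symm.injective heq]
    simpa using card_le_card inter_subset_left
  · rw [if_neg hlt.asymm]
    have hlt' := Fin.lt_def.1 hlt
    by_contra! hcon
    have : n * (#(peWith pe σ R v) + 1) ≤ n * #(peWith pe σ R w) := Nat.mul_le_mul_left _ (by omega)
    rw [mul_add] at this
    omega

lemma card_peWith_inter_le (hpe : ∀ R, IsEgalitarian R (pe R)) (σ : Equiv.Perm (Fin n))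
    (R : Fin n → Finset (Fin m)) (v : Fin n) (D S : Finset (Fin m)) :
    #(peWith pe σ (Function.update R v S) v ∩ D) ≤
      #(peWith pe σ (Function.update R v D) v) := by
  have key : ∀ T : Finset (Fin m), (fun r => Function.update R v T (σ r)) =
      Function.update (fun r => R (σ r)) (σ.symm v) T := fun T => by
    funext r
    by_cases h : r = σ.symm v
    · subst h
      simp
    · have : σ r ≠ v := fun e => h (by simp [← e])
      simp [h, this]
  have hA := hpe (fun r => Function.update R v D (σ r))
  have hB := hpe (fun r => Function.update R v S (σ r))
  simp only [peWith]
  rw [key] at hA hB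
  rw [key, key]
  exact hA.card_inter_le hB

/-- The bundle of `v` has at least the size that an even split of her demand would give to her,
and the remainder is split among the agents of highest priority. -/
lemma le_card_peWith (hpe : ∀ R, IsEgalitarian R (pe R)) (σ : Equiv.Perm (Fin n))
    (R : Fin n → Finset (Fin m)) (v : Fin n) :
    #(R v) / n + (if (σ.symm v : ℕ) < #(R v) % n then 1 else 0) ≤ #(peWith pe σ R v) := by
  set x := #(peWith pe σ R v) with hx
  have h1 : #(R v) ≤ ∑ w, #(peWith pe σ R w ∩ R v) := by
    refine (card_le_card ?_).trans card_biUnion_le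
    intro a ha
    obtain ⟨w, hw⟩ := exists_mem_peWith hpe σ ha
    exact mem_biUnion.2 ⟨w, mem_univ _, mem_inter.2 ⟨hw, ha⟩⟩
  have h2 : ∑ w, #(peWith pe σ R w ∩ R v) ≤ n * x + σ.symm v := by
    refine (sum_le_sum fun w _ => card_peWith_le hpe σ R v w).trans (le_of_eq ?_)
    rw [sum_add_distrib, sum_const, card_univ, Fintype.card_fin, smul_eq_mul]
    congr 1
    rw [← Equiv.sum_comp σ]
    simp only [Equiv.symm_apply_apply]
    rw [sum_boole]
    have : (univ.filter fun r => r < σ.symm v) = Iio (σ.symm v) := by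
      ext
      simp
    rw [this, Fin.card_Iio]
    rfl
  have h3 := Nat.div_add_mod #(R v) n
  have h4 := (σ.symm v).2
  have h5 := Nat.mod_lt #(R v) v.pos
  have h6 : n * (#(R v) / n) + #(R v) % n ≤ n * x + σ.symm v := by omega
  have h7 : #(R v) / n ≤ x := by
    by_contra! hcon
    have : n * (x + 1) ≤ n * (#(R v) / n) := Nat.mul_le_mul_left _ hcon
    rw [mul_add] at this
    omega
  split_ifs with h
  · by_contra! hcon
    have : #(R v) / n = x := by omega
    rw [this] at h6
    omega
  · exact h7

/-- The held-out items are distinct. -/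
def HeldOut.Distinct (X : HeldOut m) : Prop := X.2 ≠ some X.1

lemma mech_eq (R : Fin n → Finset (Fin m)) (X : HeldOut m) (σ : Equiv.Perm (Fin n)) (v : Fin n) :
    mech pe R (X, σ) v = peWith pe σ (fun u => R u \ heldSet X) v ∪
      heldOutMech X (Fin.revPerm.trans σ) R v := by
  simp only [mech]
  rw [heldOutMech_inter]

lemma mech_disjoint (hpe : ∀ R, IsEgalitarian R (pe R)) (R R' : Fin n → Finset (Fin m))
    (X : HeldOut m) (σ τ : Equiv.Perm (Fin n)) (v w : Fin n) :
    Disjoint (peWith pe σ (fun u => R u \ heldSet X) v) (heldOutMech X τ R' w) :=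
  disjoint_sdiff_self_left.mono (peWith_subset hpe σ _ v)
    ((heldOutMech_subset X τ R' w).trans inter_subset_right)

lemma card_mech (hpe : ∀ R, IsEgalitarian R (pe R)) (R : Fin n → Finset (Fin m))
    (X : HeldOut m) (σ : Equiv.Perm (Fin n)) (v : Fin n) :
    #(mech pe R (X, σ) v) = #(peWith pe σ (fun u => R u \ heldSet X) v) +
      #(heldOutMech X (Fin.revPerm.trans σ) R v) := by
  rw [mech_eq, card_union_of_disjoint (mech_disjoint hpe R R X σ _ v v)]

lemma mech_subset (hpe : ∀ R, IsEgalitarian R (pe R)) (R : Fin n → Finset (Fin m))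
    (X : HeldOut m) (σ : Equiv.Perm (Fin n)) (v : Fin n) : mech pe R (X, σ) v ⊆ R v := by
  rw [mech_eq]
  exact union_subset ((peWith_subset hpe σ _ v).trans sdiff_subset)
    ((heldOutMech_subset X _ R v).trans inter_subset_left)

lemma mech_isAllocation (hpe : ∀ R, IsEgalitarian R (pe R)) (R : Fin n → Finset (Fin m))
    {X : HeldOut m} (hX : X.Distinct) (σ : Equiv.Perm (Fin n)) :
    IsAllocation (mech pe R (X, σ)) := by
  intro v w hvw
  rw [mech_eq, mech_eq, disjoint_union_left, disjoint_union_right, disjoint_union_right]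
  exact ⟨⟨peWith_isAllocation hpe σ _ v w hvw, mech_disjoint hpe R R X σ _ v w⟩,
    (mech_disjoint hpe R R X σ _ w v).symm, heldOutMech_isAllocation hX _ R v w hvw⟩

lemma exists_mem_mech (hpe : ∀ R, IsEgalitarian R (pe R)) {R : Fin n → Finset (Fin m)}
    (X : HeldOut m) (σ : Equiv.Perm (Fin n)) {a : Fin m} {u : Fin n} (h : a ∈ R u) :
    ∃ v, a ∈ mech pe R (X, σ) v := by
  by_cases ha : a ∈ heldSet X
  · obtain ⟨v, hv⟩ := exists_mem_heldOutMech (τ := Fin.revPerm.trans σ) ha h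
    exact ⟨v, by rw [mech_eq]; exact mem_union_right _ hv⟩
  · obtain ⟨v, hv⟩ := exists_mem_peWith hpe σ (R := fun u => R u \ heldSet X) (u := u)
      (mem_sdiff.2 ⟨h, ha⟩)
    exact ⟨v, by rw [mech_eq]; exact mem_union_left _ hv⟩

lemma update_sdiff (R : Fin n → Finset (Fin m)) (v : Fin n) (T Y : Finset (Fin m)) :
    (fun u => Function.update R v T u \ Y) = Function.update (fun u => R u \ Y) v (T \ Y) := by
  funext u
  by_cases h : u = v
  · subst h
    simp
  · simp [h]

lemma card_mech_inter_le_add (hpe : ∀ R, IsEgalitarian R (pe R)) (R : Fin n → Finset (Fin m))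
    (X : HeldOut m) (σ : Equiv.Perm (Fin n)) (v : Fin n) (D S : Finset (Fin m)) :
    #(mech pe (Function.update R v S) (X, σ) v ∩ D) ≤
      #(peWith pe σ (fun u => Function.update R v D u \ heldSet X) v) +
        #(heldOutMech X (Fin.revPerm.trans σ) (Function.update R v S) v ∩ D) := by
  rw [mech_eq, union_inter_distrib_right]
  refine (card_union_le _ _).trans (Nat.add_le_add_right ?_ _)
  rw [update_sdiff, update_sdiff]
  refine le_trans (card_le_card ?_) (card_peWith_inter_le hpe σ _ v (D \ heldSet X)
    (S \ heldSet X))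
  intro a ha
  obtain ⟨ha, haD⟩ := mem_inter.1 ha
  refine mem_inter.2 ⟨ha, mem_sdiff.2 ⟨haD, ?_⟩⟩
  have := peWith_subset hpe σ _ v ha
  simp only [Function.update_self] at this
  exact (mem_sdiff.1 this).2

/-- No report gets more items of her demand for an agent than the true one. -/
lemma card_mech_inter_le (hpe : ∀ R, IsEgalitarian R (pe R)) (R : Fin n → Finset (Fin m))
    (X : HeldOut m) (σ : Equiv.Perm (Fin n)) (v : Fin n) (D S : Finset (Fin m)) :
    #(mech pe (Function.update R v S) (X, σ) v ∩ D) ≤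
      #(mech pe (Function.update R v D) (X, σ) v) := by
  refine (card_mech_inter_le_add hpe R X σ v D S).trans ?_
  rw [card_mech hpe]
  exact Nat.add_le_add_left (card_heldOutMech_inter_le X _ R v D S) _

lemma card_mech_inter_lt (hpe : ∀ R, IsEgalitarian R (pe R)) (R : Fin n → Finset (Fin m))
    (X : HeldOut m) (σ : Equiv.Perm (Fin n)) (v : Fin n) (D S : Finset (Fin m))
    (h1 : heldOutMech X (Fin.revPerm.trans σ) (Function.update R v S) v ∩ D = ∅)
    (h2 : (heldOutMech X (Fin.revPerm.trans σ) (Function.update R v D) v).Nonempty) :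
    #(mech pe (Function.update R v S) (X, σ) v ∩ D) + 1 ≤
      #(mech pe (Function.update R v D) (X, σ) v) := by
  have := card_mech_inter_le_add hpe R X σ v D S
  rw [h1, card_empty] at this
  rw [card_mech hpe]
  have := card_pos.2 h2
  omega

lemma symm_rev_trans (σ : Equiv.Perm (Fin n)) (v : Fin n) :
    (Fin.revPerm.trans σ).symm v = Fin.rev (σ.symm v) := rfl

/-- Envy is bounded by one item. -/
lemma card_mech_inter_le_succ (hpe : ∀ R, IsEgalitarian R (pe R)) (R : Fin n → Finset (Fin m))
    (X : HeldOut m) (σ : Equiv.Perm (Fin n)) {v w : Fin n} (hvw : v ≠ w) :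
    #(mech pe R (X, σ) w ∩ R v) ≤ #(mech pe R (X, σ) v) + 1 := by
  rw [card_mech hpe, mech_eq, union_inter_distrib_right]
  set τ := Fin.revPerm.trans σ with hτ
  have h1 : #(peWith pe σ (fun u => R u \ heldSet X) w ∩ R v) ≤
      #(peWith pe σ (fun u => R u \ heldSet X) v) + if σ.symm w < σ.symm v then 1 else 0 := by
    refine le_trans (card_le_card ?_) (card_peWith_le hpe σ _ v w)
    intro a ha
    obtain ⟨ha, haD⟩ := mem_inter.1 ha
    exact mem_inter.2 ⟨ha, mem_sdiff.2 ⟨haD, (mem_sdiff.1 (peWith_subset hpe σ _ w ha)).2⟩⟩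
  have h2 := card_heldOutMech_inter_le_one (X := X) (τ := τ) (R := R) hvw
  have h3 := card_union_le (peWith pe σ (fun u => R u \ heldSet X) w ∩ R v)
    (heldOutMech X τ R w ∩ R v)
  rcases (heldOutMech X τ R w ∩ R v).eq_empty_or_nonempty with h4 | h4
  · rw [h4, card_empty] at h3
    rw [h4]
    split_ifs at h1 <;> omega
  · rcases (heldOutMech X τ R v).eq_empty_or_nonempty with h5 | h5
    · -- the two priority orders are opposite, so only one of the two parts can cause envy
      have h6 := lt_of_heldOutMech_eq_empty hvw h4 h5
      rw [hτ, symm_rev_trans, symm_rev_trans, Fin.rev_lt_rev] at h6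
      rw [if_neg h6.asymm] at h1
      omega
    · have := card_pos.2 h5
      split_ifs at h1 <;> omega

/-- A lower bound for the size of a bundle, given the place of the agent. -/
def sizeBound (n : ℕ) (D Y : Finset (Fin m)) (q : ℕ) : ℕ :=
  #(D \ Y) / n + (if q < #(D \ Y) % n then 1 else 0) + if n - 1 - q < #(D ∩ Y) then 1 else 0

lemma sizeBound_le (hpe : ∀ R, IsEgalitarian R (pe R)) (R : Fin n → Finset (Fin m))
    (X : HeldOut m) (σ : Equiv.Perm (Fin n)) (v : Fin n) :
    sizeBound n (R v) (heldSet X) (σ.symm v) ≤ #(mech pe R (X, σ) v) := by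
  rw [card_mech hpe]
  refine add_le_add (le_card_peWith hpe σ (fun u => R u \ heldSet X) v) ?_
  split_ifs with h
  · refine card_pos.2 (heldOutMech_nonempty ?_)
    rw [symm_rev_trans, Fin.val_rev]
    omega
  · exact Nat.zero_le _

lemma sizeBound_lt (hpe : ∀ R, IsEgalitarian R (pe R)) (R : Fin n → Finset (Fin m))
    (X : HeldOut m) (σ : Equiv.Perm (Fin n)) (v : Fin n)
    (h : #(R v ∩ heldSet X) ≤ n - 1 - σ.symm v)
    (h2 : (heldOutMech X (Fin.revPerm.trans σ) R v).Nonempty) :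
    sizeBound n (R v) (heldSet X) (σ.symm v) + 1 ≤ #(mech pe R (X, σ) v) := by
  rw [card_mech hpe]
  refine add_le_add ?_ (card_pos.2 h2)
  rw [sizeBound, if_neg (not_lt.2 h)]
  exact le_card_peWith hpe σ (fun u => R u \ heldSet X) v

lemma sum_sizeBound (hn : 2 ≤ n) (D : Finset (Fin m)) (X : HeldOut m) :
    ∑ q : Fin n, sizeBound n D (heldSet X) q = #D := by
  have hcount : ∀ k ≤ n, ∑ q : Fin n, (if (q : ℕ) < k then 1 else 0) = k := by
    intro k hk
    rw [Fin.sum_univ_eq_sum_range (fun q => if q < k then 1 else 0), sum_boole]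
    have : (range n).filter (· < k) = range k := by
      ext
      simp
      omega
    simp [this]
  have h2 : #(D ∩ heldSet X) ≤ n :=
    (card_le_card inter_subset_right).trans ((card_heldSet_le X).trans hn)
  have e : ∑ q : Fin n, (if n - 1 - (q : ℕ) < #(D ∩ heldSet X) then 1 else 0) =
      #(D ∩ heldSet X) := by
    rw [← hcount _ h2, ← Equiv.sum_comp Fin.revPerm]
    refine sum_congr rfl fun q _ => ?_
    simp only [Fin.revPerm_apply, Fin.val_rev]
    have := q.2
    rw [hcount _ h2]
    congr 2
    omega
  simp only [sizeBound]
  rw [sum_add_distrib, sum_add_distrib, hcount _ (Nat.mod_lt _ (by omega)).le, e, sum_const,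
    card_univ, Fintype.card_fin, smul_eq_mul, Nat.div_add_mod, card_sdiff_add_card_inter]

end ExPost

/-! ### The coin tosses as uniform choices -/

section Coins

variable {n m : ℕ}

/-- Two independent uniform items give the held-out items: a repetition means that there is
no second one. -/
def pairHeld (x y : Fin m) : HeldOut m := (x, if y = x then none else some y)

lemma pairHeld_distinct (x y : Fin m) : (pairHeld x y).Distinct := by
  unfold HeldOut.Distinct pairHeld
  split_ifs with h
  · simp
  · simpa using h

lemma pairHeld_self (x : Fin m) : pairHeld x x = (x, none) := by simp [pairHeld]

lemma pairHeld_of_ne {x y : Fin m} (h : x ≠ y) : pairHeld x y = (x, some y) := by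
  simp [pairHeld, h.symm]

lemma heldSet_pairHeld (x y : Fin m) : heldSet (pairHeld x y) = {x, y} := by
  ext a
  by_cases h : x = y
  · subst h
    simp [pairHeld_self, heldSet]
  · simp [pairHeld_of_ne h, heldSet]

lemma map_uniformOfFintype_apply {α β : Type*} [Fintype α] [Nonempty α] [DecidableEq β]
    (f : α → β) (b : β) : (PMF.uniformOfFintype α).map f b =
      #(univ.filter fun a => f a = b) * (Fintype.card α : ENNReal)⁻¹ := by
  rw [PMF.map_apply, tsum_fintype]
  simp only [PMF.uniformOfFintype_apply]
  rw [← sum_filter, sum_const, nsmul_eq_mul]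
  congr 3
  ext a
  simp [eq_comm]

lemma secondItem_eq [NeZero m] (x : Fin m) : secondItem x =
    (PMF.uniformOfFintype (Fin m)).map fun y => if y = x then none else some y := by
  classical
  have hm : m ≠ 0 := NeZero.ne m
  have hm0 : (m : ENNReal) ≠ 0 := by exact_mod_cast hm
  have hmt : (m : ENNReal) ≠ ⊤ := ENNReal.natCast_ne_top m
  have hnone : (univ.filter fun y : Fin m => (if y = x then none else some y) = none) = {x} := by
    ext y
    by_cases h : y = x <;> simp [h]
  have hsome : ∀ z, z ≠ x →
      (univ.filter fun y : Fin m => (if y = x then none else some y) = some z) = {z} := by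
    intro z hz
    ext y
    by_cases h : y = x
    · subst h
      simpa using hz.symm
    · simp [h]
  have hsome' : (univ.filter fun y : Fin m => (if y = x then none else some y) = some x) = ∅ := by
    ext y
    by_cases h : y = x <;> simp [h]
  unfold secondItem
  split_ifs with h
  · have hm2 : 2 ≤ m := by
      obtain ⟨z, hz⟩ := h
      have h1 := z.2
      have h2 := x.2
      have h3 : (z : ℕ) ≠ x := fun e => (ne_of_mem_erase hz) (Fin.ext e)
      omega
    ext o
    rw [PMF.bind_apply, tsum_fintype, Fintype.sum_bool, map_uniformOfFintype_apply]
    simp only [PMF.bernoulli_apply, cond_true, cond_false, if_true, Fintype.card_fin,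
      Bool.false_eq_true, if_false]
    have hq : ((1 - 1 / (m : ℝ≥0) : ℝ≥0) : ENNReal) = 1 - (m : ENNReal)⁻¹ := by
      rw [ENNReal.coe_sub, ENNReal.coe_div (by exact_mod_cast hm)]
      simp
    have hle : (m : ENNReal)⁻¹ ≤ 1 := by
      rw [ENNReal.inv_le_one]
      exact_mod_cast (by omega : 1 ≤ m)
    have hq' : ((1 - (1 - 1 / (m : ℝ≥0)) : ℝ≥0) : ENNReal) = (m : ENNReal)⁻¹ := by
      rw [ENNReal.coe_sub, hq, ENNReal.coe_one, ENNReal.sub_sub_cancel ENNReal.one_ne_top hle]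
    rw [hq, hq', PMF.map_apply, tsum_fintype]
    cases o with
    | none =>
      rw [hnone]
      simp
    | some z =>
      have hz0 : (PMF.pure none : PMF (Option (Fin m))) (some z) = 0 := by simp
      rw [hz0, mul_zero, add_zero]
      rw [sum_eq_single z, if_pos rfl]
      rotate_left
      · intro y _ hy
        exact if_neg (by simpa using hy.symm)
      · simp
      by_cases hz : z = x
      · subst hz
        rw [hsome', PMF.uniformOfFinset_apply_of_notMem _ (by simp)]
        simp
      · rw [hsome z hz, PMF.uniformOfFinset_apply_of_mem _ (by simp [hz])]
        rw [card_erase_of_mem (mem_univ _), card_univ, Fintype.card_fin, card_singleton]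
        have h1 : (1 - (m : ENNReal)⁻¹) = ((m - 1 : ℕ) : ENNReal) * (m : ENNReal)⁻¹ := by
          rw [ENNReal.natCast_sub, ENNReal.sub_mul (fun _ _ => ENNReal.inv_ne_top.2 hm0),
            ENNReal.mul_inv_cancel hm0 hmt]
          simp
        rw [h1, mul_right_comm, ENNReal.mul_inv_cancel]
        · simp
        · exact_mod_cast (by omega : m - 1 ≠ 0)
        · exact ENNReal.natCast_ne_top _
  · have hall : ∀ y, y = x := by
      intro y
      by_contra hy
      exact h ⟨y, by simp [hy]⟩
    have : (fun y : Fin m => if y = x then none else some y) = Function.const _ none := by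
      funext y
      simp [hall y]
    rw [this, PMF.map_const]

/-- The coins are equivalent to three independent uniform draws: the second item repeats the first
one with probability `1 / m`, and then it is dropped. -/
lemma coins_eq_bind [NeZero m] : coins n m =
    (PMF.uniformOfFintype (Fin m)).bind fun x => (PMF.uniformOfFintype (Fin m)).bind fun y =>
      (PMF.uniformOfFintype (Equiv.Perm (Fin n))).map fun σ => (pairHeld x y, σ) := by
  unfold coins
  congr 1
  funext x
  rw [secondItem_eq, PMF.bind_map]
  rfl

lemma coins_apply_toReal [NeZero m] (ω : Coins n m) : (coins n m ω).toReal =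
    ∑ x : Fin m, ∑ y : Fin m, ∑ σ : Equiv.Perm (Fin n),
      if (pairHeld x y, σ) = ω then ((m : ℝ) ^ 2 * n.factorial)⁻¹ else 0 := by
  have hm : (m : ENNReal) ≠ 0 := by exact_mod_cast NeZero.ne m
  have hn : (n.factorial : ENNReal) ≠ 0 := by exact_mod_cast n.factorial_ne_zero
  have hnt := ENNReal.natCast_ne_top n.factorial
  have hmt := ENNReal.natCast_ne_top m
  have key : coins n m ω = ∑ x : Fin m, ∑ y : Fin m, ∑ σ : Equiv.Perm (Fin n),
      if (pairHeld x y, σ) = ω then (m : ENNReal)⁻¹ * (m : ENNReal)⁻¹ * (n.factorial : ENNReal)⁻¹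
        else 0 := by
    rw [coins_eq_bind, PMF.bind_apply, tsum_fintype]
    refine sum_congr rfl fun x _ => ?_
    rw [PMF.bind_apply, tsum_fintype, mul_sum]
    refine sum_congr rfl fun y _ => ?_
    rw [PMF.map_apply, tsum_fintype, mul_sum, mul_sum]
    refine sum_congr rfl fun σ _ => ?_
    simp only [PMF.uniformOfFintype_apply, Fintype.card_fin, Fintype.card_perm, mul_ite, mul_zero,
      eq_comm (a := ω), mul_assoc]
  rw [key]
  have hfin : (m : ENNReal)⁻¹ * (m : ENNReal)⁻¹ * (n.factorial : ENNReal)⁻¹ ≠ ⊤ := by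
    simp [ENNReal.mul_eq_top, hm, hn]
  have hite : ∀ x y σ, (if (pairHeld x y, σ) = ω then
      (m : ENNReal)⁻¹ * (m : ENNReal)⁻¹ * (n.factorial : ENNReal)⁻¹ else 0) ≠ ⊤ := by
    intro x y σ
    split_ifs
    exacts [hfin, ENNReal.zero_ne_top]
  rw [ENNReal.toReal_sum fun x _ => by simp [ENNReal.sum_eq_top, hite]]
  refine sum_congr rfl fun x _ => ?_
  rw [ENNReal.toReal_sum fun y _ => by simp [ENNReal.sum_eq_top, hite]]
  refine sum_congr rfl fun y _ => ?_
  rw [ENNReal.toReal_sum fun σ _ => hite x y σ]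
  refine sum_congr rfl fun σ _ => ?_
  split_ifs
  · simp [ENNReal.toReal_mul]
    ring
  · rfl

lemma expectedValue_eq [NeZero m] (pe : PERule n m) (R : Fin n → Finset (Fin m))
    (f : Valuation (Fin m)) (v : Fin n) : expectedValue pe R f v =
      ((m : ℝ) ^ 2 * n.factorial)⁻¹ * ∑ x : Fin m, ∑ y : Fin m, ∑ σ : Equiv.Perm (Fin n),
        f (mech pe R (pairHeld x y, σ) v) := by
  unfold expectedValue
  simp only [coins_apply_toReal, sum_mul, mul_sum]
  rw [sum_comm]
  refine sum_congr rfl fun x _ => ?_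
  rw [sum_comm]
  refine sum_congr rfl fun y _ => ?_
  rw [sum_comm]
  refine sum_congr rfl fun σ _ => ?_
  simp

lemma distinct_of_mem_support [NeZero m] {ω : Coins n m} (h : ω ∈ (coins n m).support) :
    ω.1.Distinct := by
  rw [coins_eq_bind] at h
  simp only [PMF.mem_support_bind_iff, PMF.mem_support_map_iff] at h
  obtain ⟨x, -, y, -, σ, -, rfl⟩ := h
  exact pairHeld_distinct x y

/-! ### Counting priority orders -/

lemma card_perm_apply_eq (p v : Fin n) :
    n * #(univ.filter fun σ : Equiv.Perm (Fin n) => σ.symm v = p) = n.factorial := by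
  have hconst : ∀ q, #(univ.filter fun σ : Equiv.Perm (Fin n) => σ.symm v = q) =
      #(univ.filter fun σ : Equiv.Perm (Fin n) => σ.symm v = p) := by
    intro q
    refine card_equiv (Equiv.mulRight (Equiv.swap p q)) fun σ => ?_
    simp only [mem_filter, mem_univ, true_and, Equiv.coe_mulRight, Equiv.symm_apply_eq,
      Equiv.Perm.mul_apply, Equiv.swap_apply_left]
  have := card_eq_sum_card_fiberwise (s := (univ : Finset (Equiv.Perm (Fin n))))
    (t := univ) (f := fun σ => σ.symm v) (fun _ _ => mem_univ _)
  rw [sum_congr rfl fun q _ => hconst q, sum_const, card_univ, card_univ, Fintype.card_perm,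
    Fintype.card_fin, smul_eq_mul] at this
  exact this.symm

lemma card_perm_apply_eq_apply_eq {p q v w : Fin n} (hpq : p ≠ q) (hvw : v ≠ w) :
    n * ((n - 1) * #(univ.filter fun σ : Equiv.Perm (Fin n) => σ.symm v = p ∧ σ.symm w = q)) =
      n.factorial := by
  have hconst : ∀ r ∈ univ.erase p,
      #((univ.filter fun σ : Equiv.Perm (Fin n) => σ.symm v = p).filter fun σ => σ.symm w = r) =
      #(univ.filter fun σ : Equiv.Perm (Fin n) => σ.symm v = p ∧ σ.symm w = q) := by
    intro r hr
    rw [filter_filter]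
    refine card_equiv (Equiv.mulRight (Equiv.swap q r)) fun σ => ?_
    simp only [mem_filter, mem_univ, true_and, Equiv.coe_mulRight, Equiv.symm_apply_eq,
      Equiv.Perm.mul_apply, Equiv.swap_apply_left,
      Equiv.swap_apply_of_ne_of_ne hpq (ne_of_mem_erase hr).symm]
  have := card_eq_sum_card_fiberwise
    (s := univ.filter fun σ : Equiv.Perm (Fin n) => σ.symm v = p)
    (t := univ.erase p) (f := fun σ => σ.symm w) (fun σ hσ => by
      have hσ' := (mem_filter.1 (mem_coe.1 hσ)).2
      exact mem_coe.2 (mem_erase.2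
        ⟨fun h => hvw (σ.symm.injective (h.trans hσ'.symm)).symm, mem_univ _⟩))
  rw [sum_congr rfl hconst, sum_const, card_erase_of_mem (mem_univ _), card_univ,
    Fintype.card_fin, smul_eq_mul] at this
  rw [← this, card_perm_apply_eq]

/-- Averaging over the priority order makes the place of an agent uniform. -/
lemma sum_perm_place (g : Fin n → ℕ) (v : Fin n) :
    n * ∑ σ : Equiv.Perm (Fin n), g (σ.symm v) = n.factorial * ∑ q, g q := by
  have := sum_fiberwise_of_maps_to (s := (univ : Finset (Equiv.Perm (Fin n)))) (t := univ)
    (g := fun σ => σ.symm v) (fun _ _ => mem_univ _) fun σ => g (σ.symm v)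
  rw [← this, mul_sum, mul_sum]
  refine sum_congr rfl fun q _ => ?_
  rw [sum_congr rfl (g := fun _ => g q) fun σ hσ => by rw [(mem_filter.1 hσ).2], sum_const,
    smul_eq_mul, ← mul_assoc, card_perm_apply_eq]

end Coins

/-! ### Leveled valuations -/

section Leveled

variable {m : ℕ} {ε : ℝ} {f : Valuation (Fin m)}

lemma IsLeveled.eq_sum (h : IsLeveled ε f) (S : Finset (Fin m)) : f S = ∑ a ∈ S, f {a} := by
  induction S using Finset.induction_on with
  | empty => simpa using h.2.1.1
  | insert a S ha ih =>
    rw [sum_insert ha, ← ih, insert_eq, h.1 _ _ (by simpa using ha)]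

lemma IsLeveled.singleton (h : IsLeveled ε f) (a : Fin m) :
    f {a} = 0 ∨ f {a} ∈ Set.Icc 1 (1 + ε) := by
  have := h.2.2.2 ∅ a
  simpa [marginal, h.2.1.1] using this

lemma mem_demand {a : Fin m} : a ∈ demand f ↔ 0 < f {a} := by simp [demand]

lemma IsLeveled.singleton_of_mem (h : IsLeveled ε f) {a : Fin m} (ha : a ∈ demand f) :
    f {a} ∈ Set.Icc 1 (1 + ε) := by
  rcases h.singleton a with h1 | h1
  · exact absurd (mem_demand.1 ha) (by simp [h1])
  · exact h1

lemma IsLeveled.singleton_of_notMem (h : IsLeveled ε f) {a : Fin m} (ha : a ∉ demand f) :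
    f {a} = 0 := by
  rcases h.singleton a with h1 | h1
  · exact h1
  · exact absurd (mem_demand.2 (by linarith [h1.1])) ha

lemma IsLeveled.eq_sum_inter (h : IsLeveled ε f) (S : Finset (Fin m)) :
    f S = ∑ a ∈ S ∩ demand f, f {a} := by
  rw [h.eq_sum]
  refine (sum_subset inter_subset_left fun a ha hn => h.singleton_of_notMem fun hd => hn ?_).symm
  exact mem_inter.2 ⟨ha, hd⟩

lemma IsLeveled.card_le (h : IsLeveled ε f) (S : Finset (Fin m)) : (#(S ∩ demand f) : ℝ) ≤ f S := by
  rw [h.eq_sum_inter, ← nsmul_one, ← sum_const]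
  exact sum_le_sum fun a ha => (h.singleton_of_mem (mem_inter.1 ha).2).1

lemma IsLeveled.le_card (h : IsLeveled ε f) (S : Finset (Fin m)) :
    f S ≤ (1 + ε) * #(S ∩ demand f) := by
  rw [h.eq_sum_inter, mul_comm, ← nsmul_eq_mul, ← sum_const]
  exact sum_le_sum fun a ha => (h.singleton_of_mem (mem_inter.1 ha).2).2

lemma IsLeveled.card_le_of_subset (h : IsLeveled ε f) {S : Finset (Fin m)} (hS : S ⊆ demand f) :
    (#S : ℝ) ≤ f S := by
  simpa [inter_eq_left.2 hS] using h.card_le S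

lemma IsLeveled.mono (h : IsLeveled ε f) {S T : Finset (Fin m)}
    (hST : S ∩ demand f ⊆ T) : f S ≤ f T := by
  have e : f S = f (S ∩ demand f) := by rw [h.eq_sum_inter, h.eq_sum (S ∩ demand f)]
  rw [e]
  exact h.2.1.2 _ _ hST

end Leveled

/-! ### Truthfulness -/

section Guarantees

variable {n m : ℕ} {pe : PERule n m} {ε : ℝ} {f : Valuation (Fin m)}

lemma sum_indicator (x₀ y₀ : Fin m) (P : Equiv.Perm (Fin n) → Prop) [DecidablePred P] :
    ∑ x : Fin m, ∑ y : Fin m, ∑ σ : Equiv.Perm (Fin n),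
      (if x = x₀ ∧ y = y₀ ∧ P σ then (1 : ℝ) else 0) = #(univ.filter P) := by
  rw [sum_eq_single x₀ (fun x _ hx => by simp [hx]) (by simp),
    sum_eq_single y₀ (fun y _ hy => by simp [hy]) (by simp)]
  simp

theorem ex_post_truthful (hpe : ∀ R, IsEgalitarian R (pe R)) (hε0 : 0 ≤ ε) (hf : IsLeveled ε f)
    (R : Fin n → Finset (Fin m)) (X : HeldOut m) (σ : Equiv.Perm (Fin n)) (v : Fin n)
    (S : Finset (Fin m)) :
    f (mech pe (Function.update R v S) (X, σ) v) ≤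
      (1 + ε) * f (mech pe (Function.update R v (demand f)) (X, σ) v) := by
  refine (hf.le_card _).trans (mul_le_mul_of_nonneg_left ?_ (by linarith))
  refine le_trans (by exact_mod_cast card_mech_inter_le hpe R X σ v (demand f) S)
    (hf.card_le_of_subset ?_)
  simpa using mech_subset hpe (Function.update R v (demand f)) X σ v

/-- A misreport loses an item of the demand whenever the held-out items are suitable and the agent
is the first one to choose among them: if `a` is demanded but not reported, hold out `a` alone; if
`b` is reported but not demanded, hold out `b` and then an item wanted by a competitor. -/
lemma exists_gain (hpe : ∀ R, IsEgalitarian R (pe R)) (R : Fin n → Finset (Fin m)) (v : Fin n)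
    {D S : Finset (Fin m)} (hS : S ≠ D) (hcomp : ∃ w, w ≠ v ∧ (R w ∩ D).Nonempty) :
    ∃ x y : Fin m, ∀ σ : Equiv.Perm (Fin n), n - 1 - (σ.symm v : ℕ) = 0 →
      #(mech pe (Function.update R v S) (pairHeld x y, σ) v ∩ D) + 1 ≤
        #(mech pe (Function.update R v D) (pairHeld x y, σ) v) := by
  have hfirst : ∀ (σ : Equiv.Perm (Fin n)), n - 1 - (σ.symm v : ℕ) = 0 →
      ∀ u, ¬ (Fin.revPerm.trans σ).symm u < (Fin.revPerm.trans σ).symm v := by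
    intro σ hσ u h
    rw [symm_rev_trans, symm_rev_trans, Fin.lt_def, Fin.val_rev, Fin.val_rev] at h
    omega
  by_cases hDS : D ⊆ S
  · obtain ⟨b, hbS, hbD⟩ : ∃ b ∈ S, b ∉ D := by
      by_contra! h
      exact hS (Subset.antisymm h hDS)
    obtain ⟨w, hwv, c, hc⟩ := hcomp
    obtain ⟨hcw, hcD⟩ := mem_inter.1 hc
    have hbc : b ≠ c := fun h => hbD (h ▸ hcD)
    refine ⟨b, c, fun σ hσ => card_mech_inter_lt hpe R _ σ v D S ?_ ?_⟩
    · rw [eq_empty_iff_forall_notMem]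
      intro a ha
      obtain ⟨ha, haD⟩ := mem_inter.1 ha
      rw [pairHeld_of_ne hbc] at ha
      have h1 := (mem_inter.1 (heldOutMech_subset _ _ _ _ ha)).2
      simp only [heldSet, Option.toFinset_some, mem_insert, mem_singleton] at h1
      rcases h1 with rfl | rfl
      · exact hbD haD
      · exact notMem_heldOutMech_second hbc ⟨by simpa using hbS, fun u hu => absurd hu
          (hfirst σ hσ u)⟩ hwv (by simpa [hwv] using hcw) ha
    · rw [pairHeld_of_ne hbc]
      exact ⟨c, mem_heldOutMech_second (by simpa using hbD) (by simpa using hcD) fun u hu =>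
        absurd hu (hfirst σ hσ u)⟩
  · obtain ⟨a, haD, haS⟩ := not_subset.1 hDS
    refine ⟨a, a, fun σ hσ => card_mech_inter_lt hpe R _ σ v D S ?_ ?_⟩
    · rw [eq_empty_iff_forall_notMem]
      intro b hb
      obtain ⟨h1, h2⟩ := mem_inter.1 (heldOutMech_subset _ _ _ _ (mem_inter.1 hb).1)
      rw [heldSet_pairHeld] at h2
      simp only [mem_insert, mem_singleton, or_self] at h2
      rw [Function.update_self, h2] at h1
      exact haS h1
    · rw [pairHeld_self]
      exact ⟨a, mem_heldOutMech.2 (.inl ⟨rfl, by simpa using haD, fun u hu => absurd hu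
        (hfirst σ hσ u)⟩)⟩

/-- A lost item costs at least `1` with probability `1 / (n * m ^ 2)`, while the differences in
value between demanded items are worth at most `ε * m`. -/
theorem expectedValue_lt [NeZero m] (hn : 2 ≤ n) (hε0 : 0 ≤ ε)
    (hε : ε < 1 / ((n : ℝ) * (m : ℝ) ^ 3)) (hpe : ∀ R, IsEgalitarian R (pe R))
    (hf : IsLeveled ε f) (R : Fin n → Finset (Fin m)) (v : Fin n) {S : Finset (Fin m)}
    (hS : S ≠ demand f) (hcomp : ∃ w, w ≠ v ∧ (R w ∩ demand f).Nonempty) :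
    expectedValue pe (Function.update R v S) f v <
      expectedValue pe (Function.update R v (demand f)) f v := by
  have hm : (0 : ℝ) < m := by exact_mod_cast Nat.pos_of_ne_zero (NeZero.ne m)
  have hn0 : (0 : ℝ) < n := by exact_mod_cast (by omega : 0 < n)
  have hF : (0 : ℝ) < n.factorial := by exact_mod_cast n.factorial_pos
  obtain ⟨x₀, y₀, hgain⟩ := exists_gain hpe R v hS hcomp
  rw [expectedValue_eq, expectedValue_eq]
  refine mul_lt_mul_of_pos_left ?_ (by positivity)
  set p : Fin n := ⟨n - 1, by omega⟩ with hp
  have hpt : ∀ x y σ, f (mech pe (Function.update R v S) (pairHeld x y, σ) v) +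
      (if x = x₀ ∧ y = y₀ ∧ σ.symm v = p then (1 : ℝ) else 0) ≤
      f (mech pe (Function.update R v (demand f)) (pairHeld x y, σ) v) + ε * m := by
    intro x y σ
    have h1 := hf.le_card (mech pe (Function.update R v S) (pairHeld x y, σ) v)
    have h2 : mech pe (Function.update R v (demand f)) (pairHeld x y, σ) v ⊆ demand f := by
      simpa using mech_subset hpe (Function.update R v (demand f)) (pairHeld x y) σ v
    have h3 := hf.card_le_of_subset h2
    have h4 : (#(mech pe (Function.update R v (demand f)) (pairHeld x y, σ) v) : ℝ) ≤ m := by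
      exact_mod_cast (card_le_univ _).trans (by simp)
    have h5 : (#(mech pe (Function.update R v S) (pairHeld x y, σ) v ∩ demand f) : ℝ) +
        (if x = x₀ ∧ y = y₀ ∧ σ.symm v = p then (1 : ℝ) else 0) ≤
        #(mech pe (Function.update R v (demand f)) (pairHeld x y, σ) v) := by
      split_ifs with h
      · obtain ⟨rfl, rfl, h⟩ := h
        exact_mod_cast hgain σ (by rw [h]; simp [hp])
      · rw [add_zero]
        exact_mod_cast card_mech_inter_le hpe R (pairHeld x y) σ v (demand f) S
    have h6 : (0 : ℝ) ≤ if x = x₀ ∧ y = y₀ ∧ σ.symm v = p then (1 : ℝ) else 0 := by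
      split_ifs <;> norm_num
    nlinarith
  have hsum := sum_le_sum fun x (_ : x ∈ univ) => sum_le_sum fun y (_ : y ∈ univ) =>
    sum_le_sum fun σ (_ : σ ∈ univ) => hpt x y σ
  simp only [sum_add_distrib, sum_indicator, sum_const, card_univ, Fintype.card_perm,
    Fintype.card_fin, nsmul_eq_mul] at hsum
  have hc : (n : ℝ) * #(univ.filter fun σ : Equiv.Perm (Fin n) => σ.symm v = p) = n.factorial := by
    exact_mod_cast card_perm_apply_eq p v
  set c : ℝ := (#(univ.filter fun σ : Equiv.Perm (Fin n) => σ.symm v = p) : ℝ)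
  have hc0 : 0 < c := by
    by_contra! h
    nlinarith
  rw [lt_div_iff₀ (by positivity)] at hε
  have : (m : ℝ) * (m * (n.factorial * (ε * m))) < c := by
    rw [← hc]
    nlinarith
  linarith

lemma mech_eq_of_no_competition (hpe : ∀ R, IsEgalitarian R (pe R)) (R : Fin n → Finset (Fin m))
    (X : HeldOut m) (σ : Equiv.Perm (Fin n)) (v : Fin n)
    (h : ∀ w, w ≠ v → Disjoint (R w) (R v)) : mech pe R (X, σ) v = R v := by
  refine Subset.antisymm (mech_subset hpe R X σ v) fun a ha => ?_
  obtain ⟨w, hw⟩ := exists_mem_mech hpe X σ ha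
  by_cases hwv : w = v
  · exact hwv ▸ hw
  · exact absurd ha (disjoint_left.1 (h w hwv) (mech_subset hpe R X σ w hw))

theorem expectedValue_le [NeZero m] (hn : 2 ≤ n) (hε0 : 0 ≤ ε)
    (hε : ε < 1 / ((n : ℝ) * (m : ℝ) ^ 3)) (hpe : ∀ R, IsEgalitarian R (pe R))
    (hf : IsLeveled ε f) (R : Fin n → Finset (Fin m)) (v : Fin n) (S : Finset (Fin m)) :
    expectedValue pe (Function.update R v S) f v ≤
      expectedValue pe (Function.update R v (demand f)) f v := by
  by_cases hS : S = demand f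
  · rw [hS]
  by_cases hcomp : ∃ w, w ≠ v ∧ (R w ∩ demand f).Nonempty
  · exact (expectedValue_lt hn hε0 hε hpe hf R v hS hcomp).le
  · push Not at hcomp
    rw [expectedValue_eq, expectedValue_eq]
    refine mul_le_mul_of_nonneg_left ?_ (by positivity)
    refine sum_le_sum fun x _ => sum_le_sum fun y _ => sum_le_sum fun σ _ => hf.mono ?_
    rw [mech_eq_of_no_competition hpe (Function.update R v (demand f))]
    · simp
    · intro w hw
      simpa [hw, disjoint_iff_inter_eq_empty] using hcomp w hw

/-! ### Efficiency -/

theorem mech_isReasonable (hpe : ∀ R, IsEgalitarian R (pe R)) {g : Fin n → Valuation (Fin m)}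
    (hg : ∀ v, IsLeveled ε (g v)) {X : HeldOut m} (hX : X.Distinct) (σ : Equiv.Perm (Fin n)) :
    IsReasonable g (mech pe (fun v => demand (g v)) (X, σ)) := by
  set R : Fin n → Finset (Fin m) := fun v => demand (g v) with hR
  have hsub := mech_subset hpe R X σ
  refine ⟨mech_isAllocation hpe R hX σ, fun v a ha => ?_, fun B hB hnr => ?_⟩
  · have h1 := (hg v).1 ((mech pe R (X, σ) v).erase a) {a} (by simp)
    rw [union_comm, ← insert_eq, insert_erase ha] at h1
    have := mem_demand.1 (hsub v ha)
    linarith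
  · rw [← card_biUnion_eq_sum hB, ← card_biUnion_eq_sum (mech_isAllocation hpe R hX σ)]
    refine card_le_card fun a ha => ?_
    obtain ⟨v, -, hv⟩ := mem_biUnion.1 ha
    have h1 := (hg v).1 ((B v).erase a) {a} (by simp)
    rw [union_comm, ← insert_eq, insert_erase hv] at h1
    have haR : a ∈ R v := mem_demand.2 (by linarith [hnr v a hv])
    obtain ⟨w, hw⟩ := exists_mem_mech hpe X σ haR
    exact mem_biUnion.2 ⟨w, mem_univ _, hw⟩

theorem le_welfare_mech (hpe : ∀ R, IsEgalitarian R (pe R)) (hε0 : 0 ≤ ε)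
    {g : Fin n → Valuation (Fin m)} (hg : ∀ v, IsLeveled ε (g v)) {X : HeldOut m}
    (hX : X.Distinct) (σ : Equiv.Perm (Fin n)) {B : Fin n → Finset (Fin m)}
    (hB : IsAllocation B) :
    1 / (1 + ε) * welfare g B ≤ welfare g (mech pe (fun v => demand (g v)) (X, σ)) := by
  set R : Fin n → Finset (Fin m) := fun v => demand (g v) with hR
  have hsub := mech_subset hpe R X σ
  have h1 : welfare g B ≤ (1 + ε) * (∑ v, #(B v ∩ R v) : ℕ) := by
    rw [welfare, Nat.cast_sum, mul_sum]
    exact sum_le_sum fun v _ => (hg v).le_card _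
  have h2 : ∑ v, #(B v ∩ R v) ≤ ∑ v, #(mech pe R (X, σ) v) := by
    rw [← card_biUnion_eq_sum (mech_isAllocation hpe R hX σ),
      ← card_biUnion_eq_sum (A := fun v => B v ∩ R v) fun v w hvw =>
        (hB v w hvw).mono inter_subset_left inter_subset_left]
    refine card_le_card fun a ha => ?_
    obtain ⟨v, -, hv⟩ := mem_biUnion.1 ha
    obtain ⟨w, hw⟩ := exists_mem_mech hpe X σ (mem_inter.1 hv).2
    exact mem_biUnion.2 ⟨w, mem_univ _, hw⟩
  have h3 : ((∑ v, #(mech pe R (X, σ) v) : ℕ) : ℝ) ≤ welfare g (mech pe R (X, σ)) := by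
    rw [welfare, Nat.cast_sum]
    exact sum_le_sum fun v _ => (hg v).card_le_of_subset (hsub v)
  have h2' : ((∑ v, #(B v ∩ R v) : ℕ) : ℝ) ≤ (∑ v, #(mech pe R (X, σ) v) : ℕ) := by
    exact_mod_cast h2
  rw [one_div, inv_mul_le_iff₀ (by linarith)]
  exact h1.trans (mul_le_mul_of_nonneg_left (h2'.trans h3) (by linarith))

/-! ### Ex-post fairness -/

theorem mech_isEF1For (hpe : ∀ R, IsEgalitarian R (pe R)) (hε0 : 0 ≤ ε) (hf : IsLeveled ε f)
    {R : Fin n → Finset (Fin m)} {v : Fin n} (hv : R v = demand f) (X : HeldOut m)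
    (σ : Equiv.Perm (Fin n)) : IsEF1For (1 / (1 + ε)) f (mech pe R (X, σ)) v := by
  intro w hw
  have hsub : mech pe R (X, σ) v ⊆ demand f := hv ▸ mech_subset hpe R X σ v
  have hlow := hf.card_le_of_subset hsub
  suffices h : ∃ a ∈ mech pe R (X, σ) w,
      #((mech pe R (X, σ) w).erase a ∩ demand f) ≤ #(mech pe R (X, σ) v) by
    obtain ⟨a, ha, h⟩ := h
    refine ⟨a, ha, ?_⟩
    rw [one_div, inv_mul_le_iff₀ (by linarith)]
    refine (hf.le_card _).trans (mul_le_mul_of_nonneg_left (le_trans ?_ hlow) (by linarith))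
    exact_mod_cast h
  by_cases hvw : v = w
  · subst hvw
    obtain ⟨a, ha⟩ := hw
    exact ⟨a, ha, card_le_card (inter_subset_left.trans (erase_subset _ _))⟩
  have hle := card_mech_inter_le_succ hpe R X σ hvw
  rw [hv] at hle
  rcases (mech pe R (X, σ) w ∩ demand f).eq_empty_or_nonempty with h | ⟨a, ha⟩
  · obtain ⟨a, ha⟩ := hw
    refine ⟨a, ha, ?_⟩
    rw [erase_inter, h]
    simp
  · refine ⟨a, (mem_inter.1 ha).1, ?_⟩
    rw [erase_inter, card_erase_of_mem ha]
    omega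

theorem maximinShare_le (hpe : ∀ R, IsEgalitarian R (pe R)) (hε0 : 0 ≤ ε)
    (hf : IsLeveled ε f) {R : Fin n → Finset (Fin m)} {v : Fin n} (hv : R v = demand f)
    (X : HeldOut m) (σ : Equiv.Perm (Fin n)) :
    1 / (1 + ε) * maximinShare n f ≤ f (mech pe R (X, σ) v) := by
  set A := mech pe R (X, σ) with hA
  have hsub : A v ⊆ demand f := hv ▸ mech_subset hpe R X σ v
  have hlow := hf.card_le_of_subset hsub
  have hcard : #(demand f) < n * (#(A v) + 1) := by
    have h1 : #(demand f) ≤ ∑ w, #(A w ∩ demand f) := by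
      refine (card_le_card ?_).trans card_biUnion_le
      intro a ha
      obtain ⟨w, hw⟩ := exists_mem_mech (R := R) (u := v) hpe X σ (hv ▸ ha)
      exact mem_biUnion.2 ⟨w, mem_univ _, mem_inter.2 ⟨hw, ha⟩⟩
    have h2 : ∑ w, #(A w ∩ demand f) < ∑ _w : Fin n, (#(A v) + 1) := by
      refine sum_lt_sum (fun w _ => ?_) ⟨v, mem_univ _, ?_⟩
      · by_cases hvw : v = w
        · subst hvw
          exact (card_le_card inter_subset_left).trans (Nat.le_succ _)
        · exact hv ▸ card_mech_inter_le_succ hpe R X σ hvw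
      · exact Nat.lt_succ_of_le (card_le_card inter_subset_left)
    rw [sum_const, card_univ, Fintype.card_fin, smul_eq_mul] at h2
    omega
  have : Nonempty (Fin n) := ⟨v⟩
  rw [one_div, inv_mul_le_iff₀ (by linarith)]
  refine ciSup_le fun P => ?_
  -- by the pigeonhole principle, some bundle of the partition has few demanded items
  obtain ⟨j, -, hj⟩ := exists_card_fiber_lt_of_card_lt_mul (s := demand f)
    (t := (univ : Finset (Fin n))) (f := P) (n := #(A v) + 1) (by simpa using hcard)
  refine (ciInf_le (Set.finite_range _).bddBelow j).trans ?_
  refine (hf.le_card _).trans (mul_le_mul_of_nonneg_left (le_trans ?_ hlow) (by linarith))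
  have e : (univ.filter fun a => P a = j) ∩ demand f = (demand f).filter fun a => P a = j := by
    ext
    simp [and_comm]
  rw [e]
  exact_mod_cast Nat.le_of_lt_succ hj

/-! ### Proportionality in expectation -/

/-- If the reports of the agents other than `v` are not all equal to the one of `v`, then `v`
gets an item beyond her guaranteed number in some event of probability
`1 / (m ^ 2 * (n * (n - 1)))`. -/
lemma exists_bonus (hn : 2 ≤ n) (hpe : ∀ R, IsEgalitarian R (pe R)) (R : Fin n → Finset (Fin m))
    {v w : Fin n} (hne : R w ≠ R v) (hD : (R v).Nonempty) :
    ∃ x y : Fin m, ∀ σ : Equiv.Perm (Fin n), (σ.symm w : ℕ) = n - 1 → (σ.symm v : ℕ) = n - 2 →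
      sizeBound n (R v) (heldSet (pairHeld x y)) (σ.symm v) + 1 ≤
        #(mech pe R (pairHeld x y, σ) v) := by
  have hbefore : ∀ σ : Equiv.Perm (Fin n), (σ.symm w : ℕ) = n - 1 → (σ.symm v : ℕ) = n - 2 →
      ∀ u, (Fin.revPerm.trans σ).symm u < (Fin.revPerm.trans σ).symm v → u = w := by
    intro σ hw hv u hu
    rw [symm_rev_trans, symm_rev_trans, Fin.lt_def, Fin.val_rev, Fin.val_rev] at hu
    have := (σ.symm u).2
    exact σ.symm.injective (Fin.ext (by omega))
  by_cases hsub : R v ⊆ R w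
  · obtain ⟨b, hbw, hbv⟩ : ∃ b ∈ R w, b ∉ R v := by
      by_contra! h
      exact hne (Subset.antisymm h hsub)
    obtain ⟨c, hc⟩ := hD
    have hbc : b ≠ c := fun h => hbv (h ▸ hc)
    refine ⟨b, c, fun σ hw hv => sizeBound_lt hpe R _ σ v ?_ ?_⟩
    · rw [heldSet_pairHeld, hv]
      have : R v ∩ {b, c} ⊆ {c} := by
        intro a ha
        obtain ⟨h1, h2⟩ := mem_inter.1 ha
        rcases mem_insert.1 h2 with rfl | h2
        · exact absurd h1 hbv
        · exact h2
      have := card_le_card this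
      rw [card_singleton] at this
      omega
    · rw [pairHeld_of_ne hbc]
      refine ⟨c, mem_heldOutMech_second hbv hc fun u hu => ?_⟩
      rw [hbefore σ hw hv u hu]
      refine ⟨hbw, fun z hz => ?_⟩
      rw [symm_rev_trans, symm_rev_trans, Fin.lt_def, Fin.val_rev, Fin.val_rev] at hz
      omega
  · obtain ⟨a, hav, haw⟩ := not_subset.1 hsub
    refine ⟨a, a, fun σ hw hv => sizeBound_lt hpe R _ σ v ?_ ?_⟩
    · rw [heldSet_pairHeld, hv]
      have := card_le_card (inter_subset_right (s₁ := R v) (s₂ := {a, a}))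
      rw [insert_eq_of_mem (mem_singleton_self a), card_singleton] at this
      rw [insert_eq_of_mem (mem_singleton_self a)]
      omega
    · rw [pairHeld_self]
      exact ⟨a, mem_heldOutMech.2 (.inl ⟨rfl, hav, fun u hu => hbefore σ hw hv u hu ▸ haw⟩)⟩

/-- When all reports are equal, the mechanism treats the agents symmetrically. -/
lemma mech_const_relabel (D : Finset (Fin m)) (X : HeldOut m) (σ π : Equiv.Perm (Fin n))
    (v : Fin n) : mech pe (fun _ => D) (X, π * σ) (π v) = mech pe (fun _ => D) (X, σ) v := by
  have hsymm : ∀ ρ : Equiv.Perm (Fin n), ∀ u, (ρ.trans π).symm (π u) = ρ.symm u :=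
    fun ρ u => by simp
  have hF : ∀ (ρ : Equiv.Perm (Fin n)) (x : Fin m) (u : Fin n),
      IsFirst (ρ.trans π) (fun _ => D) x (π u) ↔ IsFirst ρ (fun _ => D) x u := by
    intro ρ x u
    unfold IsFirst
    rw [hsymm, ← π.forall_congr_right]
    simp only [hsymm]
  have hU : ∀ (ρ : Equiv.Perm (Fin n)) (x : Fin m) (u : Fin n),
      updatedPlace (ρ.trans π) (fun _ => D) x (π u) = updatedPlace ρ (fun _ => D) x u := by
    intro ρ x u
    by_cases h : IsFirst ρ (fun _ => D) x u
    · rw [updatedPlace_of_isFirst h, updatedPlace_of_isFirst ((hF ρ x u).2 h)]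
    · rw [updatedPlace_of_not h, updatedPlace_of_not (mt (hF ρ x u).1 h), hsymm]
  rw [mech_eq, mech_eq]
  have h1 : peWith pe (π * σ) (fun _ => D \ heldSet X) (π v) =
      peWith pe σ (fun _ => D \ heldSet X) v := by
    simp [peWith, Equiv.Perm.mul_def]
  have h2 : Fin.revPerm.trans (π * σ) = (Fin.revPerm.trans σ).trans π := rfl
  rw [h1, h2]
  congr 1
  ext a
  rw [mem_heldOutMech, mem_heldOutMech, hF, hU, ← π.forall_congr_right]
  simp only [hU]

lemma sum_mech_const (hpe : ∀ R, IsEgalitarian R (pe R)) (hf : IsLeveled ε f) {X : HeldOut m}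
    (hX : X.Distinct) (v : Fin n) :
    n * ∑ σ : Equiv.Perm (Fin n), f (mech pe (fun _ => demand f) (X, σ) v) =
      n.factorial * f univ := by
  have hconst : ∀ w, ∑ σ : Equiv.Perm (Fin n), f (mech pe (fun _ => demand f) (X, σ) w) =
      ∑ σ : Equiv.Perm (Fin n), f (mech pe (fun _ => demand f) (X, σ) v) := by
    intro w
    rw [← Equiv.sum_comp (Equiv.mulLeft (Equiv.swap v w))]
    refine sum_congr rfl fun σ _ => ?_
    have := mech_const_relabel (pe := pe) (demand f) X σ (Equiv.swap v w) v
    rw [Equiv.swap_apply_left] at this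
    rw [Equiv.coe_mulLeft, this]
  have hall : ∀ σ : Equiv.Perm (Fin n),
      ∑ w, f (mech pe (fun _ => demand f) (X, σ) w) = f univ := by
    intro σ
    have hd := mech_isAllocation hpe (fun _ => demand f) hX σ
    simp only [hf.eq_sum (mech pe _ _ _)]
    rw [hf.eq_sum_inter univ, ← sum_biUnion fun i _ j _ hij => hd i j hij]
    refine sum_congr ?_ fun _ _ => rfl
    ext a
    simp only [mem_biUnion, mem_univ, true_and, univ_inter]
    constructor
    · rintro ⟨w, hw⟩
      exact mech_subset hpe _ X σ w hw
    · exact fun ha => exists_mem_mech (R := fun _ => demand f) (u := v) hpe X σ ha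
  calc (n : ℝ) * ∑ σ : Equiv.Perm (Fin n), f (mech pe (fun _ => demand f) (X, σ) v)
      = ∑ w : Fin n, ∑ σ : Equiv.Perm (Fin n), f (mech pe (fun _ => demand f) (X, σ) w) := by
        rw [sum_congr rfl fun w _ => hconst w]
        simp
    _ = n.factorial * f univ := by
        rw [sum_comm, sum_congr rfl fun σ _ => hall σ]
        simp [Fintype.card_perm]

/-- Summed over all priority orders, the guaranteed sizes make up a proportional share of the number
of demanded items. Either all reports agree, and the share is exact by symmetry, or the bonus
makes up for the differences in value between demanded items. -/
theorem proportional_in_expectation [NeZero m] (hn : 2 ≤ n) (hε0 : 0 ≤ ε)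
    (hε : ε < 1 / ((n : ℝ) * (m : ℝ) ^ 3)) (hpe : ∀ R, IsEgalitarian R (pe R))
    (hf : IsLeveled ε f) (R : Fin n → Finset (Fin m)) (v : Fin n) (hv : R v = demand f) :
    f univ / n ≤ expectedValue pe R f v := by
  have hm : (0 : ℝ) < m := by exact_mod_cast Nat.pos_of_ne_zero (NeZero.ne m)
  have hn0 : (0 : ℝ) < n := by exact_mod_cast (by omega : 0 < n)
  have hF : (0 : ℝ) < n.factorial := by exact_mod_cast n.factorial_pos
  rw [expectedValue_eq, le_inv_mul_iff₀ (by positivity)]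
  rcases (demand f).eq_empty_or_nonempty with hD | hD
  · have h0 : ∀ S, f S = 0 := fun S => by rw [hf.eq_sum_inter, hD]; simp
    simp [h0]
  by_cases hall : ∀ w, R w = demand f
  · have hR : R = fun _ => demand f := funext hall
    rw [hR]
    have hxy : ∀ x y : Fin m, ∑ σ : Equiv.Perm (Fin n),
        f (mech pe (fun _ => demand f) (pairHeld x y, σ) v) = n.factorial * f univ / n :=
      fun x y => by
        rw [eq_div_iff hn0.ne', mul_comm]
        exact sum_mech_const hpe hf (pairHeld_distinct x y) v
    simp only [hxy, sum_const, card_univ, Fintype.card_fin, nsmul_eq_mul]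
    apply le_of_eq
    ring
  · push Not at hall
    obtain ⟨w, hw⟩ := hall
    have hwv : w ≠ v := fun e => hw (e ▸ hv)
    obtain ⟨x₀, y₀, hbonus⟩ := exists_bonus hn hpe R (hv ▸ hw) (hv ▸ hD)
    set p : Fin n := ⟨n - 2, by omega⟩ with hp
    set q : Fin n := ⟨n - 1, by omega⟩ with hq
    have hpq : p ≠ q := fun e => by
      have := congrArg Fin.val e
      simp only [hp, hq] at this
      omega
    have hpt : ∀ x y σ, (sizeBound n (R v) (heldSet (pairHeld x y)) (σ.symm v) : ℝ) +
        (if x = x₀ ∧ y = y₀ ∧ (σ.symm v = p ∧ σ.symm w = q) then (1 : ℝ) else 0) ≤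
        f (mech pe R (pairHeld x y, σ) v) := by
      intro x y σ
      have h2 : mech pe R (pairHeld x y, σ) v ⊆ demand f :=
        hv ▸ mech_subset hpe R (pairHeld x y) σ v
      refine le_trans ?_ (hf.card_le_of_subset h2)
      split_ifs with h
      · obtain ⟨rfl, rfl, h1, h2⟩ := h
        exact_mod_cast hbonus σ (by rw [h2]) (by rw [h1])
      · rw [add_zero]
        exact_mod_cast sizeBound_le hpe R (pairHeld x y) σ v
    have hsum := sum_le_sum fun x (_ : x ∈ univ) => sum_le_sum fun y (_ : y ∈ univ) =>
      sum_le_sum fun σ (_ : σ ∈ univ) => hpt x y σ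
    have hplace : ∀ x y : Fin m, ∑ σ : Equiv.Perm (Fin n),
        (sizeBound n (R v) (heldSet (pairHeld x y)) (σ.symm v) : ℝ) =
        n.factorial * #(demand f) / n := by
      intro x y
      rw [eq_div_iff hn0.ne', mul_comm, ← hv, ← sum_sizeBound hn (R v) (pairHeld x y)]
      exact_mod_cast sum_perm_place
        (fun q => sizeBound n (R v) (heldSet (pairHeld x y)) q) v
    simp only [sum_add_distrib, sum_indicator, hplace, sum_const, card_univ,
      Fintype.card_fin, nsmul_eq_mul] at hsum
    refine le_trans ?_ hsum
    have hc : (n : ℝ) * ((n - 1) *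
        #(univ.filter fun σ : Equiv.Perm (Fin n) => σ.symm v = p ∧ σ.symm w = q)) =
        n.factorial := by
      have := card_perm_apply_eq_apply_eq hpq hwv.symm
      rw [← this]
      push_cast [Nat.cast_sub (by omega : 1 ≤ n)]
      ring
    set c : ℝ :=
      (#(univ.filter fun σ : Equiv.Perm (Fin n) => σ.symm v = p ∧ σ.symm w = q) : ℝ)
    have hn1 : (0 : ℝ) < n - 1 := by
      have : (2 : ℝ) ≤ n := by exact_mod_cast hn
      linarith
    have hc0 : 0 < c := by
      by_contra! h
      nlinarith [mul_pos hn0 hn1]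
    have hup : f univ ≤ (1 + ε) * #(demand f) := by
      simpa using hf.le_card univ
    have hdm : (#(demand f) : ℝ) ≤ m := by
      exact_mod_cast (card_le_univ _).trans (by simp)
    have hd0 : (0 : ℝ) ≤ #(demand f) := by positivity
    rw [lt_div_iff₀ (by positivity)] at hε
    have hFn : (n.factorial : ℝ) / n = (n - 1) * c := by
      rw [← hc]
      field_simp
    have e1 : (m : ℝ) ^ 2 * n.factorial * (f univ / n) = m ^ 2 * ((n - 1) * c) * f univ := by
      rw [← hFn]
      ring
    have e2 : (m : ℝ) * (m * (n.factorial * #(demand f) / n)) =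
        m ^ 2 * ((n - 1) * c) * #(demand f) := by
      rw [← hFn]
      ring
    rw [e1, e2]
    have h1 : (m : ℝ) ^ 2 * ((n - 1) * c) * f univ ≤
        m ^ 2 * ((n - 1) * c) * ((1 + ε) * #(demand f)) :=
      mul_le_mul_of_nonneg_left hup (by positivity)
    have h2 : (m : ℝ) ^ 2 * (n - 1) * (ε * #(demand f)) ≤ 1 := by
      calc (m : ℝ) ^ 2 * (n - 1) * (ε * #(demand f)) ≤ m ^ 2 * n * (ε * m) := by
            gcongr
            linarith
        _ = ε * (n * m ^ 3) := by ring
        _ ≤ 1 := hε.le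
    nlinarith

end Guarantees

/-! ### Deterministic runs of the machine -/

/-- `Big p s s' t`: the program `p`, started in the memory `s`, draws no random number and ends
after exactly `t` steps in the memory `s'`. -/
inductive Big : Program → Memory → Memory → ℕ → Prop
  | assign (t : ℕ) (i j e : Expr) (s : Memory) :
      Big (.assign t i j e) s (s.write t (i.eval s) (j.eval s) (e.eval s)) 1
  | seq {p q : Program} {s s₁ s₂ : Memory} {a b : ℕ} :
      Big p s s₁ a → Big q s₁ s₂ b → Big (.seq p q) s s₂ (a + b + 1)
  | cond_true {e : Expr} {p q : Program} {s s' : Memory} {a : ℕ} :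
      e.eval s ≠ 0 → Big p s s' a → Big (.cond e p q) s s' (a + 1)
  | cond_false {e : Expr} {p q : Program} {s s' : Memory} {a : ℕ} :
      e.eval s = 0 → Big q s s' a → Big (.cond e p q) s s' (a + 1)
  | loop_done {e : Expr} {p : Program} {s : Memory} : e.eval s = 0 → Big (.loop e p) s s 1
  | loop_step {e : Expr} {p : Program} {s s₁ s₂ : Memory} {a b : ℕ} :
      e.eval s ≠ 0 → Big p s s₁ a → Big (.loop e p) s₁ s₂ b → Big (.loop e p) s s₂ (a + b + 1)

lemma run_add (a b : ℕ) (c : Config) : run (a + b) c = (run a c).bind (run b) := by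
  induction a generalizing c with
  | zero => simp [run, PMF.pure_bind]
  | succ a ih =>
    rw [Nat.succ_add, run, run, PMF.bind_bind]
    congr 1
    funext c'
    exact ih c'

lemma run_halted (T : ℕ) (s : Memory) : run T ([], s) = PMF.pure ([], s) := by
  induction T with
  | zero => rfl
  | succ T ih => rw [run, step, PMF.pure_bind, ih]

lemma Big.run {p : Program} {s s' : Memory} {t : ℕ} (h : Big p s s' t) (K : List Program) :
    run t (p :: K, s) = PMF.pure (K, s') := by
  induction h generalizing K with
  | assign t i j e s => simp [FairAllocation.run, step]
  | seq _ _ ihp ihq =>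
    rw [FairAllocation.run, step, PMF.pure_bind, run_add, ihp, PMF.pure_bind, ihq]
  | cond_true he _ ih => rw [FairAllocation.run, step, PMF.pure_bind, if_pos he, ih]
  | cond_false he _ ih => rw [FairAllocation.run, step, PMF.pure_bind, if_neg (not_not.2 he), ih]
  | loop_done he =>
    rw [FairAllocation.run, step, PMF.pure_bind, if_neg (not_not.2 he), FairAllocation.run]
  | loop_step he _ _ ihp ihq =>
    rw [FairAllocation.run, step, PMF.pure_bind, if_pos he, run_add, ihp, PMF.pure_bind, ihq]

/-! ### Frames: which tables a program can read and write -/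

/-- The tables that occur in an expression. -/
def Expr.tables : Expr → List ℕ
  | .const _ => []
  | .get t i j => t :: (i.tables ++ j.tables)
  | .add e₁ e₂ => e₁.tables ++ e₂.tables
  | .sub e₁ e₂ => e₁.tables ++ e₂.tables

/-- The tables that occur in a program. -/
def Program.tables : Program → List ℕ
  | .assign t i j e => t :: (i.tables ++ (j.tables ++ e.tables))
  | .rand t i j e => t :: (i.tables ++ (j.tables ++ e.tables))
  | .seq p q => p.tables ++ q.tables
  | .cond e p q => e.tables ++ (p.tables ++ q.tables)
  | .loop e p => e.tables ++ p.tables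

/-- The tables that a program can change. -/
def Program.mods : Program → List ℕ
  | .assign t _ _ _ => [t]
  | .rand t _ _ _ => [t]
  | .seq p q => p.mods ++ q.mods
  | .cond _ p q => p.mods ++ q.mods
  | .loop _ p => p.mods

lemma Memory.write_ne {s : Memory} {t t' i j k : ℕ} (h : t' ≠ t) : s.write t i j k t' = s t' := by
  funext i' j'
  simp [Memory.write, h]

lemma Memory.write_same (s : Memory) (t i j k i' j' : ℕ) :
    s.write t i j k t i' j' = if i' = i ∧ j' = j then k else s t i' j' := by
  simp [Memory.write]

lemma Memory.write_self (s : Memory) (t i j k : ℕ) : s.write t i j k t i j = k := by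
  simp [Memory.write]

lemma Big.eq_of_notMem_mods {p : Program} {s s' : Memory} {k : ℕ} (h : Big p s s' k) {t : ℕ}
    (ht : t ∉ p.mods) : s' t = s t := by
  induction h with
  | assign => exact Memory.write_ne (by simpa [Program.mods] using ht)
  | seq _ _ ihp ihq =>
    simp only [Program.mods, List.mem_append, not_or] at ht
    rw [ihq ht.2, ihp ht.1]
  | cond_true _ _ ih =>
    simp only [Program.mods, List.mem_append, not_or] at ht
    exact ih ht.1
  | cond_false _ _ ih =>
    simp only [Program.mods, List.mem_append, not_or] at ht
    exact ih ht.2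
  | loop_done => rfl
  | loop_step _ _ _ ihp ihq => rw [ihq ht, ihp ht]

lemma Expr.eval_congr {S : List ℕ} {s u : Memory} (h : ∀ t ∈ S, s t = u t) (e : Expr)
    (he : e.tables ⊆ S) : e.eval s = e.eval u := by
  induction e with
  | const k => rfl
  | get t i j ihi ihj =>
    simp only [Expr.tables, List.cons_subset, List.append_subset] at he
    simp only [Expr.eval, ihi he.2.1, ihj he.2.2, h t he.1]
  | add e₁ e₂ ih₁ ih₂ =>
    simp only [Expr.tables, List.append_subset] at he
    simp only [Expr.eval, ih₁ he.1, ih₂ he.2]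
  | sub e₁ e₂ ih₁ ih₂ =>
    simp only [Expr.tables, List.append_subset] at he
    simp only [Expr.eval, ih₁ he.1, ih₂ he.2]

/-- A run depends only on the tables that occur in the program. -/
lemma Big.congr {S : List ℕ} {p : Program} {s s' u : Memory} {k : ℕ} (h : Big p s s' k)
    (hp : p.tables ⊆ S) (hu : ∀ t ∈ S, s t = u t) :
    ∃ u', Big p u u' k ∧ ∀ t ∈ S, s' t = u' t := by
  induction h generalizing u with
  | assign t i j e s =>
    simp only [Program.tables, List.cons_subset, List.append_subset] at hp
    refine ⟨_, .assign t i j e u, fun t' ht' => ?_⟩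
    rw [Expr.eval_congr hu i hp.2.1, Expr.eval_congr hu j hp.2.2.1, Expr.eval_congr hu e hp.2.2.2]
    funext i' j'
    simp only [Memory.write, hu t' ht']
  | seq _ _ ihp ihq =>
    simp only [Program.tables, List.append_subset] at hp
    obtain ⟨u₁, h₁, hu₁⟩ := ihp hp.1 hu
    obtain ⟨u₂, h₂, hu₂⟩ := ihq hp.2 hu₁
    exact ⟨u₂, .seq h₁ h₂, hu₂⟩
  | cond_true he _ ih =>
    simp only [Program.tables, List.append_subset] at hp
    obtain ⟨u₁, h₁, hu₁⟩ := ih hp.2.1 hu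
    exact ⟨u₁, .cond_true (Expr.eval_congr hu _ hp.1 ▸ he) h₁, hu₁⟩
  | cond_false he _ ih =>
    simp only [Program.tables, List.append_subset] at hp
    obtain ⟨u₁, h₁, hu₁⟩ := ih hp.2.2 hu
    exact ⟨u₁, .cond_false (Expr.eval_congr hu _ hp.1 ▸ he) h₁, hu₁⟩
  | loop_done he =>
    simp only [Program.tables, List.append_subset] at hp
    exact ⟨u, .loop_done (Expr.eval_congr hu _ hp.1 ▸ he), hu⟩
  | loop_step he _ _ ihp ihq =>
    have hp' := hp
    simp only [Program.tables, List.append_subset] at hp'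
    obtain ⟨u₁, h₁, hu₁⟩ := ihp hp'.2 hu
    obtain ⟨u₂, h₂, hu₂⟩ := ihq hp hu₁
    exact ⟨u₂, .loop_step (Expr.eval_congr hu _ hp'.1 ▸ he) h₁ h₂, hu₂⟩

/-! ### Total correctness with a time bound -/

/-- The program `p`, started in the memory `s`, ends within `L ^ k` steps in a memory that
satisfies `Q`. Since a loop of fewer than `L` rounds and a sequential composition raise the exponent
by a constant, the nesting depth of a program determines a polynomial time bound. -/
def Ends (L k : ℕ) (p : Program) (s : Memory) (Q : Memory → Prop) : Prop :=
  ∃ s' t, Big p s s' t ∧ t ≤ L ^ k ∧ Q s'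

section Rules

variable {L k : ℕ} {s : Memory} {Q Q' : Memory → Prop} {p q : Program} {e : Expr}

lemma Ends.mono (h : Ends L k p s Q) (hQ : ∀ s', Q s' → Q' s') : Ends L k p s Q' := by
  obtain ⟨s', t, h1, h2, h3⟩ := h
  exact ⟨s', t, h1, h2, hQ s' h3⟩

lemma Ends.mono_exp (hL : 0 < L) {k' : ℕ} (h : Ends L k p s Q) (hk : k ≤ k') :
    Ends L k' p s Q := by
  obtain ⟨s', t, h1, h2, h3⟩ := h
  exact ⟨s', t, h1, h2.trans (Nat.pow_le_pow_right hL hk), h3⟩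

/-- The postcondition may use that the program changes no other tables. -/
lemma Ends.keep (h : Ends L k p s Q) : Ends L k p s fun s' => Q s' ∧ ∀ t ∉ p.mods, s' t = s t := by
  obtain ⟨s', t, h1, h2, h3⟩ := h
  exact ⟨s', t, h1, h2, h3, fun _ ht => h1.eq_of_notMem_mods ht⟩

lemma Ends.assign (hL : 0 < L) {t : ℕ} {i j : Expr}
    (h : Q (s.write t (i.eval s) (j.eval s) (e.eval s))) : Ends L k (.assign t i j e) s Q :=
  ⟨_, 1, .assign t i j e s, Nat.one_le_pow _ _ hL, h⟩

lemma Ends.seq (hL : 3 ≤ L) (h : Ends L k p s fun s₁ => Ends L k q s₁ Q) :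
    Ends L (k + 1) (.seq p q) s Q := by
  obtain ⟨s₁, a, hp, ha, s₂, b, hq, hb, hQ⟩ := h
  refine ⟨s₂, a + b + 1, .seq hp hq, ?_, hQ⟩
  have h1 : 1 ≤ L ^ k := Nat.one_le_pow _ _ (by omega)
  have h2 : L ^ k * 3 ≤ L ^ k * L := Nat.mul_le_mul_left _ hL
  rw [pow_succ]
  omega

lemma Ends.cond (hL : 2 ≤ L) (h1 : e.eval s ≠ 0 → Ends L k p s Q)
    (h2 : e.eval s = 0 → Ends L k q s Q) : Ends L (k + 1) (.cond e p q) s Q := by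
  have hk : L ^ k + 1 ≤ L ^ (k + 1) := by
    have h1 : 1 ≤ L ^ k := Nat.one_le_pow _ _ (by omega)
    have h2 : L ^ k * 2 ≤ L ^ k * L := Nat.mul_le_mul_left _ hL
    rw [pow_succ]
    omega
  by_cases h : e.eval s = 0
  · obtain ⟨s', t, hb, ht, hQ⟩ := h2 h
    exact ⟨s', t + 1, .cond_false h hb, by omega, hQ⟩
  · obtain ⟨s', t, hb, ht, hQ⟩ := h1 h
    exact ⟨s', t + 1, .cond_true h hb, by omega, hQ⟩

/-- Rule for `while` loops with an invariant `I` and a decreasing measure `V`. -/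
lemma Ends.while {I : Memory → Prop} {V : Memory → ℕ} (hL : V s + 9 ≤ L) (hI : I s)
    (hbody : ∀ u, (∀ t ∉ p.mods, u t = s t) → I u → e.eval u ≠ 0 →
      Ends L (k + 1) p u fun u' => I u' ∧ V u' < V u)
    (hQ : ∀ u, (∀ t ∉ p.mods, u t = s t) → I u → e.eval u = 0 → Q u) :
    Ends L (k + 2) (.loop e p) s Q := by
  have key : ∀ N u, V u ≤ N → (∀ t ∉ p.mods, u t = s t) → I u →
      ∃ s' t, Big (.loop e p) u s' t ∧ t ≤ N * (L ^ (k + 1) + 1) + 1 ∧ Q s' := by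
    intro N
    induction N with
    | zero =>
      intro u hV hu hIu
      by_cases he : e.eval u = 0
      · exact ⟨u, 1, .loop_done he, by omega, hQ u hu hIu he⟩
      · obtain ⟨s', t, -, -, -, h⟩ := hbody u hu hIu he
        omega
    | succ N ih =>
      intro u hV hu hIu
      by_cases he : e.eval u = 0
      · exact ⟨u, 1, .loop_done he, by omega, hQ u hu hIu he⟩
      · obtain ⟨u₁, t, hb, ht, hI₁, hV₁⟩ := hbody u hu hIu he
        obtain ⟨s', t', hb', ht', hQ'⟩ := ih u₁ (by omega)
          (fun r hr => (hb.eq_of_notMem_mods hr).trans (hu r hr)) hI₁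
        refine ⟨s', t + t' + 1, .loop_step he hb hb', ?_, hQ'⟩
        rw [Nat.succ_mul]
        omega
  obtain ⟨s', t, hb, ht, hQ'⟩ := key (V s) s le_rfl (fun _ _ => rfl) hI
  refine ⟨s', t, hb, ht.trans ?_, hQ'⟩
  have h1 : L ≤ L ^ (k + 1) := Nat.le_self_pow (by omega) L
  have h2 : L ^ (k + 1) * (V s + 9) ≤ L ^ (k + 1) * L := Nat.mul_le_mul_left _ hL
  rw [pow_succ L (k + 1)]
  nlinarith

end Rules

/-- `for` loop: the counter in the entry `(0, 0)` of the table `c` runs from `0` to the value of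
`b` (exclusive). -/
def forLoop (c : ℕ) (b : Expr) (p : Program) : Program :=
  .seq (.assign c (.const 0) (.const 0) (.const 0))
    (.loop (.sub b (.get c (.const 0) (.const 0)))
      (.seq p (.assign c (.const 0) (.const 0) (.add (.get c (.const 0) (.const 0)) (.const 1)))))

/-- Rule for `for` loops with the invariant `I i` before the round `i`. -/
lemma Ends.for {L k c N : ℕ} {b : Expr} {p : Program} {s : Memory} {Q : Memory → Prop}
    (I : ℕ → Memory → Prop) (hL : N + 9 ≤ L) (hc : c ∉ p.mods)
    (hI : ∀ i u j, I i u → I i (u.write c 0 0 j))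
    (hb : ∀ i u, (∀ t ∉ (forLoop c b p).mods, u t = s t) → I i u → b.eval u = N)
    (h0 : I 0 s)
    (hbody : ∀ i u, (∀ t ∉ (forLoop c b p).mods, u t = s t) → i < N → u c 0 0 = i → I i u →
      Ends L (k + 1) p u (I (i + 1)))
    (hQ : ∀ u, (∀ t ∉ (forLoop c b p).mods, u t = s t) → I N u → Q u) :
    Ends L (k + 4) (forLoop c b p) s Q := by
  have hmods : ∀ t, t ∉ (forLoop c b p).mods ↔ t ≠ c ∧ t ∉ p.mods := by
    intro t
    simp only [forLoop, Program.mods, List.mem_append, List.mem_singleton]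
    tauto
  refine Ends.seq (by omega) (Ends.assign (by omega) ?_)
  refine Ends.while (I := fun u => (∀ t ∉ (forLoop c b p).mods, u t = s t) ∧
    u c 0 0 ≤ N ∧ I (u c 0 0) u) (V := fun u => N - u c 0 0) (by omega) ?_ ?_ ?_
  · refine ⟨fun t ht => Memory.write_ne ((hmods t).1 ht).1, ?_⟩
    simp only [Expr.eval, Memory.write_self]
    exact ⟨Nat.zero_le _, hI 0 s 0 h0⟩
  · rintro u - ⟨hu, hle, hIu⟩ he
    simp only [Expr.eval, hb _ u hu hIu] at he
    have hlt : u c 0 0 < N := by omega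
    refine Ends.seq (by omega) ((hbody _ u hu hlt rfl hIu).keep.mono ?_)
    rintro u₁ ⟨hI₁, hk⟩
    refine Ends.assign (by omega) ?_
    simp only [Expr.eval, Memory.write_self, hk c hc]
    refine ⟨⟨fun t ht => ?_, hlt, hI _ _ _ hI₁⟩, by omega⟩
    rw [Memory.write_ne ((hmods t).1 ht).1, hk t ((hmods t).1 ht).2, hu t ht]
  · rintro u - ⟨hu, hle, hIu⟩ he
    simp only [Expr.eval, hb _ u hu hIu] at he
    have : u c 0 0 = N := by omega
    exact hQ u hu (this ▸ hIu)

/-! ### Labels for the search for an augmenting path -/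

section Labels

variable {n m : ℕ}

/-- The state of a search from the unallocated items. The nodes are `0`, which owns the
unallocated items, and `r + 1` for the agent in place `r`; `own a` is the node that owns
the item `a`. The labels of the nodes reached are positive and increase in the order of discovery,
`cnt` is the number of nodes reached, and a node `r + 1` that has been reached wants the item
`itm (r + 1)`, whose owner was reached before. -/
structure Labelled (R : Fin n → Finset (Fin m)) (own lab itm : ℕ → ℕ) (cnt : ℕ) : Prop where
  zero_ne : lab 0 ≠ 0
  cnt_eq : cnt = #((range (n + 1)).filter fun j => lab j ≠ 0)
  le_cnt : ∀ j ≤ n, lab j ≤ cnt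
  wit : ∀ r : Fin n, lab (r + 1) ≠ 0 →
    ∃ a : Fin m, itm (r + 1) = a ∧ a ∈ R r ∧ lab (own a) ≠ 0 ∧ lab (own a) < lab (r + 1)

lemma Labelled.cnt_le {R : Fin n → Finset (Fin m)} {own lab itm : ℕ → ℕ} {cnt : ℕ}
    (h : Labelled R own lab itm cnt) : cnt ≤ n + 1 := by
  rw [h.cnt_eq]
  exact (card_filter_le _ _).trans (by simp)

lemma Labelled.label {R : Fin n → Finset (Fin m)} {own lab itm : ℕ → ℕ} {cnt : ℕ}
    (h : Labelled R own lab itm cnt) (hown : ∀ a : Fin m, own a ≤ n) {r : Fin n} {a : Fin m}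
    (ha : a ∈ R r) (hr : lab (r + 1) = 0) (hl : lab (own a) ≠ 0) :
    Labelled R own (Function.update lab (r + 1) (cnt + 1)) (Function.update itm (r + 1) a)
      (cnt + 1) := by
  have hne : ∀ j, lab j ≠ 0 → j ≠ r + 1 := fun j hj e => hj (e ▸ hr)
  have hmono : ∀ j, lab j ≠ 0 → Function.update lab (r + 1) (cnt + 1) j = lab j :=
    fun j hj => Function.update_of_ne (hne j hj) _ _
  refine ⟨by rw [hmono 0 h.zero_ne]; exact h.zero_ne, ?_, fun j hj => ?_, fun r' hr' => ?_⟩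
  · have : ((range (n + 1)).filter fun j => Function.update lab (r + 1) (cnt + 1) j ≠ 0) =
        insert ((r : ℕ) + 1) ((range (n + 1)).filter fun j => lab j ≠ 0) := by
      ext j
      have := r.2
      by_cases hj : j = r + 1
      · subst hj
        simp
      · simp [hj]
    rw [this, card_insert_of_notMem (by simp [hr]), ← h.cnt_eq]
  · by_cases e : j = r + 1
    · subst e
      simp
    · rw [Function.update_of_ne e]
      exact (h.le_cnt j hj).trans (Nat.le_succ _)
  · by_cases e : r' = r
    · subst e
      refine ⟨a, by simp, ha, ?_, ?_⟩
      · rwa [hmono _ hl]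
      · rw [hmono _ hl, Function.update_self]
        exact Nat.lt_succ_of_le (h.le_cnt _ (hown a))
    · have e' : (r' : ℕ) + 1 ≠ r + 1 := fun h => e (Fin.ext (by omega))
      rw [Function.update_of_ne e'] at hr' ⊢
      obtain ⟨b, h1, h2, h3, h4⟩ := h.wit r' hr'
      exact ⟨b, h1, h2, by rwa [hmono _ h3], by rwa [hmono _ h3, Function.update_of_ne e']⟩

lemma labelled_init (R : Fin n → Finset (Fin m)) (own lab itm : ℕ → ℕ)
    (h : ∀ j ≤ n, lab j = if j = 0 then 1 else 0) : Labelled R own lab itm 1 := by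
  refine ⟨by simp [h 0], ?_, fun j hj => ?_, fun r hr => ?_⟩
  · have : ((range (n + 1)).filter fun j => lab j ≠ 0) = {0} := by
      ext j
      simp only [mem_filter, mem_range, mem_singleton]
      constructor
      · rintro ⟨h1, h2⟩
        rw [h j (by omega)] at h2
        by_contra hj
        simp [hj] at h2
      · rintro rfl
        simp [h 0]
    rw [this, card_singleton]
  · rw [h j hj]
    split_ifs <;> omega
  · rw [h _ (by omega)] at hr
    simp at hr

/-- The bundles described by the owners of the items. -/
def bundles (n m : ℕ) (own : ℕ → ℕ) : Fin n → Finset (Fin m) :=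
  fun r => univ.filter fun a => own a = r + 1

lemma mem_bundles {own : ℕ → ℕ} {r : Fin n} {a : Fin m} :
    a ∈ bundles n m own r ↔ own a = r + 1 := by simp [bundles]

lemma bundles_isAllocation (own : ℕ → ℕ) : IsAllocation (bundles n m own) := by
  intro v w hvw
  rw [disjoint_left]
  intro a hv hw
  rw [mem_bundles] at hv hw
  exact hvw (Fin.ext (by omega))

/-- One round of an augmentation: the node `cur` takes the item `a` from another node. -/
lemma card_bundles_update {own : ℕ → ℕ} {a : Fin m} {cur : ℕ} (h : own a ≠ cur) (r : Fin n) :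
    #(bundles n m (Function.update own a cur) r) + (if own a = r + 1 then 1 else 0) =
      #(bundles n m own r) + if cur = r + 1 then 1 else 0 := by
  have hup : ∀ b : Fin m, b ≠ a → Function.update own a cur b = own b := fun b hb =>
    Function.update_of_ne (fun e => hb (Fin.ext e)) _ _
  by_cases h1 : cur = r + 1
  · rw [if_pos h1, if_neg (fun e => h (e.trans h1.symm))]
    have : bundles n m (Function.update own a cur) r = insert a (bundles n m own r) := by
      ext b
      rw [mem_insert, mem_bundles, mem_bundles]
      by_cases hb : b = a
      · subst hb
        simp [h1]
      · simp [hup b hb, hb]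
    rw [this, card_insert_of_notMem]
    rw [mem_bundles]
    exact fun e => h (e.trans h1.symm)
  · rw [if_neg h1]
    by_cases h2 : own a = r + 1
    · rw [if_pos h2]
      have : bundles n m (Function.update own a cur) r = (bundles n m own r).erase a := by
        ext b
        rw [mem_erase, mem_bundles, mem_bundles]
        by_cases hb : b = a
        · subst hb
          simp [h1]
        · simp [hup b hb, hb]
      rw [this, card_erase_add_one (mem_bundles.2 h2), add_zero]
    · rw [if_neg h2]
      have : bundles n m (Function.update own a cur) r = bundles n m own r := by
        ext b
        rw [mem_bundles, mem_bundles]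
        by_cases hb : b = a
        · subst hb
          simp [h1, h2]
        · rw [hup b hb]
      rw [this]

/-- The state of the walk back to the unallocated items: `cur` still has to take its item, and the
nodes with smaller labels can still do so. -/
structure Walking (R : Fin n → Finset (Fin m)) (own lab itm : ℕ → ℕ) (cur : ℕ) : Prop where
  own_le : ∀ a : Fin m, own a ≤ n
  own_mem : ∀ (a : Fin m) (r : Fin n), own a = r + 1 → a ∈ R r
  cur_le : cur ≤ n
  cur_ne : lab cur ≠ 0
  wit : ∀ r : Fin n, lab (r + 1) ≠ 0 → lab (r + 1) ≤ lab cur →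
    ∃ a : Fin m, itm (r + 1) = a ∧ a ∈ R r ∧ lab (own a) ≠ 0 ∧ lab (own a) < lab (r + 1)

lemma Walking.step {R : Fin n → Finset (Fin m)} {own lab itm : ℕ → ℕ} {cur : ℕ}
    (h : Walking R own lab itm cur) (hcur : cur ≠ 0) :
    ∃ a : Fin m, itm cur = a ∧ own a ≠ cur ∧ lab (own a) < lab cur ∧
      Walking R (Function.update own a cur) lab itm (own a) := by
  have hle := h.cur_le
  obtain ⟨r, hr⟩ : ∃ r : Fin n, cur = r + 1 := ⟨⟨cur - 1, by omega⟩, by simp; omega⟩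
  obtain ⟨a, h1, h2, h3, h4⟩ := h.wit r (hr ▸ h.cur_ne) (hr ▸ le_rfl)
  rw [← hr] at h1 h4
  refine ⟨a, h1, fun e => ?_, h4, fun b => ?_, fun b r' hb => ?_, h.own_le a, h3, ?_⟩
  · rw [e] at h4
    exact lt_irrefl _ h4
  · by_cases hb : b = a
    · subst hb
      simpa using hle
    · rw [Function.update_of_ne fun e => hb (Fin.ext e)]
      exact h.own_le b
  · by_cases hba : b = a
    · subst hba
      rw [Function.update_self, hr] at hb
      have : r = r' := Fin.ext (by omega)
      exact this ▸ h2
    · rw [Function.update_of_ne fun e => hba (Fin.ext e)] at hb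
      exact h.own_mem b r' hb
  · intro r' hr' hle'
    obtain ⟨b, g1, g2, g3, g4⟩ := h.wit r' hr' (hle'.trans h4.le)
    have hba : b ≠ a := by
      rintro rfl
      omega
    have : Function.update own a cur b = own b :=
      Function.update_of_ne (fun e => hba (Fin.ext e)) _ _
    exact ⟨b, g1, g2, by rwa [this], by rwa [this]⟩

/-! ### Greedy construction of egalitarian allocations -/

/-- The agent `j` can get no further item, and no member of a tight set that contains her is
better off than she would be with one more item. -/
def Certified (R A : Fin n → Finset (Fin m)) (j : Fin n) : Prop :=
  ∃ C : Finset (Fin n), j ∈ C ∧ IsTight R A C ∧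
    ∀ l ∈ C, n * #(A l) + l ≤ n * #(A j) + n + j

/-- The agents get items one at a time, in rounds and by priority. After `d` complete rounds,
and with the agents before place `i` treated in the next one, each agent has received an
item in each of her turns, or is certified. -/
structure Greedy (R A : Fin n → Finset (Fin m)) (d i : ℕ) : Prop where
  sub : ∀ r, A r ⊆ R r
  disj : IsAllocation A
  le : ∀ j : Fin n, #(A j) ≤ d + if (j : ℕ) < i then 1 else 0
  cert : ∀ j : Fin n, #(A j) = d + (if (j : ℕ) < i then 1 else 0) ∨ Certified R A j

/-- If the agent `i` cannot get a further item, then she is certified. -/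
lemma Greedy.fail {R A : Fin n → Finset (Fin m)} {d : ℕ} {i : Fin n} (h : Greedy R A d i)
    (hC : ∃ C : Finset (Fin n), i ∈ C ∧ IsTight R A C) : Greedy R A d (i + 1) := by
  have hle : ∀ j : Fin n, d + (if (j : ℕ) < i then 1 else 0) ≤
      d + if (j : ℕ) < i + 1 then 1 else 0 := fun j => by split_ifs <;> omega
  refine ⟨h.sub, h.disj, fun j => (h.le j).trans (hle j), fun j => ?_⟩
  rcases h.cert j with hj | hj
  · rcases eq_or_ne j i with rfl | hne
    · right
      obtain ⟨C, hiC, hC⟩ := hC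
      refine ⟨C, hiC, hC, fun l _ => ?_⟩
      have hl := h.le l
      simp only [lt_irrefl, if_false, add_zero] at hj
      rw [hj]
      have := l.2
      split_ifs at hl with h1
      · have : n * #(A l) ≤ n * (d + 1) := Nat.mul_le_mul_left _ hl
        rw [mul_add] at this
        omega
      · have : n * #(A l) ≤ n * d := Nat.mul_le_mul_left _ hl
        omega
    · left
      rw [hj]
      have : (j : ℕ) ≠ i := fun e => hne (Fin.ext e)
      congr 1
      split_ifs <;> omega
  · exact .inr hj

/-- If the agent `i` gets a further item and nobody else loses one, then the tight sets
remain tight, and none of them contains `i`. -/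
lemma Greedy.augment {R A A' : Fin n → Finset (Fin m)} {d : ℕ} {i : Fin n} (h : Greedy R A d i)
    (hsub : ∀ r, A' r ⊆ R r) (hd : IsAllocation A')
    (hcard : ∀ r, #(A' r) = #(A r) + if r = i then 1 else 0) : Greedy R A' d (i + 1) := by
  have hnot : ∀ C, IsTight R A C → i ∉ C := by
    intro C hC hi
    have h1 := (isTight_iff_card h.sub h.disj C).1 hC
    have h2 : ∑ j ∈ C, #(A' j) ≤ #(C.biUnion R) := by
      rw [← card_biUnion_eq_sum hd]
      exact card_le_card (biUnion_mono fun r _ => hsub r)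
    have h3 : ∑ j ∈ C, #(A j) < ∑ j ∈ C, #(A' j) :=
      sum_lt_sum (fun j _ => by rw [hcard]; omega) ⟨i, hi, by rw [hcard, if_pos rfl]; omega⟩
    omega
  have hi : #(A i) = d := by
    rcases h.cert i with h1 | ⟨C, hC, hCt, -⟩
    · simpa using h1
    · exact absurd hC (hnot C hCt)
  have hlt : ∀ j : Fin n, j ≠ i → ((j : ℕ) < i + 1 ↔ (j : ℕ) < i) := fun j hj => by
    have : (j : ℕ) ≠ i := fun e => hj (Fin.ext e)
    omega
  refine ⟨hsub, hd, fun j => ?_, fun j => ?_⟩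
  · rw [hcard]
    by_cases hj : j = i
    · subst hj
      simp [hi]
    · simpa [hj, hlt j hj] using h.le j
  · by_cases hj : j = i
    · subst hj
      left
      simp [hcard, hi]
    · rcases h.cert j with h1 | ⟨C, hC, hCt, hk⟩
      · left
        simpa [hcard, hj, hlt j hj] using h1
      · right
        have hCi := hnot C hCt
        have hsame : ∀ l ∈ C, #(A l) = #(A' l) := fun l hl => by
          have : l ≠ i := fun e => hCi (e ▸ hl)
          simp [hcard, this]
        refine ⟨C, hC, hCt.congr_card h.sub h.disj hsub hd hsame, fun l hl => ?_⟩
        rw [← hsame l hl, ← hsame j hC]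
        exact hk l hl

lemma Greedy.next_round {R A : Fin n → Finset (Fin m)} {d : ℕ} (h : Greedy R A d n) :
    Greedy R A (d + 1) 0 := by
  refine ⟨h.sub, h.disj, fun j => ?_, fun j => ?_⟩
  · simpa using h.le j
  · simpa using h.cert j

lemma greedy_empty (R : Fin n → Finset (Fin m)) {A : Fin n → Finset (Fin m)}
    (h : ∀ r, A r = ∅) : Greedy R A 0 0 := by
  refine ⟨fun r => by simp [h], fun v w _ => by simp [h], fun j => by simp [h], fun j => ?_⟩
  left
  simp [h]

/-- After `m` rounds, an agent who is not certified holds all items. -/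
lemma Greedy.isEgalitarian {R A : Fin n → Finset (Fin m)} (h : Greedy R A m 0) :
    IsEgalitarian R A := by
  refine ⟨h.sub, h.disj, fun j => ?_⟩
  rcases h.cert j with h1 | h1
  · have huniv : A j = univ := by
      rw [← card_eq_iff_eq_univ, h1]
      simp
    refine ⟨{j}, by simp, fun l hl => ?_, fun l hl => ?_⟩
    · simp [huniv]
    · rw [mem_singleton] at hl
      subst hl
      omega
  · exact h1

/-- When the search is complete, the agents that it has not reached form a tight set. -/
lemma isTight_of_closed {R : Fin n → Finset (Fin m)} {own lab : ℕ → ℕ}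
    (hown : ∀ a : Fin m, own a ≤ n) (h0 : lab 0 ≠ 0)
    (hcl : ∀ (r : Fin n) (a : Fin m), a ∈ R r → lab (own a) ≠ 0 → lab (r + 1) ≠ 0) :
    IsTight R (bundles n m own) (univ.filter fun r => lab (r + 1) = 0) := by
  intro r hr a ha
  have hr0 : lab (r + 1) = 0 := by simpa using hr
  have ha0 : lab (own a) = 0 := by
    by_contra h
    exact hcl r a ha h hr0
  have hne : own a ≠ 0 := fun e => h0 (e ▸ ha0)
  have hle := hown a
  refine mem_biUnion.2 ⟨⟨own a - 1, by omega⟩, ?_, ?_⟩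
  · simp only [mem_filter, mem_univ, true_and]
    rwa [Nat.sub_add_cancel (by omega)]
  · rw [mem_bundles]
    simp
    omega

end Labels

/-! ### A program for the PE mechanism -/

/-- The entry `(0, 0)` of a table, used as a variable. -/
def Expr.var (t : ℕ) : Expr := .get t (.const 0) (.const 0)

/-- A program that only writes to the table `9`, which is never read. -/
def skipProg : Program := .assign 9 (.const 0) (.const 0) (.const 0)

/-- Labels the agent in place `var 19` if she wants the item `var 18` and the owner of that
item has been labelled. Table `10` holds the reports, `11` the owners of the items, `12` the
labels, `13` the items by which the nodes have been reached; `var 15` is the number of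
labelled nodes, and `var 14` tells whether something has changed. -/
def relaxProg : Program :=
  .cond (.get 10 (.var 19) (.var 18))
    (.cond (.get 12 (.add (.var 19) (.const 1)) (.const 0)) skipProg
      (.cond (.get 12 (.get 11 (.var 18) (.const 0)) (.const 0))
        (.seq (.assign 15 (.const 0) (.const 0) (.add (.var 15) (.const 1)))
        (.seq (.assign 12 (.add (.var 19) (.const 1)) (.const 0) (.var 15))
        (.seq (.assign 13 (.add (.var 19) (.const 1)) (.const 0) (.var 18))
          (.assign 14 (.const 0) (.const 0) (.const 1)))))
        skipProg))
    skipProg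

/-- One pass over all items and agents. -/
def roundProg : Program :=
  .seq (.assign 14 (.const 0) (.const 0) (.const 0))
    (forLoop 18 (.var 1) (forLoop 19 (.var 0) relaxProg))

/-- Labels the nodes from which the unallocated items can be reached. -/
def searchProg : Program :=
  .seq (forLoop 23 (.add (.var 0) (.const 1)) (.assign 12 (.var 23) (.const 0) (.const 0)))
  (.seq (.assign 12 (.const 0) (.const 0) (.const 1))
  (.seq (.assign 15 (.const 0) (.const 0) (.const 1))
  (.seq (.assign 14 (.const 0) (.const 0) (.const 1))
    (.loop (.var 14) roundProg))))

/-- The node `var 20` takes its item, and the former owner of that item becomes `var 20`. -/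
def walkStepProg : Program :=
  .seq (.assign 22 (.const 0) (.const 0) (.get 13 (.var 20) (.const 0)))
  (.seq (.assign 21 (.const 0) (.const 0) (.get 11 (.var 22) (.const 0)))
  (.seq (.assign 11 (.var 22) (.const 0) (.var 20))
    (.assign 20 (.const 0) (.const 0) (.var 21))))

/-- Tries to give a further item to the agent in place `var 17`. -/
def attemptProg : Program :=
  .seq searchProg
    (.cond (.get 12 (.add (.var 17) (.const 1)) (.const 0))
      (.seq (.assign 20 (.const 0) (.const 0) (.add (.var 17) (.const 1)))
        (.loop (.var 20) walkStepProg))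
      skipProg)

/-- The greedy construction of an egalitarian allocation, with the owners in table `11`. -/
def peProg : Program := forLoop 16 (.var 1) (forLoop 17 (.var 0) attemptProg)

/-- The first column of a table. -/
def col (s : Memory) (t : ℕ) : ℕ → ℕ := fun j => s t j 0

lemma col_congr {s u : Memory} {t : ℕ} (h : u t = s t) : col u t = col s t := by
  unfold col
  rw [h]

lemma col_write (s : Memory) (t i k : ℕ) :
    col (s.write t i 0 k) t = Function.update (col s t) i k := by
  funext j
  simp [col, Memory.write_same, Function.update_apply]

lemma col_write_ne {s : Memory} {t t' i j k : ℕ} (h : t' ≠ t) :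
    col (s.write t i j k) t' = col s t' := col_congr (Memory.write_ne h)

section PEProgram

variable {n m : ℕ} {R : Fin n → Finset (Fin m)} {L : ℕ}

/-- The memory holds the problem, and every owned item is wanted by its owner. -/
structure PEState (R : Fin n → Finset (Fin m)) (s : Memory) : Prop where
  agents : s 0 0 0 = n
  items : s 1 0 0 = m
  reports : ∀ (r : Fin n) (a : Fin m), s 10 r a ≠ 0 ↔ a ∈ R r
  own_le : ∀ a : Fin m, col s 11 a ≤ n
  own_mem : ∀ (a : Fin m) (r : Fin n), col s 11 a = r + 1 → a ∈ R r

lemma PEState.congr {s u : Memory} (h : PEState R s) (h0 : u 0 = s 0) (h1 : u 1 = s 1)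
    (h10 : u 10 = s 10) (h11 : u 11 = s 11) : PEState R u := by
  refine ⟨by rw [h0]; exact h.agents, by rw [h1]; exact h.items, ?_, ?_, ?_⟩
  · rw [h10]
    exact h.reports
  · rw [col_congr h11]
    exact h.own_le
  · rw [col_congr h11]
    exact h.own_mem

/-- The invariant of a pass: the pairs before `(ia, ir)` have been treated, and `c₀` is the number
of labelled nodes at the beginning of the pass. -/
structure RoundInv (R : Fin n → Finset (Fin m)) (s : Memory) (c₀ ia ir : ℕ) (u : Memory) :
    Prop where
  lab : Labelled R (col s 11) (col u 12) (col u 13) (u 15 0 0)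
  mono : c₀ ≤ u 15 0 0
  changed : u 14 0 0 ≠ 0 → c₀ + 1 ≤ u 15 0 0
  unchanged : u 14 0 0 = 0 → ∀ (r : Fin n) (a : Fin m),
    ((a : ℕ) < ia ∨ (a : ℕ) = ia ∧ (r : ℕ) < ir) →
    a ∈ R r → col u 12 (col s 11 a) ≠ 0 → col u 12 (r + 1) ≠ 0

lemma RoundInv.congr {s u u' : Memory} {c₀ ia ir : ℕ} (h : RoundInv R s c₀ ia ir u)
    (h12 : u' 12 = u 12) (h13 : u' 13 = u 13) (h14 : u' 14 = u 14) (h15 : u' 15 = u 15) :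
    RoundInv R s c₀ ia ir u' := by
  refine ⟨?_, ?_, ?_, ?_⟩
  · rw [col_congr h12, col_congr h13, h15]
    exact h.lab
  · rw [h15]
    exact h.mono
  · rw [h14, h15]
    exact h.changed
  · rw [h14, col_congr h12]
    exact h.unchanged

lemma relaxProg_ends (hL : 3 ≤ L) {s u : Memory} (hs : PEState R s) {c₀ : ℕ} {r : Fin n}
    {a : Fin m} (h10 : u 10 = s 10) (h11 : u 11 = s 11) (hr : u 19 0 0 = r) (ha : u 18 0 0 = a)
    (h : RoundInv R s c₀ a r u) : Ends L 7 relaxProg u (RoundInv R s c₀ a (r + 1)) := by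
  have hskip : ∀ k, (a ∈ R r → col u 12 (col s 11 a) ≠ 0 → col u 12 (r + 1) ≠ 0) →
      Ends L k skipProg u (RoundInv R s c₀ a (r + 1)) := by
    intro k hok
    refine Ends.assign (by omega) (RoundInv.congr (u := u) ?_ (Memory.write_ne (by simp))
      (Memory.write_ne (by simp)) (Memory.write_ne (by simp)) (Memory.write_ne (by simp)))
    refine ⟨h.lab, h.mono, h.changed, fun hf r' a' hlt ha' => ?_⟩
    by_cases e : r' = r ∧ a' = a
    · obtain ⟨rfl, rfl⟩ := e
      exact hok ha'
    · refine h.unchanged hf r' a' ?_ ha'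
      rcases hlt with h1 | ⟨h1, h2⟩
      · exact .inl h1
      · refine .inr ⟨h1, lt_of_le_of_ne (by omega) fun h3 => e ⟨Fin.ext h3, Fin.ext h1⟩⟩
  refine Ends.cond (by omega) (fun h1 => Ends.cond (by omega) (fun h2 => ?_) fun h2 =>
    Ends.cond (by omega) (fun h3 => ?_) fun h3 => ?_) fun h1 => ?_
  · simp only [Expr.eval, Expr.var, hr] at h2
    exact hskip _ fun _ _ => h2
  · simp only [Expr.eval, Expr.var, hr, ha, h10, h11] at h1 h2 h3
    have haR := (hs.reports r a).1 h1
    have hnew := h.lab.label hs.own_le haR h2 h3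
    refine Ends.seq hL (Ends.assign (by omega) (Ends.seq hL (Ends.assign (by omega)
      (Ends.seq hL (Ends.assign (by omega) (Ends.assign (by omega) ?_))))))
    simp only [Expr.eval, Expr.var]
    have hm := h.mono
    constructor
    · simpa [Memory.write_ne, Memory.write_self, col_write, col_write_ne, hr, ha] using hnew
    · simp only [Memory.write_ne, Memory.write_self, ne_eq, Nat.reduceEqDiff,
        not_false_eq_true]
      omega
    · simp only [Memory.write_ne, Memory.write_self, ne_eq, Nat.reduceEqDiff,
        not_false_eq_true]
      omega
    · simp [Memory.write_self]
  · simp only [Expr.eval, Expr.var, ha, h11] at h3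
    exact hskip _ fun _ h' => absurd h3 h'
  · simp only [Expr.eval, Expr.var, hr, ha, h10] at h1
    exact hskip _ fun h' => absurd h1 ((hs.reports r a).2 h')

lemma roundProg_ends (hL : n + m + 10 ≤ L) {s u : Memory} (hs : PEState R s)
    (h0 : u 0 = s 0) (h1 : u 1 = s 1) (h10 : u 10 = s 10) (h11 : u 11 = s 11)
    (h : Labelled R (col s 11) (col u 12) (col u 13) (u 15 0 0)) :
    Ends L 14 roundProg u (RoundInv R s (u 15 0 0) m 0) := by
  refine Ends.seq (by omega) (Ends.assign (by omega) ?_)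
  set w := u.write 14 ((Expr.const 0).eval u) ((Expr.const 0).eval u) ((Expr.const 0).eval u)
    with hw
  have hwne : ∀ t, t ≠ 14 → w t = u t := fun t ht => Memory.write_ne ht
  have hstart : RoundInv R s (u 15 0 0) 0 0 w := by
    refine ⟨?_, ?_, ?_, ?_⟩
    · rw [col_congr (hwne 12 (by simp)), col_congr (hwne 13 (by simp)), hwne 15 (by simp)]
      exact h
    · rw [hwne 15 (by simp)]
    · intro hf
      simp [hw, Expr.eval, Memory.write_self] at hf
    · rintro - r a (hlt | ⟨-, hlt⟩) <;> omega
  refine Ends.for (fun ia => RoundInv R s (u 15 0 0) ia 0) (N := m) (by omega) (by decide)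
    (fun i v j hv => hv.congr (Memory.write_ne (by simp)) (Memory.write_ne (by simp))
      (Memory.write_ne (by simp)) (Memory.write_ne (by simp))) ?_ hstart ?_ ?_
  · intro i v hv _
    simp only [Expr.eval, Expr.var]
    rw [hv 1 (by decide), hwne 1 (by simp), h1, hs.items]
  · intro ia v hv hia hcv hIv
    refine Ends.for (fun ir => RoundInv R s (u 15 0 0) ia ir) (N := n) (by omega) (by decide)
      (fun i v j hv => hv.congr (Memory.write_ne (by simp)) (Memory.write_ne (by simp))
        (Memory.write_ne (by simp)) (Memory.write_ne (by simp))) ?_ hIv ?_ ?_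
    · intro i v' hv' _
      simp only [Expr.eval, Expr.var]
      rw [hv' 0 (by decide), hv 0 (by decide), hwne 0 (by simp), h0, hs.agents]
    · intro ir v' hv' hir hcv' hIv'
      refine relaxProg_ends (r := ⟨ir, hir⟩) (a := ⟨ia, hia⟩) (by omega) hs ?_ ?_ hcv' ?_ hIv'
      · rw [hv' 10 (by decide), hv 10 (by decide), hwne 10 (by simp), h10]
      · rw [hv' 11 (by decide), hv 11 (by decide), hwne 11 (by simp), h11]
      · rw [hv' 18 (by decide), hcv]
    · intro v' _ hIv'
      refine ⟨hIv'.lab, hIv'.mono, hIv'.changed, fun hf r a hlt => hIv'.unchanged hf r a ?_⟩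
      rcases hlt with hlt | ⟨-, hlt⟩
      · rcases Nat.lt_succ_iff_lt_or_eq.1 hlt with h | h
        · exact .inl h
        · exact .inr ⟨h, r.2⟩
      · omega
  · intro v _ hIv
    exact hIv

lemma searchProg_ends (hL : n + m + 10 ≤ L) {s : Memory} (hs : PEState R s) :
    Ends L 19 searchProg s fun u =>
      Labelled R (col s 11) (col u 12) (col u 13) (u 15 0 0) ∧
      ∀ (r : Fin n) (a : Fin m), a ∈ R r → col u 12 (col s 11 a) ≠ 0 → col u 12 (r + 1) ≠ 0 := by
  have hL0 : 0 < L := by omega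
  refine Ends.seq (by omega) (Ends.mono_exp (k := 5) hL0 ?_ (by omega))
  refine Ends.for (fun k u => ∀ j < k, col u 12 j = 0) (N := n + 1) (by omega) (by decide)
    ?_ ?_ (by simp) ?_ ?_
  · intro i u j h
    rwa [col_write_ne (by simp)]
  · intro i u hu _
    simp only [Expr.eval, Expr.var]
    rw [hu 0 (by decide), hs.agents]
  · intro i u _ _ hc h
    refine Ends.assign hL0 ?_
    simp only [Expr.eval, Expr.var, hc, col_write]
    intro j hj
    by_cases e : j = i
    · simp [e]
    · rw [Function.update_of_ne e]
      exact h j (by omega)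
  · intro u hu hclear
    have hu' : ∀ t, t ≠ 23 → t ≠ 12 → u t = s t := fun t h1 h2 => hu t (by
      simp [forLoop, Program.mods, h1, h2])
    refine Ends.seq (by omega) (Ends.assign hL0 (Ends.seq (by omega) (Ends.assign hL0
      (Ends.seq (by omega) (Ends.assign hL0 ?_)))))
    simp only [Expr.eval]
    set w := ((u.write 12 0 0 1).write 15 0 0 1).write 14 0 0 1 with hw
    have hwne : ∀ t, t ≠ 12 → t ≠ 14 → t ≠ 15 → t ≠ 23 → w t = s t := fun t h1 h2 h3 h4 => by
      rw [hw, Memory.write_ne h2, Memory.write_ne h3, Memory.write_ne h1, hu' t h4 h1]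
    have h12 : col w 12 = Function.update (col u 12) 0 1 := by
      rw [hw, col_write_ne (by simp), col_write_ne (by simp), col_write]
    have h15 : w 15 0 0 = 1 := by
      rw [hw, Memory.write_ne (by simp), Memory.write_self]
    refine Ends.while (I := fun v => Labelled R (col s 11) (col v 12) (col v 13) (v 15 0 0) ∧
      (v 14 0 0 = 0 → ∀ (r : Fin n) (a : Fin m), a ∈ R r → col v 12 (col s 11 a) ≠ 0 →
        col v 12 (r + 1) ≠ 0))
      (V := fun v => if v 14 0 0 = 0 then 0 else n + 2 - v 15 0 0) ?_ ⟨?_, ?_⟩ ?_ ?_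
    · simp only [h15]
      split_ifs <;> omega
    · rw [h15]
      refine labelled_init R _ _ _ fun j hj => ?_
      rw [h12, Function.update_apply]
      split_ifs
      · rfl
      · exact hclear j (by omega)
    · intro hf
      simp [hw, Memory.write_self] at hf
    · rintro v hv ⟨hlab, -⟩ he
      simp only [Expr.eval, Expr.var] at he
      have hvs : ∀ t ∈ [0, 1, 10, 11], v t = s t := by
        intro t ht
        simp only [List.mem_cons, List.not_mem_nil, or_false] at ht
        rcases ht with rfl | rfl | rfl | rfl
        all_goals
          rw [hv _ (by decide), hwne _ (by simp) (by simp) (by simp) (by simp)]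
      refine (roundProg_ends hL hs (hvs 0 (by simp)) (hvs 1 (by simp)) (hvs 10 (by simp))
        (hvs 11 (by simp)) hlab).mono fun v' hv' => ⟨⟨hv'.lab, fun hf r a => ?_⟩, ?_⟩
      · exact hv'.unchanged hf r a (.inl a.2)
      · have h1 := hv'.lab.cnt_le
        have h2 := hlab.cnt_le
        rw [if_neg he]
        by_cases hf : v' 14 0 0 = 0
        · rw [if_pos hf]
          omega
        · rw [if_neg hf]
          have := hv'.changed hf
          omega
    · rintro v - ⟨hlab, hcl⟩ he
      exact ⟨hlab, hcl he⟩

lemma walk_ends (hL : n + m + 10 ≤ L) {s : Memory}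
    (h : Walking R (col s 11) (col s 12) (col s 13) (s 20 0 0))
    (hbound : col s 12 (s 20 0 0) ≤ n + 1) :
    Ends L 5 (.loop (.var 20) walkStepProg) s fun u =>
      (∀ a : Fin m, col u 11 a ≤ n) ∧
      (∀ (a : Fin m) (r : Fin n), col u 11 a = r + 1 → a ∈ R r) ∧
      ∀ r : Fin n, #(bundles n m (col u 11) r) =
        #(bundles n m (col s 11) r) + if s 20 0 0 = r + 1 then 1 else 0 := by
  have hL0 : 0 < L := by omega
  refine Ends.while (I := fun v => Walking R (col v 11) (col s 12) (col s 13) (v 20 0 0) ∧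
    ∀ r : Fin n, #(bundles n m (col v 11) r) + (if v 20 0 0 = r + 1 then 1 else 0) =
        #(bundles n m (col s 11) r) + if s 20 0 0 = r + 1 then 1 else 0)
    (V := fun v => if v 20 0 0 = 0 then 0 else col s 12 (v 20 0 0)) ?_ ⟨h, fun r => rfl⟩ ?_ ?_
  · split_ifs <;> omega
  · rintro v hv ⟨hw, hc⟩ he
    simp only [Expr.eval, Expr.var] at he
    obtain ⟨a, h1, h2, h3, h4⟩ := hw.step he
    have h13 : v 13 (v 20 0 0) 0 = a := by rw [hv 13 (by decide)]; exact h1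
    refine Ends.seq (by omega) (Ends.assign hL0 (Ends.seq (by omega) (Ends.assign hL0
      (Ends.seq (by omega) (Ends.assign hL0 (Ends.assign hL0 ?_))))))
    simp only [Expr.eval, Expr.var, h13]
    have e11 : v 11 a 0 = col v 11 a := rfl
    have hcard := card_bundles_update (n := n) h2
    simp only [Memory.write_ne, Memory.write_self, col_write, col_write_ne, ne_eq,
      Nat.reduceEqDiff, not_false_eq_true, e11]
    refine ⟨⟨h4, fun r => ?_⟩, ?_⟩
    · rw [← hc r]
      exact hcard r
    · rw [if_neg he]
      split_ifs
      · exact Nat.pos_of_ne_zero hw.cur_ne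
      · exact h3
  · rintro v - ⟨hw, hc⟩ he
    simp only [Expr.eval, Expr.var] at he
    refine ⟨hw.own_le, hw.own_mem, fun r => ?_⟩
    rw [← hc r, he]
    simp

/-- The attempt to give a further item to an agent either succeeds or certifies the agent. -/
lemma attemptProg_ends (hL : n + m + 10 ≤ L) {s : Memory} (hs : PEState R s) {d : ℕ} {i : Fin n}
    (hi : s 17 0 0 = i) (hg : Greedy R (bundles n m (col s 11)) d i) :
    Ends L 20 attemptProg s fun u => PEState R u ∧ Greedy R (bundles n m (col u 11)) d (i + 1) := by
  have hL0 : 0 < L := by omega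
  refine Ends.seq (by omega) ((searchProg_ends hL hs).keep.mono ?_)
  rintro u ⟨⟨hlab, hcl⟩, hu⟩
  have hu0 := hu 0 (by decide)
  have hu1 := hu 1 (by decide)
  have hu10 := hu 10 (by decide)
  have hu11 := hu 11 (by decide)
  have hu17 := hu 17 (by decide)
  have hsu : PEState R u := hs.congr hu0 hu1 hu10 hu11
  refine Ends.mono_exp (k := 7) hL0 (Ends.cond (by omega) (fun he => ?_) fun he => ?_) (by omega)
  · simp only [Expr.eval, Expr.var, hu17, hi] at he
    refine Ends.seq (by omega) (Ends.assign hL0 ?_)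
    simp only [Expr.eval, Expr.var, hu17, hi]
    set w := u.write 20 0 0 (i + 1) with hw
    have hwne : ∀ t, t ≠ 20 → w t = u t := fun t ht => Memory.write_ne ht
    have hw20 : w 20 0 0 = i + 1 := Memory.write_self _ _ _ _ _
    have hw11 : col w 11 = col s 11 := col_congr ((hwne 11 (by simp)).trans hu11)
    have hw12 : col w 12 = col u 12 := col_congr (hwne 12 (by simp))
    have hw13 : col w 13 = col u 13 := col_congr (hwne 13 (by simp))
    have hwalk : Walking R (col w 11) (col w 12) (col w 13) (w 20 0 0) := by
      rw [hw11, hw12, hw13, hw20]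
      exact ⟨hs.own_le, hs.own_mem, i.2, he, fun r hr _ => hlab.wit r hr⟩
    have hbound : col w 12 (w 20 0 0) ≤ n + 1 := by
      rw [hw12, hw20]
      exact (hlab.le_cnt _ i.2).trans hlab.cnt_le
    refine (walk_ends hL hwalk hbound).keep.mono ?_
    rintro v ⟨⟨h1, h2, h3⟩, hv⟩
    refine ⟨⟨?_, ?_, ?_, h1, h2⟩, ?_⟩
    · rw [hv 0 (by decide), hwne 0 (by simp)]
      exact hsu.agents
    · rw [hv 1 (by decide), hwne 1 (by simp)]
      exact hsu.items
    · rw [hv 10 (by decide), hwne 10 (by simp)]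
      exact hsu.reports
    · refine hg.augment (fun r a ha => h2 a r (mem_bundles.1 ha)) (bundles_isAllocation _) ?_
      intro r
      rw [h3 r, hw11, hw20]
      congr 1
      refine if_congr ?_ rfl rfl
      rw [Fin.ext_iff]
      omega
  · simp only [Expr.eval, Expr.var, hu17, hi] at he
    refine Ends.assign hL0 ⟨hsu.congr (Memory.write_ne (by simp)) (Memory.write_ne (by simp))
      (Memory.write_ne (by simp)) (Memory.write_ne (by simp)), ?_⟩
    rw [col_write_ne (by simp), col_congr hu11]
    refine hg.fail ⟨_, ?_, isTight_of_closed hs.own_le hlab.zero_ne hcl⟩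
    simp only [mem_filter, mem_univ, true_and]
    exact he

theorem peProg_ends (hL : n + m + 10 ≤ L) {s : Memory} (hs : PEState R s)
    (hempty : ∀ a : Fin m, col s 11 a = 0) :
    Ends L 26 peProg s fun u =>
      (∀ a : Fin m, col u 11 a ≤ n) ∧ IsEgalitarian R (bundles n m (col u 11)) := by
  have hcongr : ∀ (t d i j : ℕ) (u : Memory), t ≠ 0 → t ≠ 1 → t ≠ 10 → t ≠ 11 →
      PEState R u ∧ Greedy R (bundles n m (col u 11)) d i →
      PEState R (u.write t 0 0 j) ∧ Greedy R (bundles n m (col (u.write t 0 0 j) 11)) d i := by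
    rintro t d i j u h0 h1 h10 h11 ⟨h, h'⟩
    refine ⟨h.congr (Memory.write_ne h0.symm) (Memory.write_ne h1.symm) (Memory.write_ne h10.symm)
      (Memory.write_ne h11.symm), ?_⟩
    rwa [col_write_ne h11.symm]
  refine Ends.for (fun d u => PEState R u ∧ Greedy R (bundles n m (col u 11)) d 0) (N := m)
    (by omega) (by decide) (fun d u j => hcongr 16 d 0 j u (by simp) (by simp) (by simp) (by simp))
    (fun d u _ h => h.1.items) ⟨hs, greedy_empty R fun r => ?_⟩ ?_ ?_
  · rw [eq_empty_iff_forall_notMem]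
    intro a ha
    rw [mem_bundles, hempty] at ha
    omega
  · intro d u _ _ _ h
    refine Ends.for (fun i u => PEState R u ∧ Greedy R (bundles n m (col u 11)) d i) (N := n)
      (by omega) (by decide)
      (fun i u j => hcongr 17 d i j u (by simp) (by simp) (by simp) (by simp))
      (fun i u _ h => h.1.agents) h ?_ ?_
    · intro i v _ hi hv h
      exact attemptProg_ends (i := ⟨i, hi⟩) hL h.1 hv h.2
    · rintro v - ⟨h1, h2⟩
      exact ⟨h1, h2.next_round⟩
  · rintro u - ⟨hu, h⟩
    exact ⟨hu.own_le, h.isEgalitarian⟩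

end PEProgram

/-! ### The PE rule computed by the program -/

section Rule

variable {n m : ℕ}

/-- The memory in which the program for the PE mechanism starts. -/
def peInput (R : Fin n → Finset (Fin m)) : Memory := fun t =>
  if t = 10 then inputMemory R 2 else if t = 0 ∨ t = 1 then inputMemory R t else 0

lemma inputMemory_zero (R : Fin n → Finset (Fin m)) : inputMemory R 0 0 0 = n := by
  simp [inputMemory]

lemma inputMemory_one (R : Fin n → Finset (Fin m)) : inputMemory R 1 0 0 = m := by
  simp [inputMemory]

lemma inputMemory_two (R : Fin n → Finset (Fin m)) (v : Fin n) (a : Fin m) :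
    inputMemory R 2 v a = if a ∈ R v then 1 else 0 := by
  have : (∃ (v' : Fin n) (a' : Fin m), v'.val = v ∧ a'.val = a ∧ a' ∈ R v') ↔ a ∈ R v := by
    constructor
    · rintro ⟨v', a', h1, h2, h3⟩
      rwa [Fin.ext h1, Fin.ext h2] at h3
    · exact fun h => ⟨v, a, rfl, rfl, h⟩
  unfold inputMemory
  rw [if_neg (by simp), if_neg (by simp)]
  exact if_congr (by simp only [true_and, this]) rfl rfl

lemma inputMemory_two_of_not (R : Fin n → Finset (Fin m)) {i j : ℕ} (h : ¬ (i < n ∧ j < m)) :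
    inputMemory R 2 i j = 0 := by
  have : ¬ ∃ (v' : Fin n) (a' : Fin m), v'.val = i ∧ a'.val = j ∧ a' ∈ R v' := by
    rintro ⟨v', a', rfl, rfl, -⟩
    exact h ⟨v'.2, a'.2⟩
  unfold inputMemory
  rw [if_neg (by simp), if_neg (by simp), if_neg fun h' => this h'.2]

lemma inputMemory_eq_zero (R : Fin n → Finset (Fin m)) {t : ℕ} (ht : 3 ≤ t) :
    inputMemory R t = 0 := by
  funext i j
  have h0 : t ≠ 0 := by omega
  have h1 : t ≠ 1 := by omega
  have h2 : t ≠ 2 := by omega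
  simp [inputMemory, h0, h1, h2]

lemma peState_peInput (R : Fin n → Finset (Fin m)) : PEState R (peInput R) := by
  have h11 : ∀ a : Fin m, col (peInput R) 11 a = 0 := fun a => by simp [col, peInput]
  refine ⟨?_, ?_, ?_, fun a => by rw [h11]; omega, fun a r h => ?_⟩
  · simpa [peInput] using inputMemory_zero R
  · simpa [peInput] using inputMemory_one R
  · intro r a
    simp [peInput, inputMemory_two]
  · rw [h11] at h
    omega

lemma exists_peProg_run (R : Fin n → Finset (Fin m)) :
    Ends (n + m + 10) 26 peProg (peInput R) fun u =>
      (∀ a : Fin m, col u 11 a ≤ n) ∧ IsEgalitarian R (bundles n m (col u 11)) :=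
  peProg_ends le_rfl (peState_peInput R) fun a => by simp [col, peInput]

variable (n m) in
/-- The rule that the program for the PE mechanism computes when it starts in `peInput R`. -/
noncomputable def programRule : PERule n m := fun R =>
  bundles n m (col (exists_peProg_run R).choose 11)

lemma isEgalitarian_programRule (R : Fin n → Finset (Fin m)) :
    IsEgalitarian R (programRule n m R) := by
  obtain ⟨t, -, -, -, h⟩ := (exists_peProg_run R).choose_spec
  exact h

theorem isPE_programRule : IsPE (programRule n m) := fun R =>
  (isEgalitarian_programRule R).isPEOutcome

theorem IsPE.isEgalitarian (hn : 2 ≤ n) {pe : PERule n m} (h : IsPE pe)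
    (R : Fin n → Finset (Fin m)) : IsEgalitarian R (pe R) :=
  (h R).isEgalitarian hn (isEgalitarian_programRule R)

/-- The tables used by the program for the PE mechanism. -/
def peTables : List ℕ := [0, 1, 9, 10, 11, 12, 13, 14, 15, 16, 17, 18, 19, 20, 21, 22, 23]

lemma peProg_tables : peProg.tables ⊆ peTables := by
  intro t ht
  simp only [peProg, attemptProg, searchProg, roundProg, relaxProg, walkStepProg, skipProg, forLoop,
    Program.tables, Expr.tables, Expr.var, List.mem_append, List.mem_cons, List.not_mem_nil,
    or_false, false_or] at ht
  simp only [peTables, List.mem_cons, List.not_mem_nil, or_false]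
  omega

/-- The program computes the same rule from every memory that agrees with `peInput R` on the tables
that occur in it. -/
lemma peProg_ends_programRule {s : Memory} {R : Fin n → Finset (Fin m)}
    (h : ∀ t ∈ peTables, peInput R t = s t) :
    Ends (n + m + 10) 26 peProg s fun u =>
      (∀ a : Fin m, col u 11 a ≤ n) ∧ bundles n m (col u 11) = programRule n m R := by
  obtain ⟨t, h1, h2, h3, -⟩ := (exists_peProg_run R).choose_spec
  obtain ⟨u, hu, hsame⟩ := h1.congr peProg_tables h
  have h11 := col_congr (hsame 11 (by decide))
  exact ⟨u, t, hu, h2, h11 ▸ h3, by rw [programRule, h11]⟩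

end Rule

/-! ### The deterministic part of the program for the mechanism

Tables `4` and `5` hold the two random items and table `6` the random numbers for the priority
order. -/

/-- Computes the priority order in table `7` by successive transpositions. -/
def sigmaProg : Program :=
  forLoop 31 (.var 0)
    (.seq (.assign 7 (.var 31) (.const 0) (.get 7 (.get 6 (.var 31) (.const 0)) (.const 0)))
      (.assign 7 (.get 6 (.var 31) (.const 0)) (.const 0) (.var 31)))

/-- Writes the reports, by places, on the items that are not held out into table `10`. -/
def reportsProg : Program :=
  forLoop 32 (.var 0)
    (.seq (forLoop 33 (.var 1)
      (.assign 10 (.var 32) (.var 33) (.get 2 (.get 7 (.var 32) (.const 0)) (.var 33))))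
    (.seq (.assign 10 (.var 32) (.var 4) (.const 0)) (.assign 10 (.var 32) (.var 5) (.const 0))))

/-- Writes the allocation of the items that are not held out into table `3`. -/
def outProg : Program :=
  forLoop 34 (.var 1)
    (.cond (.get 11 (.var 34) (.const 0))
      (.assign 3 (.get 7 (.sub (.get 11 (.var 34) (.const 0)) (.const 1)) (.const 0)) (.var 34)
        (.const 1))
      skipProg)

/-- Finds the last place whose agent reports the first held-out item (`var 35` is that place plus
one, or zero), and gives the item to that agent. -/
def firstProg : Program :=
  .seq (.assign 35 (.const 0) (.const 0) (.const 0))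
  (.seq (forLoop 36 (.var 0)
    (.cond (.get 2 (.get 7 (.var 36) (.const 0)) (.var 4))
      (.assign 35 (.const 0) (.const 0) (.add (.var 36) (.const 1)))
      skipProg))
  (.cond (.var 35)
    (.assign 3 (.get 7 (.sub (.var 35) (.const 1)) (.const 0)) (.var 4) (.const 1))
    skipProg))

/-- The same for the second held-out item, where the winner of the first one comes last. -/
def secondProg : Program :=
  .cond (.add (.sub (.var 4) (.var 5)) (.sub (.var 5) (.var 4)))
    (.seq (.assign 38 (.const 0) (.const 0) (.const 0))
    (.seq (.cond (.var 35)
      (.cond (.get 2 (.get 7 (.sub (.var 35) (.const 1)) (.const 0)) (.var 5))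
        (.assign 38 (.const 0) (.const 0) (.var 35)) skipProg) skipProg)
    (.seq (forLoop 37 (.var 0)
      (.cond (.get 2 (.get 7 (.var 37) (.const 0)) (.var 5))
        (.cond (.add (.sub (.add (.var 37) (.const 1)) (.var 35))
            (.sub (.var 35) (.add (.var 37) (.const 1))))
          (.assign 38 (.const 0) (.const 0) (.add (.var 37) (.const 1))) skipProg) skipProg))
    (.cond (.var 38)
      (.assign 3 (.get 7 (.sub (.var 38) (.const 1)) (.const 0)) (.var 5) (.const 1))
      skipProg))))
    skipProg

/-- Everything after the random draws. -/
def detProg : Program :=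
  .seq sigmaProg (.seq reportsProg (.seq peProg (.seq outProg (.seq firstProg secondProg))))

/-! ### Shuffling -/

section Shuffle

variable {n : ℕ}

/-- The product of the transpositions of `i` and `J i` for `i < k`. -/
def shuffle (J : ℕ → ℕ) : ℕ → Equiv.Perm (Fin n)
  | 0 => 1
  | k + 1 => if h : k < n ∧ J k < n then shuffle J k * Equiv.swap ⟨k, h.1⟩ ⟨J k, h.2⟩
      else shuffle J k

lemma shuffle_succ (J : ℕ → ℕ) {k : ℕ} (hk : k < n) (hJ : J k ≤ k) : shuffle J (k + 1) =
    shuffle J k * Equiv.swap (⟨k, hk⟩ : Fin n) ⟨J k, hJ.trans_lt hk⟩ := by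
  rw [shuffle, dif_pos ⟨hk, hJ.trans_lt hk⟩]

lemma shuffle_congr {J J' : ℕ → ℕ} {k : ℕ} (h : ∀ i < k, J i = J' i) :
    (shuffle J k : Equiv.Perm (Fin n)) = shuffle J' k := by
  induction k with
  | zero => rfl
  | succ k ih =>
    simp only [shuffle, ih fun i hi => h i (by omega), h k (by omega)]

lemma shuffle_apply_of_le {J : ℕ → ℕ} {k : ℕ} (h : ∀ i < k, J i ≤ i) (hk : k ≤ n) (r : Fin n)
    (hr : k ≤ r) : shuffle J k r = r := by
  induction k with
  | zero => rfl
  | succ k ih =>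
    rw [shuffle_succ J (by omega) (h k (by omega)), Equiv.Perm.mul_apply,
      Equiv.swap_apply_of_ne_of_ne]
    · exact ih (fun i hi => h i (by omega)) (by omega) (by omega)
    · intro e
      rw [e] at hr
      simp at hr
    · intro e
      have := h k (by omega)
      rw [e] at hr
      simp at hr
      omega

lemma sigmaProg_ends {L : ℕ} (hL : n + 9 ≤ L) {s : Memory} (hn : s 0 0 0 = n)
    (hJ : ∀ i < n, col s 6 i ≤ i) :
    Ends L 5 sigmaProg s fun u => ∀ r : Fin n, col u 7 r = shuffle (n := n) (col s 6) n r := by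
  refine Ends.for
    (fun k u => ∀ r : Fin n, (r : ℕ) < k → col u 7 r = shuffle (n := n) (col s 6) k r) (N := n)
    hL (by decide) ?_ ?_ (by simp) ?_ ?_
  · intro k u j h
    rwa [col_write_ne (by simp)]
  · intro k u hu _
    simp only [Expr.eval, Expr.var]
    rw [hu 0 (by decide), hn]
  · intro k u hu hk hc h
    have h6 : u 6 k 0 = col s 6 k := by rw [hu 6 (by decide)]; rfl
    have hJk := hJ k hk
    refine Ends.seq (by omega) (Ends.assign (by omega) (Ends.assign (by omega) ?_))
    simp only [Expr.eval, Expr.var, hc, h6, Memory.write_ne, ne_eq, Nat.reduceEqDiff,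
      not_false_eq_true, col_write]
    set j := col s 6 k with hj
    intro r hr
    have hs := shuffle_succ (n := n) (col s 6) hk hJk
    have hfix := shuffle_apply_of_le (n := n) (J := col s 6) (fun i hi => hJ i (by omega)) hk.le
      ⟨k, hk⟩ le_rfl
    by_cases e1 : (r : ℕ) = j
    · have : r = ⟨j, hJk.trans_lt hk⟩ := Fin.ext e1
      rw [e1, Function.update_self, hs, this, Equiv.Perm.mul_apply, Equiv.swap_apply_right, hfix]
    · rw [Function.update_of_ne e1]
      by_cases e2 : (r : ℕ) = k
      · have : r = ⟨k, hk⟩ := Fin.ext e2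
        rw [e2, Function.update_self, hs, this, Equiv.Perm.mul_apply, Equiv.swap_apply_left]
        exact h ⟨j, hJk.trans_lt hk⟩ (by change j < k; omega)
      · rw [Function.update_of_ne e2, hs, Equiv.Perm.mul_apply, Equiv.swap_apply_of_ne_of_ne
          (fun e => e2 (by rw [e])) (fun e => e1 (by rw [e]))]
        exact h r (by omega)
  · intro u _ h r
    exact h r r.2

end Shuffle

/-! ### Scanning for the first agent -/

section Scan

variable {n : ℕ}

/-- Among the places that satisfy `P`, the number `W - 1` is the one with the smallest key that
satisfies `Y`, and `W = 0` if there is none. -/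
def Scan (P Y : Fin n → Prop) (key : Fin n → ℕ) (W : ℕ) : Prop :=
  (W = 0 ∧ ∀ r, P r → ¬ Y r) ∨
    ∃ r, P r ∧ W = r + 1 ∧ Y r ∧ ∀ r', P r' → key r' < key r → ¬ Y r'

lemma Scan.hit {P P' Y : Fin n → Prop} {key : Fin n → ℕ} {r₀ : Fin n}
    (hY : Y r₀) (hkey : ∀ r, P r → key r₀ < key r) (hP : ∀ r, P' r ↔ P r ∨ r = r₀) :
    Scan P' Y key (r₀ + 1) := by
  refine .inr ⟨r₀, (hP r₀).2 (.inr rfl), rfl, hY, fun r hr hlt => ?_⟩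
  rcases (hP r).1 hr with h | rfl
  · exact absurd hlt (hkey r h).asymm
  · exact absurd hlt (lt_irrefl _)

lemma Scan.miss {P P' Y : Fin n → Prop} {key : Fin n → ℕ} {W : ℕ} {r₀ : Fin n}
    (h : Scan P Y key W) (hY : ¬ Y r₀) (hP : ∀ r, P' r ↔ P r ∨ r = r₀) : Scan P' Y key W := by
  rcases h with ⟨h1, h2⟩ | ⟨r, h1, h2, h3, h4⟩
  · refine .inl ⟨h1, fun r hr => ?_⟩
    rcases (hP r).1 hr with h | rfl
    exacts [h2 r h, hY]
  · refine .inr ⟨r, (hP r).2 (.inl h1), h2, h3, fun r' hr' hlt => ?_⟩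
    rcases (hP r').1 hr' with h | rfl
    exacts [h4 r' h hlt, hY]

lemma Scan.congr {P P' Y : Fin n → Prop} {key : Fin n → ℕ} {W : ℕ}
    (h : Scan P Y key W) (hP : ∀ r, P' r ↔ P r) : Scan P' Y key W := by
  have : P' = P := funext fun r => propext (hP r)
  rwa [this]

lemma Scan.eq_iff {P Y : Fin n → Prop} {key : Fin n → ℕ} {W : ℕ} (h : Scan P Y key W)
    (hP : ∀ r, P r) (hinj : Function.Injective key) (r : Fin n) :
    W = r + 1 ↔ Y r ∧ ∀ r', key r' < key r → ¬ Y r' := by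
  rcases h with ⟨h1, h2⟩ | ⟨r₁, -, h2, h3, h4⟩
  · constructor
    · intro h
      omega
    · exact fun h => absurd h.1 (h2 r (hP r))
  · constructor
    · intro h
      have : r₁ = r := Fin.ext (by omega)
      subst this
      exact ⟨h3, fun r' => h4 r' (hP r')⟩
    · rintro ⟨h5, h6⟩
      rcases lt_trichotomy (key r) (key r₁) with h | h | h
      · exact absurd h5 (h4 r (hP r) h)
      · rw [h2, hinj h]
      · exact absurd h3 (h6 r₁ h)

lemma Scan.exists_eq {P Y : Fin n → Prop} {key : Fin n → ℕ} {W : ℕ} (h : Scan P Y key W)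
    (hW : W ≠ 0) : ∃ r : Fin n, W = r + 1 := by
  rcases h with ⟨h1, -⟩ | ⟨r, -, h2, -⟩
  exacts [absurd h1 hW, ⟨r, h2⟩]

end Scan

/-! ### Correctness of the deterministic part -/

section Deterministic

variable {n m : ℕ} {R : Fin n → Finset (Fin m)} {σ : Equiv.Perm (Fin n)} {x y : Fin m} {L : ℕ}

/-- The memory holds the input, the random items and the priority order. -/
structure Ready (R : Fin n → Finset (Fin m)) (σ : Equiv.Perm (Fin n)) (x y : Fin m) (s : Memory) :
    Prop where
  agents : s 0 0 0 = n
  items : s 1 0 0 = m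
  reports : ∀ (v : Fin n) (a : Fin m), s 2 v a = if a ∈ R v then 1 else 0
  fst : s 4 0 0 = x
  snd : s 5 0 0 = y
  order : ∀ r : Fin n, s 7 r 0 = σ r

lemma Ready.congr {s u : Memory} (h : Ready R σ x y s)
    (hu : ∀ t ∈ [0, 1, 2, 4, 5, 7], u t = s t) : Ready R σ x y u := by
  refine ⟨?_, ?_, ?_, ?_, ?_, ?_⟩
  · rw [hu 0 (by simp)]; exact h.agents
  · rw [hu 1 (by simp)]; exact h.items
  · rw [hu 2 (by simp)]; exact h.reports
  · rw [hu 4 (by simp)]; exact h.fst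
  · rw [hu 5 (by simp)]; exact h.snd
  · rw [hu 7 (by simp)]; exact h.order

lemma reportsProg_ends (hL : n + m + 10 ≤ L) {s : Memory} (hs : Ready R σ x y s)
    (h10 : s 10 = 0) : Ends L 9 reportsProg s fun u =>
      u 10 = inputMemory (fun r => R (σ r) \ heldSet (pairHeld x y)) 2 := by
  have hL0 : 0 < L := by omega
  refine Ends.for (fun k u => ∀ i j, u 10 i j =
      if i < k ∧ j < m ∧ j ≠ x ∧ j ≠ y then s 2 (s 7 i 0) j else 0) (N := n) (by omega) (by decide)
    ?_ ?_ (by simp [h10]) ?_ ?_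
  · intro k u j h
    rwa [Memory.write_ne (by simp)]
  · intro k u hu _
    simp only [Expr.eval, Expr.var]
    rw [hu 0 (by decide), hs.agents]
  · intro k u hu hk hc h
    have hus : ∀ t ∈ [0, 1, 2, 4, 5, 7], u t = s t := by
      intro t ht
      simp only [List.mem_cons, List.not_mem_nil, or_false] at ht
      rcases ht with rfl | rfl | rfl | rfl | rfl | rfl
      all_goals exact hu _ (by decide)
    refine Ends.seq (by omega) (Ends.mono_exp (k := 4) hL0 ?_ (by omega))
    refine Ends.for (fun l v => ∀ i j, v 10 i j =
      if i < k ∧ j < m ∧ j ≠ x ∧ j ≠ y then s 2 (s 7 i 0) j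
        else if i = k ∧ j < l then s 2 (s 7 i 0) j else 0) (N := m) (by omega) (by decide)
      ?_ ?_ (by simpa using h) ?_ ?_
    · intro l v j h
      rwa [Memory.write_ne (by simp)]
    · intro l v hv _
      simp only [Expr.eval, Expr.var]
      rw [hv 1 (by decide), hus 1 (by simp), hs.items]
    · intro l v hv hl hcl hI
      refine Ends.assign hL0 ?_
      have h32 : v 32 0 0 = k := by rw [hv 32 (by decide), hc]
      simp only [Expr.eval, Expr.var, hcl, h32, hv 2 (by decide), hv 7 (by decide),
        hus 2 (by simp), hus 7 (by simp)]
      intro i j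
      rw [Memory.write_same, hI]
      by_cases e : i = k ∧ j = l
      · obtain ⟨rfl, rfl⟩ := e
        simp
      · rw [if_neg e]
        by_cases e1 : i = k
        · have : j ≠ l := fun e2 => e ⟨e1, e2⟩
          have : j < l + 1 ↔ j < l := by omega
          simp [this]
        · simp [e1]
    · intro v hv hI
      have h32 : v 32 0 0 = k := by rw [hv 32 (by decide), hc]
      refine Ends.seq (by omega) (Ends.assign hL0 (Ends.assign hL0 ?_))
      have h4 : v 4 0 0 = x := by rw [hv 4 (by decide), hus 4 (by simp), hs.fst]
      have h5 : v 5 0 0 = y := by rw [hv 5 (by decide), hus 5 (by simp), hs.snd]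
      simp only [Expr.eval, Expr.var, h32, h4, h5, Memory.write_ne, ne_eq, Nat.reduceEqDiff,
        not_false_eq_true]
      intro i j
      rw [Memory.write_same, Memory.write_same, hI]
      by_cases e1 : i = k
      · subst e1
        by_cases e2 : j = y
        · simp [e2]
        · by_cases e3 : j = x
          · simp [e3]
          · simp [e2, e3]
      · have : i < k + 1 ↔ i < k := by omega
        simp [e1, this]
  · intro u _ h
    funext i j
    rw [h]
    by_cases hij : i < n ∧ j < m
    · obtain ⟨hi, hj⟩ := hij
      have e1 : s 7 i 0 = σ ⟨i, hi⟩ := hs.order ⟨i, hi⟩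
      have e2 := hs.reports (σ ⟨i, hi⟩) ⟨j, hj⟩
      have e3 := inputMemory_two (fun r => R (σ r) \ heldSet (pairHeld x y)) ⟨i, hi⟩ ⟨j, hj⟩
      simp only at e2 e3
      rw [e1, e2, e3, heldSet_pairHeld]
      simp only [mem_sdiff, mem_insert, mem_singleton, Fin.ext_iff, hi, hj, true_and, not_or]
      split_ifs <;> tauto
    · rw [inputMemory_two_of_not _ hij, if_neg]
      tauto

/-- The table `3` describes the allocation `A`. -/
def Output (A : Fin n → Finset (Fin m)) (s : Memory) : Prop :=
  ∀ (v : Fin n) (a : Fin m), s 3 v a = 1 ↔ a ∈ A v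

lemma outProg_ends (hL : n + m + 10 ≤ L) {s : Memory} (hs : Ready R σ x y s)
    (h3 : s 3 = 0) (hown : ∀ a : Fin m, col s 11 a ≤ n) :
    Ends L 5 outProg s (Output fun v => bundles n m (col s 11) (σ.symm v)) := by
  have hL0 : 0 < L := by omega
  refine Ends.for (fun k u => ∀ (v : Fin n) (a : Fin m), u 3 v a = 1 ↔
      (a : ℕ) < k ∧ col s 11 a = σ.symm v + 1) (N := m) (by omega) (by decide)
    ?_ ?_ (by simp [h3]) ?_ ?_
  · intro k u j h
    rwa [Memory.write_ne (by simp)]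
  · intro k u hu _
    simp only [Expr.eval, Expr.var]
    rw [hu 1 (by decide), hs.items]
  · intro k u hu hk hc h
    have h11 : u 11 k 0 = col s 11 k := by rw [hu 11 (by decide)]; rfl
    have hkle : col s 11 k ≤ n := hown ⟨k, hk⟩
    refine Ends.cond (by omega) (fun he => ?_) fun he => ?_
    · simp only [Expr.eval, Expr.var, hc, h11] at he
      refine Ends.assign hL0 ?_
      have hr : col s 11 k - 1 < n := by omega
      have h7 : u 7 (col s 11 k - 1) 0 = σ ⟨col s 11 k - 1, hr⟩ := by
        rw [hu 7 (by decide)]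
        exact hs.order ⟨_, hr⟩
      simp only [Expr.eval, Expr.var, hc, h11, h7]
      intro v a
      rw [Memory.write_same]
      by_cases e : (a : ℕ) = k
      · have e1 : ((v : ℕ) = σ ⟨col s 11 k - 1, hr⟩ ∧ (a : ℕ) = k) ↔
            col s 11 k = σ.symm v + 1 := by
          rw [← Fin.ext_iff, ← Equiv.symm_apply_eq, Fin.ext_iff]
          simp only [e, and_true]
          omega
        by_cases e2 : col s 11 k = σ.symm v + 1
        · rw [if_pos (e1.2 e2), e]
          simpa using e2
        · rw [if_neg (mt e1.1 e2), h v a, e]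
          simp [e2]
      · rw [if_neg (fun h => e h.2), h v a]
        have : (a : ℕ) < k + 1 ↔ (a : ℕ) < k := by omega
        rw [this]
    · simp only [Expr.eval, Expr.var, hc, h11] at he
      refine Ends.assign hL0 ?_
      intro v a
      rw [Memory.write_ne (by simp), h v a]
      by_cases e : (a : ℕ) = k
      · rw [e, he]
        omega
      · have : (a : ℕ) < k + 1 ↔ (a : ℕ) < k := by omega
        rw [this]
  · intro u _ h v a
    rw [h v a, mem_bundles]
    simp

lemma output_write {A B : Fin n → Finset (Fin m)} {s : Memory} (h : Output A s) (w : Fin n)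
    (b : Fin m) (hB : ∀ v a, a ∈ B v ↔ a ∈ A v ∨ (v = w ∧ a = b)) :
    Output B (s.write 3 w b 1) := by
  intro v a
  rw [Memory.write_same, hB, ← h v a, Fin.ext_iff, Fin.ext_iff]
  split_ifs with h1
  · simp [h1]
  · simp [h1]

/-- The scan overwrites its result at every hit, so that the last place in the order `σ`
remains, which is the first one in the reverse order. -/
lemma firstProg_ends (hL : n + m + 10 ≤ L) {s : Memory} (hs : Ready R σ x y s)
    {A B : Fin n → Finset (Fin m)} (hA : Output A s)
    (hB : ∀ v a, a ∈ B v ↔ a ∈ A v ∨ (IsFirst (Fin.revPerm.trans σ) R x v ∧ a = x)) :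
    Ends L 8 firstProg s fun u => Output B u ∧ u 35 0 0 ≤ n ∧
      ∀ r : Fin n, u 35 0 0 = r + 1 ↔ IsFirst (Fin.revPerm.trans σ) R x (σ r) := by
  have hL0 : 0 < L := by omega
  refine Ends.seq (by omega) (Ends.assign hL0 (Ends.seq (by omega) ?_))
  simp only [Expr.eval]
  set w := s.write 35 0 0 0 with hw
  have hwne : ∀ t, t ≠ 35 → w t = s t := fun t ht => Memory.write_ne ht
  refine Ends.mono_exp (k := 5) hL0 (Ends.for (fun k u => Scan (fun r : Fin n => (r : ℕ) < k)
    (fun r => x ∈ R (σ r)) (fun r => n - 1 - (r : ℕ)) (u 35 0 0)) (N := n) (by omega) (by decide)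
    ?_ ?_ ?_ ?_ ?_) (by omega)
  · intro k u j h
    rwa [Memory.write_ne (by simp)]
  · intro k u hu _
    simp only [Expr.eval, Expr.var]
    rw [hu 0 (by decide), hwne 0 (by simp), hs.agents]
  · exact .inl ⟨by rw [hw, Memory.write_self], fun r hr => by omega⟩
  · intro k u hu hk hc h
    have hP : ∀ r : Fin n, (r : ℕ) < k + 1 ↔ (r : ℕ) < k ∨ r = ⟨k, hk⟩ := fun r => by
      rw [Fin.ext_iff]
      simp only
      omega
    have h2 : u 2 (u 7 k 0) (u 4 0 0) = if x ∈ R (σ ⟨k, hk⟩) then 1 else 0 := by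
      rw [hu 2 (by decide), hu 7 (by decide), hu 4 (by decide), hwne 2 (by simp),
        hwne 7 (by simp), hwne 4 (by simp), hs.fst, ← hs.reports]
      congr 1
      exact hs.order ⟨k, hk⟩
    refine Ends.cond (by omega) (fun he => ?_) fun he => ?_
    · simp only [Expr.eval, Expr.var, hc, h2] at he
      refine Ends.assign hL0 ?_
      simp only [Expr.eval, Expr.var, hc, Memory.write_self]
      refine Scan.hit (r₀ := ⟨k, hk⟩) (P := fun r : Fin n => (r : ℕ) < k) ?_ (fun r hr => ?_) hP
      · by_contra hcon
        exact he (if_neg hcon)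
      · simp only
        omega
    · simp only [Expr.eval, Expr.var, hc, h2] at he
      refine Ends.assign hL0 ?_
      rw [Memory.write_ne (by simp)]
      refine h.miss (r₀ := ⟨k, hk⟩) (fun hcon => ?_) hP
      simp [hcon] at he
  · intro u hu h
    have hinj : Function.Injective fun r : Fin n => n - 1 - (r : ℕ) := fun r r' e => by
      have := r.2
      have := r'.2
      simp only at e
      exact Fin.ext (by omega)
    have hiff : ∀ r : Fin n, u 35 0 0 = r + 1 ↔ IsFirst (Fin.revPerm.trans σ) R x (σ r) := by
      intro r
      rw [h.eq_iff (fun r => r.2) hinj, IsFirst]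
      refine and_congr_right fun _ => Equiv.forall_congr σ fun r' => ?_
      simp only [symm_rev_trans, Equiv.symm_apply_apply, Fin.lt_def, Fin.val_rev]
      have : n - 1 - (r' : ℕ) < n - 1 - r ↔ n - ((r' : ℕ) + 1) < n - ((r : ℕ) + 1) := by omega
      rw [this]
    have hle : u 35 0 0 ≤ n := by
      by_cases h0 : u 35 0 0 = 0
      · omega
      · obtain ⟨r, hr⟩ := h.exists_eq h0
        have := r.2
        omega
    have hAu : Output A u := by
      intro v a
      rw [hu 3 (by decide), hwne 3 (by simp)]
      exact hA v a
    refine Ends.cond (by omega) (fun he => ?_) fun he => ?_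
    · simp only [Expr.eval, Expr.var] at he
      obtain ⟨r, hr⟩ := h.exists_eq he
      refine Ends.assign hL0 ?_
      have h7 : u 7 r 0 = σ r := by
        rw [hu 7 (by decide), hwne 7 (by simp)]
        exact hs.order r
      have h4 : u 4 0 0 = x := by rw [hu 4 (by decide), hwne 4 (by simp), hs.fst]
      simp only [Expr.eval, Expr.var, hr, Nat.add_sub_cancel, h7, h4]
      rw [Memory.write_ne (by simp), hr]
      rw [hr] at hiff hle
      refine ⟨output_write hAu _ _ fun v a => ?_, hle, hiff⟩
      rw [hB]
      have hfirst := (hiff r).1 rfl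
      have : IsFirst (Fin.revPerm.trans σ) R x v ↔ v = σ r :=
        ⟨fun h => h.unique hfirst, fun h => h ▸ hfirst⟩
      rw [this]
    · simp only [Expr.eval, Expr.var] at he
      refine Ends.assign hL0 ?_
      refine ⟨fun v a => ?_, ?_⟩
      · rw [Memory.write_ne (by simp), hAu v a, hB]
        have : ¬ IsFirst (Fin.revPerm.trans σ) R x v := by
          intro hcon
          have := (hiff (σ.symm v)).2 (by simpa using hcon)
          omega
        simp [this]
      · rw [Memory.write_ne (by simp)]
        exact ⟨hle, hiff⟩

/-- The scan runs through the updated order from its end to its beginning: it starts with the winner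
of the first item and then visits the other agents in the order `σ`. -/
lemma secondProg_ends (hL : n + m + 10 ≤ L) {s : Memory} (hs : Ready R σ x y s)
    {A B : Fin n → Finset (Fin m)} (hA : Output A s) (hle : s 35 0 0 ≤ n)
    (hfirst : ∀ r : Fin n, s 35 0 0 = r + 1 ↔ IsFirst (Fin.revPerm.trans σ) R x (σ r))
    (hB : ∀ v a, a ∈ B v ↔ a ∈ A v ∨ (x ≠ y ∧ a = y ∧ y ∈ R v ∧
      ∀ u, updatedPlace (Fin.revPerm.trans σ) R x u < updatedPlace (Fin.revPerm.trans σ) R x v →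
        y ∉ R u)) :
    Ends L 10 secondProg s (Output B) := by
  have hL0 : 0 < L := by omega
  set key : Fin n → ℕ := fun r => updatedPlace (Fin.revPerm.trans σ) R x (σ r) with hkey
  have hkeyF : ∀ r : Fin n, s 35 0 0 = r + 1 → key r = n := fun r hr =>
    updatedPlace_of_isFirst ((hfirst r).1 hr)
  have hkeyN : ∀ r : Fin n, s 35 0 0 ≠ r + 1 → key r = n - (r + 1) := fun r hr => by
    rw [hkey]
    simp only
    rw [updatedPlace_of_not (mt (hfirst r).2 hr), symm_rev_trans, Fin.val_rev,
      Equiv.symm_apply_apply]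
  have hrep : ∀ (u : Memory) (r : Fin n), u 2 = s 2 → u 7 = s 7 → u 5 = s 5 →
      u 2 (u 7 r 0) (u 5 0 0) = if y ∈ R (σ r) then 1 else 0 := by
    intro u r h2 h7 h5
    rw [h2, h7, h5, hs.snd, hs.order, hs.reports]
  refine Ends.cond (by omega) (fun he => ?_) fun he => ?_
  swap
  · -- a single held-out item
    simp only [Expr.eval, Expr.var, hs.fst, hs.snd] at he
    have hxy : x = y := Fin.ext (by omega)
    refine Ends.assign hL0 fun v a => ?_
    rw [Memory.write_ne (by simp), hA v a, hB]
    simp [hxy]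
  simp only [Expr.eval, Expr.var, hs.fst, hs.snd] at he
  have hxy : x ≠ y := by
    rintro rfl
    simp at he
  refine Ends.seq (by omega) (Ends.assign hL0 (Ends.seq (by omega) ?_))
  simp only [Expr.eval]
  set w := s.write 38 0 0 0 with hw
  have hwne : ∀ t, t ≠ 38 → w t = s t := fun t ht => Memory.write_ne ht
  have h35 : w 35 0 0 = s 35 0 0 := by rw [hwne 35 (by simp)]
  -- the scan begins with the winner of the first item
  have hstart : Ends L 7 (.cond (.var 35)
      (.cond (.get 2 (.get 7 (.sub (.var 35) (.const 1)) (.const 0)) (.var 5))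
        (.assign 38 (.const 0) (.const 0) (.var 35)) skipProg) skipProg) w
      fun u => Scan (fun r : Fin n => s 35 0 0 = r + 1) (fun r => y ∈ R (σ r)) key (u 38 0 0) := by
    refine Ends.cond (by omega) (fun h1 => ?_) fun h1 => ?_
    · simp only [Expr.eval, Expr.var, h35] at h1
      obtain ⟨r, hr⟩ : ∃ r : Fin n, s 35 0 0 = r + 1 :=
        ⟨⟨s 35 0 0 - 1, by omega⟩, by simp only; omega⟩
      have h2 := hrep w r (hwne 2 (by simp)) (hwne 7 (by simp)) (hwne 5 (by simp))
      refine Ends.cond (by omega) (fun h3 => ?_) fun h3 => ?_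
      · simp only [Expr.eval, Expr.var, h35, hr, Nat.add_sub_cancel, h2] at h3
        refine Ends.assign hL0 ?_
        simp only [Expr.eval, Expr.var, h35, Memory.write_self, hr]
        refine Scan.hit (P := fun _ => False) ?_ (by simp) fun r' => ?_
        · by_contra hcon
          exact h3 (if_neg hcon)
        · rw [false_or, Fin.ext_iff]
          omega
      · simp only [Expr.eval, Expr.var, h35, hr, Nat.add_sub_cancel, h2] at h3
        refine Ends.assign hL0 ?_
        rw [Memory.write_ne (by simp), hw, Memory.write_self]
        refine .inl ⟨rfl, fun r' hr' hcon => ?_⟩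
        have : r' = r := Fin.ext (by omega)
        subst this
        simp [hcon] at h3
    · simp only [Expr.eval, Expr.var, h35] at h1
      refine Ends.assign hL0 ?_
      rw [Memory.write_ne (by simp), hw, Memory.write_self]
      exact .inl ⟨rfl, fun r hr => by omega⟩
  refine hstart.keep.mono ?_
  rintro v ⟨hscan, hv⟩
  refine Ends.seq (by omega) (Ends.mono_exp (k := 6) hL0 (Ends.for
    (fun k u => Scan (fun r : Fin n => s 35 0 0 = r + 1 ∨ (r : ℕ) < k)
    (fun r => y ∈ R (σ r)) key (u 38 0 0)) (N := n) (by omega) (by decide)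
    ?_ ?_ ?_ ?_ ?_) (by omega))
  · intro k u j h
    rwa [Memory.write_ne (by simp)]
  · intro k u hu _
    simp only [Expr.eval, Expr.var]
    rw [hu 0 (by decide), hv 0 (by decide), hwne 0 (by simp), hs.agents]
  · exact hscan.congr fun r => by simp
  · intro k u hu hk hc h
    have h2 := hrep u ⟨k, hk⟩
      (by rw [hu 2 (by decide), hv 2 (by decide), hwne 2 (by simp)])
      (by rw [hu 7 (by decide), hv 7 (by decide), hwne 7 (by simp)])
      (by rw [hu 5 (by decide), hv 5 (by decide), hwne 5 (by simp)])
    have hu35 : u 35 0 0 = s 35 0 0 := by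
      rw [hu 35 (by decide), hv 35 (by decide), h35]
    have hP : ∀ r : Fin n, (s 35 0 0 = r + 1 ∨ (r : ℕ) < k + 1) ↔
        (s 35 0 0 = r + 1 ∨ (r : ℕ) < k) ∨ r = ⟨k, hk⟩ := fun r => by
      rw [Fin.ext_iff]
      simp only
      omega
    refine Ends.cond (by omega) (fun h3 => Ends.cond (by omega) (fun h4 => ?_) fun h4 => ?_)
      fun h3 => ?_
    · simp only [Expr.eval, Expr.var, hc, h2] at h3
      simp only [Expr.eval, Expr.var, hc, hu35] at h4
      refine Ends.assign hL0 ?_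
      simp only [Expr.eval, Expr.var, hc, Memory.write_self]
      refine Scan.hit (r₀ := ⟨k, hk⟩) (P := fun r : Fin n => s 35 0 0 = r + 1 ∨ (r : ℕ) < k)
        ?_ (fun r hr => ?_) hP
      · by_contra hcon
        exact h3 (if_neg hcon)
      · have hk' : key ⟨k, hk⟩ = n - (k + 1) := hkeyN ⟨k, hk⟩ (by simp only; omega)
        rw [hk']
        by_cases hr1 : s 35 0 0 = r + 1
        · rw [hkeyF r hr1]
          omega
        · rw [hkeyN r hr1]
          rcases hr with hr | hr
          · exact absurd hr hr1
          · omega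
    · simp only [Expr.eval, Expr.var, hc, hu35] at h4
      refine Ends.assign hL0 ?_
      rw [Memory.write_ne (by simp)]
      refine h.congr fun r => ?_
      omega
    · simp only [Expr.eval, Expr.var, hc, h2] at h3
      refine Ends.assign hL0 ?_
      rw [Memory.write_ne (by simp)]
      refine h.miss (r₀ := ⟨k, hk⟩) (fun hcon => ?_) hP
      simp [hcon] at h3
  · intro u hu h
    have hinj : Function.Injective key :=
      (updatedPlace_injective (Fin.revPerm.trans σ) R x).comp σ.injective
    have hiff := h.eq_iff (fun r => .inr r.2) hinj
    have hout : ∀ v : Fin n, u 38 0 0 = σ.symm v + 1 ↔ (y ∈ R v ∧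
        ∀ z, updatedPlace (Fin.revPerm.trans σ) R x z < updatedPlace (Fin.revPerm.trans σ) R x v →
          y ∉ R z) := by
      intro v
      rw [hiff, σ.apply_symm_apply]
      refine and_congr_right fun _ => Equiv.forall_congr σ fun r' => ?_
      simp only [hkey, Equiv.apply_symm_apply]
    have hBu : ∀ v a, a ∈ B v ↔ a ∈ A v ∨ (u 38 0 0 = σ.symm v + 1 ∧ a = y) := by
      intro v a
      rw [hB, hout]
      tauto
    have hAu : Output A u := by
      intro v' a
      rw [hu 3 (by decide), hv 3 (by decide), hwne 3 (by simp)]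
      exact hA v' a
    refine Ends.cond (by omega) (fun he => ?_) fun he => ?_
    · simp only [Expr.eval, Expr.var] at he
      obtain ⟨r, hr⟩ := h.exists_eq he
      refine Ends.assign hL0 ?_
      have h7 : u 7 r 0 = σ r := by
        rw [hu 7 (by decide), hv 7 (by decide), hwne 7 (by simp)]
        exact hs.order r
      have h5 : u 5 0 0 = y := by rw [hu 5 (by decide), hv 5 (by decide), hwne 5 (by simp), hs.snd]
      simp only [Expr.eval, Expr.var, hr, Nat.add_sub_cancel, h7, h5]
      refine output_write hAu _ _ fun v a => ?_
      rw [hBu, hr]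
      have : (r : ℕ) + 1 = σ.symm v + 1 ↔ v = σ r := by
        rw [← Equiv.symm_apply_eq, Fin.ext_iff]
        omega
      rw [this]
    · simp only [Expr.eval, Expr.var] at he
      refine Ends.assign hL0 fun v a => ?_
      rw [Memory.write_ne (by simp), hAu v a, hBu, he]
      simp

/-- After the random draws, the program computes the outcome of the mechanism. -/
theorem detProg_ends (hL : L = n + m + 10) {s : Memory}
    (hs : ∀ t, t ∉ [4, 5, 6, 30] → s t = inputMemory R t) (hx : s 4 0 0 = x) (hy : s 5 0 0 = y)
    (hJ : ∀ i < n, col s 6 i ≤ i) :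
    Ends L 32 detProg s fun u => outputAllocation u =
      mech (programRule n m) R (pairHeld x y, shuffle (col s 6) n) := by
  classical
  have hL0 : 0 < L := by omega
  have hzero : ∀ t, 3 ≤ t → t ∉ [4, 5, 6, 30] → s t = 0 := fun t h h' =>
    (hs t h').trans (inputMemory_eq_zero R h)
  set σ : Equiv.Perm (Fin n) := shuffle (col s 6) n with hσ
  have hn0 : s 0 0 0 = n := by rw [hs 0 (by simp)]; exact inputMemory_zero R
  refine Ends.seq (by omega) (Ends.mono_exp (k := 5) hL0
    ((sigmaProg_ends (by omega) hn0 hJ).keep.mono ?_) (by omega))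
  rintro u ⟨hsig, hu⟩
  have hready : Ready R σ x y u := by
    refine ⟨?_, ?_, ?_, ?_, ?_, hsig⟩
    · rw [hu 0 (by decide), hn0]
    · rw [hu 1 (by decide), hs 1 (by simp), inputMemory_one]
    · rw [hu 2 (by decide), hs 2 (by simp)]
      exact inputMemory_two R
    · rw [hu 4 (by decide), hx]
    · rw [hu 5 (by decide), hy]
  refine Ends.seq (by omega) (Ends.mono_exp (k := 9) hL0
    ((reportsProg_ends hL.ge hready
      (by rw [hu 10 (by decide), hzero 10 (by simp) (by simp)])).keep.mono ?_) (by omega))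
  rintro v ⟨h10, hv⟩
  set R' : Fin n → Finset (Fin m) := fun r => R (σ r) \ heldSet (pairHeld x y) with hR'
  have hready : Ready R σ x y v := hready.congr (by
    intro t ht
    simp only [List.mem_cons, List.not_mem_nil, or_false] at ht
    rcases ht with rfl | rfl | rfl | rfl | rfl | rfl
    all_goals exact hv _ (by decide))
  have hin : ∀ t ∈ peTables, peInput R' t = v t := by
    have hvz : ∀ t, t ∉ reportsProg.mods → t ∉ sigmaProg.mods → 3 ≤ t → t ∉ [4, 5, 6, 30] →
        v t = 0 := fun t h1 h2 h3 h4 => by rw [hv t h1, hu t h2, hzero t h3 h4]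
    intro t ht
    simp only [peTables, List.mem_cons, List.not_mem_nil, or_false] at ht
    rcases ht with rfl | rfl | rfl | rfl | rfl | rfl | rfl | rfl | rfl | rfl | rfl | rfl | rfl |
      rfl | rfl | rfl | rfl
    · rw [hv 0 (by decide), hu 0 (by decide), hs 0 (by simp)]
      funext i j
      simp [peInput, inputMemory]
    · rw [hv 1 (by decide), hu 1 (by decide), hs 1 (by simp)]
      funext i j
      simp [peInput, inputMemory]
    · rw [hvz 9 (by decide) (by decide) (by simp) (by simp)]
      simp [peInput]
    · rw [h10]
      simp [peInput]
    all_goals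
      rw [hvz _ (by decide) (by decide) (by simp) (by simp)]
      simp [peInput]
  refine Ends.seq (by omega) (Ends.mono_exp (k := 26) hL0
    ((hL ▸ peProg_ends_programRule hin).keep.mono ?_) (by omega))
  rintro w ⟨⟨hown, hpe⟩, hw⟩
  have hready : Ready R σ x y w := hready.congr (by
    intro t ht
    simp only [List.mem_cons, List.not_mem_nil, or_false] at ht
    rcases ht with rfl | rfl | rfl | rfl | rfl | rfl
    all_goals exact hw _ (by decide))
  have h3 : w 3 = 0 := by
    rw [hw 3 (by decide), hv 3 (by decide), hu 3 (by decide), hzero 3 (by simp) (by simp)]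
  refine Ends.seq (by omega) (Ends.mono_exp (k := 5) hL0
    ((outProg_ends hL.ge hready h3 hown).keep.mono ?_) (by omega))
  rintro w₁ ⟨hA, hw₁⟩
  have hready : Ready R σ x y w₁ := hready.congr (by
    intro t ht
    simp only [List.mem_cons, List.not_mem_nil, or_false] at ht
    rcases ht with rfl | rfl | rfl | rfl | rfl | rfl
    all_goals exact hw₁ _ (by decide))
  rw [hpe] at hA
  refine Ends.seq (by omega) (Ends.mono_exp (k := 8) hL0
    ((firstProg_ends hL.ge hready hA (B := fun v => programRule n m R' (σ.symm v) ∪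
      univ.filter fun a => IsFirst (Fin.revPerm.trans σ) R x v ∧ a = x)
      fun v a => by simp).keep.mono ?_) (by omega))
  rintro w₂ ⟨⟨hB, hle, hfirst⟩, hw₂⟩
  have hready : Ready R σ x y w₂ := hready.congr (by
    intro t ht
    simp only [List.mem_cons, List.not_mem_nil, or_false] at ht
    rcases ht with rfl | rfl | rfl | rfl | rfl | rfl
    all_goals exact hw₂ _ (by decide))
  refine Ends.mono_exp (k := 10) hL0 ((secondProg_ends hL.ge hready hB hle hfirst
    (B := mech (programRule n m) R (pairHeld x y, σ)) fun v a => ?_).mono ?_) (by omega)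
  · rw [mech_eq, mem_union, mem_heldOutMech, mem_union, peWith]
    simp only [mem_filter, mem_univ, true_and, or_assoc]
    refine or_congr_right ?_
    by_cases hxy : x = y
    · subst hxy
      simp [pairHeld_self, and_comm]
    · simp only [pairHeld_of_ne hxy, Option.some.injEq, ne_eq, hxy, not_false_eq_true, true_and]
      constructor
      · rintro (⟨h1, h2⟩ | ⟨rfl, h2, h3⟩)
        · exact .inl ⟨h2, h1⟩
        · exact .inr ⟨rfl, h2, h3⟩
      · rintro (⟨h1, h2⟩ | ⟨rfl, h2, h3⟩)
        · exact .inl ⟨h2, h1⟩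
        · exact .inr ⟨rfl, h2, h3⟩
  · intro z hz
    funext v
    ext a
    rw [← hz v a]
    simp [outputAllocation]

end Deterministic

/-! ### The random draws -/

lemma bind_congr_support {α β : Type*} (p : PMF α) {f g : α → PMF β}
    (h : ∀ a ∈ p.support, f a = g a) : p.bind f = p.bind g := by
  ext b
  rw [PMF.bind_apply, PMF.bind_apply]
  refine tsum_congr fun a => ?_
  by_cases ha : p a = 0
  · rw [ha, zero_mul, zero_mul]
  · rw [h a ((PMF.mem_support_iff _ _).2 ha)]

/-- Draws `J i ∈ {0, …, i}` independently and uniformly for all `i < k`. -/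
noncomputable def draws : ℕ → PMF (ℕ → ℕ)
  | 0 => PMF.pure 0
  | k + 1 => (draws k).bind fun J =>
      (PMF.uniformOfFintype (Fin (k + 1))).map fun j : Fin (k + 1) => Function.update J k j

lemma le_of_mem_support_draws {k : ℕ} {J : ℕ → ℕ} (hJ : J ∈ (draws k).support) :
    ∀ i < k, J i ≤ i := by
  induction k generalizing J with
  | zero => intro i hi; omega
  | succ k ih =>
    simp only [draws, PMF.mem_support_bind_iff, PMF.mem_support_map_iff] at hJ
    obtain ⟨J', hJ', j, -, rfl⟩ := hJ
    intro i hi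
    by_cases e : i = k
    · rw [e, Function.update_self]
      omega
    · rw [Function.update_of_ne e]
      exact ih hJ' i (by omega)

lemma map_shuffle_draws_succ {n k : ℕ} (hk : k < n) :
    (draws (k + 1)).map (fun J => (shuffle J (k + 1) : Equiv.Perm (Fin n))) =
      (PMF.uniformOfFintype (Fin (k + 1))).bind fun j : Fin (k + 1) =>
        ((draws k).map fun J => (shuffle J k : Equiv.Perm (Fin n))).map
          (· * Equiv.swap ⟨k, hk⟩ ⟨j, by omega⟩) := by
  simp only [draws, PMF.map_bind, PMF.map_comp]
  simp only [← PMF.bind_pure_comp]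
  rw [PMF.bind_comm]
  congr 1
  funext j
  congr 1
  funext J
  simp only [Function.comp_apply]
  have hj : Function.update J k j k ≤ k := by
    rw [Function.update_self]
    omega
  rw [shuffle_succ _ hk hj, shuffle_congr fun i hi => Function.update_of_ne hi.ne _ _]
  simp only [Function.update_self]

lemma map_mul_right_apply {G : Type*} [Group G] (p : PMF G) (g h : G) :
    (p.map (· * g)) h = p (h * g⁻¹) := by
  rw [PMF.map_apply, tsum_eq_single (h * g⁻¹)]
  · simp
  · intro b hb
    rw [if_neg]
    rintro rfl
    simp at hb

/-- After `k` rounds the random permutation is uniform on those that fix all numbers from `k` on. -/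
lemma map_shuffle_draws_apply {n k : ℕ} (hk : k ≤ n) (π : Equiv.Perm (Fin n)) :
    ((draws k).map fun J => (shuffle J k : Equiv.Perm (Fin n))) π =
      if ∀ r : Fin n, k ≤ r → π r = r then (k.factorial : ENNReal)⁻¹ else 0 := by
  induction k generalizing π with
  | zero =>
    simp only [draws, PMF.pure_map, shuffle, PMF.pure_apply, Nat.zero_le, forall_true_left,
      Nat.factorial_zero, Nat.cast_one, inv_one, Equiv.ext_iff, Equiv.Perm.one_apply]
  | succ k ih =>
    have hk' : k < n := hk
    rw [map_shuffle_draws_succ hk', PMF.bind_apply, tsum_fintype]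
    simp only [map_mul_right_apply, Equiv.swap_inv, PMF.uniformOfFintype_apply, Fintype.card_fin,
      ih hk'.le]
    have key : ∀ j : Fin (k + 1),
        (∀ r : Fin n, k ≤ r → (π * Equiv.swap (⟨k, hk'⟩ : Fin n) ⟨j, by omega⟩) r = r) ↔
          (∀ r : Fin n, k + 1 ≤ r → π r = r) ∧ π ⟨j, by omega⟩ = ⟨k, hk'⟩ := by
      intro j
      have hne : ∀ r : Fin n, k + 1 ≤ r →
          Equiv.swap (⟨k, hk'⟩ : Fin n) ⟨j, by omega⟩ r = r := by
        intro r hr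
        have h1 : r ≠ ⟨k, hk'⟩ := Fin.ne_of_val_ne (by simp only; omega)
        have h2 : r ≠ ⟨j, by omega⟩ := Fin.ne_of_val_ne (by simp only; omega)
        exact Equiv.swap_apply_of_ne_of_ne h1 h2
      constructor
      · intro h
        refine ⟨fun r hr => ?_, ?_⟩
        · have := h r (by omega)
          rwa [Equiv.Perm.mul_apply, hne r hr] at this
        · have := h ⟨k, hk'⟩ le_rfl
          rwa [Equiv.Perm.mul_apply, Equiv.swap_apply_left] at this
      · rintro ⟨h1, h2⟩ r hr
        rw [Equiv.Perm.mul_apply]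
        rcases eq_or_lt_of_le hr with e | hlt
        · have : r = ⟨k, hk'⟩ := Fin.ext e.symm
          rw [this, Equiv.swap_apply_left, h2]
        · rw [hne r hlt, h1 r hlt]
    simp only [key]
    split_ifs with hπ
    · have hlt : ((π⁻¹ ⟨k, hk'⟩ : Fin n) : ℕ) < k + 1 := by
        by_contra hcon
        have h1 := hπ (π⁻¹ ⟨k, hk'⟩) (by omega)
        rw [← Equiv.Perm.mul_apply, mul_inv_cancel, Equiv.Perm.one_apply] at h1
        have h2 : k = (π⁻¹ ⟨k, hk'⟩ : Fin n) := congrArg Fin.val h1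
        omega
      rw [sum_eq_single ⟨_, hlt⟩]
      · rw [if_pos ⟨hπ, by simp⟩, Nat.factorial_succ, Nat.cast_mul, ENNReal.mul_inv]
        · exact .inl (by exact_mod_cast k.succ_ne_zero)
        · exact .inl (ENNReal.natCast_ne_top _)
      · intro j _ hj
        rw [if_neg, mul_zero]
        rintro ⟨-, h⟩
        have hinv : π⁻¹ ⟨k, hk'⟩ = ⟨j, by omega⟩ := by rw [← h, Equiv.Perm.inv_eq_iff_eq]
        exact hj (Fin.ext (congrArg Fin.val hinv).symm)
      · simp
    · exact sum_eq_zero fun j _ => by rw [if_neg fun h => hπ h.1, mul_zero]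

/-- Successive random transpositions give a uniformly random permutation. -/
lemma map_shuffle_draws (n : ℕ) : (draws n).map (fun J => shuffle J n) =
    PMF.uniformOfFintype (Equiv.Perm (Fin n)) := by
  ext π
  rw [map_shuffle_draws_apply le_rfl, if_pos fun r hr => absurd r.2 (by omega),
    PMF.uniformOfFintype_apply, Fintype.card_perm, Fintype.card_fin]

/-! ### The program for the mechanism -/

/-- Draws the random numbers for the priority order; `var 30` is the counter. -/
def drawLoop : Program :=
  .loop (.sub (.var 0) (.var 30))
    (.seq (.rand 6 (.var 30) (.const 0) (.var 30))
      (.assign 30 (.const 0) (.const 0) (.add (.var 30) (.const 1))))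

/-- A program for the whole mechanism. -/
def mechProg : Program :=
  .seq (.rand 4 (.const 0) (.const 0) (.sub (.var 1) (.const 1)))
  (.seq (.rand 5 (.const 0) (.const 0) (.sub (.var 1) (.const 1)))
  (.seq (.assign 30 (.const 0) (.const 0) (.const 0))
  (.seq drawLoop detProg)))

lemma run_rand {T N : ℕ} [NeZero N] {t : ℕ} {i j e : Expr} {K : List Program} {s : Memory}
    (h : e.eval s + 1 = N) : run (T + 1) (.rand t i j e :: K, s) =
      (PMF.uniformOfFintype (Fin N)).bind fun k : Fin N =>
        run T (K, s.write t (i.eval s) (j.eval s) k) := by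
  subst h
  rw [run, step, PMF.bind_map]
  -- in `step`, the coercion of the drawn number to a natural number is a `bind` of its own
  change ((PMF.uniformOfFintype _).bind fun k : Fin (e.eval s + 1) => PMF.pure (k : ℕ)).bind _ = _
  rw [PMF.bind_bind]
  simp only [PMF.pure_bind]
  rfl

lemma run_seq {T : ℕ} {p q : Program} {K : List Program} {s : Memory} :
    run (T + 1) (.seq p q :: K, s) = run T (p :: q :: K, s) := by
  rw [run, step, PMF.pure_bind]

lemma run_assign {T : ℕ} {t : ℕ} {i j e : Expr} {K : List Program} {s : Memory} :
    run (T + 1) (.assign t i j e :: K, s) =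
      run T (K, s.write t (i.eval s) (j.eval s) (e.eval s)) := by
  rw [run, step, PMF.pure_bind]

/-- The memory `s` after `k` random numbers, listed by `J`, have been drawn. -/
def withDraws (s : Memory) (J : ℕ → ℕ) (k : ℕ) : Memory := fun t i j =>
  if t = 6 ∧ j = 0 then J i else if t = 30 ∧ i = 0 ∧ j = 0 then k else s t i j

lemma withDraws_of_ne (s : Memory) (J : ℕ → ℕ) (k : ℕ) {t : ℕ} (h6 : t ≠ 6) (h30 : t ≠ 30) :
    withDraws s J k t = s t := by
  funext i j
  simp [withDraws, h6, h30]

lemma run_drawLoop_round {s : Memory} {n k : ℕ} (hn : s 0 0 0 = n) (hk : k < n) (J : ℕ → ℕ)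
    (K : List Program) : run 4 (drawLoop :: K, withDraws s J k) =
      (PMF.uniformOfFintype (Fin (k + 1))).map fun j : Fin (k + 1) =>
        (drawLoop :: K, withDraws s (Function.update J k j) (k + 1)) := by
  have h0 : withDraws s J k 0 0 0 = n := hn
  have h30 : withDraws s J k 30 0 0 = k := rfl
  rw [run, drawLoop, step, PMF.pure_bind, if_pos, run_seq, run_rand (N := k + 1)]
  · rw [← PMF.bind_pure_comp]
    congr 1
    funext j
    rw [run_assign, run, Function.comp_apply]
    congr 2
    simp only [Expr.eval, Expr.var, h30]
    rw [Memory.write_ne (by simp), h30]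
    funext t a b
    by_cases e6 : t = 6
    · subst e6
      by_cases ea : a = k <;> by_cases eb : b = 0 <;>
        simp [withDraws, Memory.write, ea, eb]
    · by_cases e30 : t = 30
      · subst e30
        by_cases hab : a = 0 ∧ b = 0 <;> simp [withDraws, Memory.write, hab]
      · simp [withDraws, Memory.write, e6, e30]
  · simp only [Expr.eval, Expr.var, h30]
  · simp only [Expr.eval, Expr.var, h30, h0]
    omega

lemma run_drawLoop {s : Memory} {n k : ℕ} (hn : s 0 0 0 = n) (hk : k ≤ n) (K : List Program) :
    run (4 * k) (drawLoop :: K, withDraws s 0 0) =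
      (draws k).map fun J => (drawLoop :: K, withDraws s J k) := by
  induction k with
  | zero => simp [run, draws, PMF.pure_map]
  | succ k ih =>
    rw [Nat.mul_succ, run_add, ih (by omega), draws, PMF.map_bind, PMF.bind_map]
    congr 1
    funext J
    rw [Function.comp_apply, run_drawLoop_round hn hk, PMF.map_comp]
    rfl

/-- The memory when the random items have been drawn. -/
def afterItems {n m : ℕ} (R : Fin n → Finset (Fin m)) (x y : Fin m) : Memory :=
  ((inputMemory R).write 4 0 0 x).write 5 0 0 y

section Mechanism

variable {n m : ℕ}

/-- The draws take `4 * n + 8` steps whatever their outcome. -/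
lemma run_mechProg [NeZero m] (R : Fin n → Finset (Fin m)) (T : ℕ) :
    run (4 * n + 8 + T) ([mechProg], inputMemory R) =
      (PMF.uniformOfFintype (Fin m)).bind fun x => (PMF.uniformOfFintype (Fin m)).bind fun y =>
        (draws n).bind fun J => run T ([detProg], withDraws (afterItems R x y) J n) := by
  have hm : m - 1 + 1 = m := Nat.succ_pred_eq_of_pos (Nat.pos_of_neZero m)
  have hT : 4 * n + 8 + T = 4 * n + (1 + T) + 7 := by omega
  rw [hT, mechProg, run_seq, run_rand (N := m)]
  swap
  · simp only [Expr.eval, Expr.var, inputMemory_one, hm]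
  congr 1
  funext x
  rw [run_seq, run_rand (N := m)]
  swap
  · simp only [Expr.eval, Expr.var]
    rw [Memory.write_ne (by simp), inputMemory_one, hm]
  congr 1
  funext y
  have hstart : (afterItems R x y).write 30 0 0 0 = withDraws (afterItems R x y) 0 0 := by
    funext t i j
    by_cases e6 : t = 6
    · subst e6
      simp [withDraws, afterItems, Memory.write, inputMemory_eq_zero]
    · simp [withDraws, Memory.write, e6]
  rw [run_seq, run_assign, run_seq]
  change run (4 * n + (1 + T)) ([drawLoop, detProg], (afterItems R x y).write 30 0 0 0) = _
  have h0 : afterItems R x y 0 0 0 = n := inputMemory_zero R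
  rw [hstart, run_add, run_drawLoop h0 le_rfl, PMF.bind_map]
  congr 1
  funext J
  rw [Function.comp_apply, run_add 1, run, drawLoop, step, PMF.pure_bind, if_neg, run,
    PMF.pure_bind]
  have h1 : withDraws (afterItems R x y) J n 0 0 0 = n := h0
  have h2 : withDraws (afterItems R x y) J n 30 0 0 = n := rfl
  simp [Expr.eval, Expr.var, h1, h2]

lemma run_detProg (R : Fin n → Finset (Fin m)) (x y : Fin m) {J : ℕ → ℕ} (hJ : ∀ i < n, J i ≤ i)
    {T : ℕ} (hT : (n + m + 10) ^ 32 ≤ T) : ∃ s,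
      run T ([detProg], withDraws (afterItems R x y) J n) = PMF.pure ([], s) ∧
        outputAllocation s = mech (programRule n m) R (pairHeld x y, shuffle J n) := by
  set u := withDraws (afterItems R x y) J n with hu
  have hR : ∀ t, t ∉ [4, 5, 6, 30] → u t = inputMemory R t := by
    intro t ht
    simp only [List.mem_cons, List.not_mem_nil, or_false, not_or] at ht
    rw [hu, withDraws_of_ne _ _ _ ht.2.2.1 ht.2.2.2, afterItems, Memory.write_ne ht.2.1,
      Memory.write_ne ht.1]
  have hx : u 4 0 0 = x := by
    rw [hu, withDraws_of_ne _ _ _ (by simp) (by simp), afterItems, Memory.write_ne (by simp),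
      Memory.write_self]
  have hy : u 5 0 0 = y := by
    rw [hu, withDraws_of_ne _ _ _ (by simp) (by simp), afterItems, Memory.write_self]
  obtain ⟨s, t, h1, h2, h3⟩ := detProg_ends rfl hR hx hy hJ
  refine ⟨s, ?_, h3⟩
  obtain ⟨d, rfl⟩ := Nat.exists_eq_add_of_le (h2.trans hT)
  rw [run_add, h1.run, PMF.pure_bind, run_halted]

/-- The program `mechProg` runs the mechanism in polynomial time. -/
theorem runsMechIn_mechProg [NeZero m] (R : Fin n → Finset (Fin m)) :
    RunsMechIn mechProg ((n + m + 10) ^ 33) (programRule n m) R := by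
  obtain ⟨T, hT, hle⟩ : ∃ T, (n + m + 10) ^ 33 = 4 * n + 8 + T ∧ (n + m + 10) ^ 32 ≤ T := by
    have h1 : n + m + 10 ≤ (n + m + 10) ^ 32 := Nat.le_self_pow (by simp) _
    refine ⟨(n + m + 10) ^ 33 - (4 * n + 8), ?_, ?_⟩
    all_goals
      rw [pow_succ _ 32]
      have h2 : (n + m + 10) ^ 32 * 10 ≤ (n + m + 10) ^ 32 * (n + m + 10) :=
        Nat.mul_le_mul_left _ (by omega)
      omega
  rw [RunsMechIn, hT, run_mechProg]
  constructor
  · intro c hc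
    simp only [PMF.mem_support_bind_iff] at hc
    obtain ⟨x, -, y, -, J, hJ, hc⟩ := hc
    obtain ⟨s, h1, -⟩ := run_detProg R x y (le_of_mem_support_draws hJ) hle
    rw [h1, PMF.mem_support_pure_iff] at hc
    rw [hc]
  · rw [coins_eq_bind]
    simp only [PMF.map_bind, PMF.map_comp]
    refine congrArg (PMF.bind _) (funext fun x => congrArg (PMF.bind _) (funext fun y => ?_))
    rw [← map_shuffle_draws, PMF.map_comp, ← PMF.bind_pure_comp]
    refine bind_congr_support _ fun J hJ => ?_
    obtain ⟨s, h1, h2⟩ := run_detProg R x y (le_of_mem_support_draws hJ) hle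
    rw [h1, PMF.pure_map, h2]
    rfl

end Mechanism

end FairAllocation

theorem mainTheorem4 :
    -- the guarantees, for every PE mechanism
    (∀ (n m : ℕ) [NeZero m] (ε : ℝ) (pe : FairAllocation.PERule n m)
      (f : Fin n → FairAllocation.Valuation (Fin m)),
      2 ≤ n → 0 ≤ ε → ε < 1 / ((n : ℝ) * (m : ℝ) ^ 3) → FairAllocation.IsPE pe →
      (∀ v, FairAllocation.IsLeveled ε (f v)) →
      -- truthful in expectation
      (∀ (v : Fin n) (R : Fin n → Finset (Fin m)) (S : Finset (Fin m)),
        FairAllocation.expectedValue pe (Function.update R v S) (f v) v ≤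
          FairAllocation.expectedValue pe
            (Function.update R v (FairAllocation.demand (f v))) (f v) v) ∧
      -- the truth is the unique best report if another agent reports an item that `v` demands
      (∀ (v : Fin n) (R : Fin n → Finset (Fin m)) (S : Finset (Fin m)),
        (∃ i, i ≠ v ∧ (R i ∩ FairAllocation.demand (f v)).Nonempty) →
        S ≠ FairAllocation.demand (f v) →
        FairAllocation.expectedValue pe (Function.update R v S) (f v) v <
          FairAllocation.expectedValue pe
            (Function.update R v (FairAllocation.demand (f v))) (f v) v) ∧
      -- ex-post `ε`-truthful
      (∀ ω ∈ (FairAllocation.coins n m).support,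
        ∀ (v : Fin n) (R : Fin n → Finset (Fin m)) (S : Finset (Fin m)),
        f v (FairAllocation.mech pe (Function.update R v S) ω v) ≤
          (1 + ε) * f v (FairAllocation.mech pe
            (Function.update R v (FairAllocation.demand (f v))) ω v)) ∧
      -- reasonable, and nearly welfare maximizing, when all agents are truthful
      (∀ ω ∈ (FairAllocation.coins n m).support,
        FairAllocation.IsReasonable f
          (FairAllocation.mech pe (fun v => FairAllocation.demand (f v)) ω) ∧
        ∀ B : Fin n → Finset (Fin m), FairAllocation.IsAllocation B →
          1 / (1 + ε) * FairAllocation.welfare f B ≤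
            FairAllocation.welfare f
              (FairAllocation.mech pe (fun v => FairAllocation.demand (f v)) ω)) ∧
      -- ex-post maximin and EF1 guarantees for every truthful agent
      (∀ ω ∈ (FairAllocation.coins n m).support,
        ∀ (v : Fin n) (R : Fin n → Finset (Fin m)), R v = FairAllocation.demand (f v) →
        1 / (1 + ε) * FairAllocation.maximinShare n (f v) ≤
          f v (FairAllocation.mech pe R ω v) ∧
        FairAllocation.IsEF1For (1 / (1 + ε)) (f v) (FairAllocation.mech pe R ω) v) ∧
      -- proportional in expectation for every truthful agent
      (∀ (v : Fin n) (R : Fin n → Finset (Fin m)), R v = FairAllocation.demand (f v) →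
        f v Finset.univ / (n : ℝ) ≤ FairAllocation.expectedValue pe R (f v) v)) ∧
    -- polynomial time: one program and one polynomial for all numbers of agents and items
    (∃ (P : FairAllocation.Program) (q : Polynomial ℕ) (pe : ∀ n m : ℕ, FairAllocation.PERule n m),
      ∀ (n m : ℕ) [NeZero m], 2 ≤ n →
        FairAllocation.IsPE (pe n m) ∧
        ∀ R : Fin n → Finset (Fin m),
          FairAllocation.RunsMechIn P (q.eval (n + m)) (pe n m) R) := by
  refine ⟨?_, FairAllocation.mechProg, (Polynomial.X + Polynomial.C 10) ^ 33,
    FairAllocation.programRule, fun n m _ _ => ⟨FairAllocation.isPE_programRule, fun R => ?_⟩⟩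
  · intro n m _ ε pe f hn hε0 hε hPE hf
    have hpe := hPE.isEgalitarian hn
    refine ⟨fun v R S => ?_, fun v R S hcomp hS => ?_, ?_, ?_, ?_, fun v R hv => ?_⟩
    · exact FairAllocation.expectedValue_le hn hε0 hε hpe (hf v) R v S
    · exact FairAllocation.expectedValue_lt hn hε0 hε hpe (hf v) R v hS hcomp
    · rintro ⟨X, σ⟩ - v R S
      exact FairAllocation.ex_post_truthful hpe hε0 (hf v) R X σ v S
    · rintro ⟨X, σ⟩ hω
      have hX := FairAllocation.distinct_of_mem_support hω
      exact ⟨FairAllocation.mech_isReasonable hpe hf hX σ,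
        fun B hB => FairAllocation.le_welfare_mech hpe hε0 hf hX σ hB⟩
    · rintro ⟨X, σ⟩ - v R hv
      exact ⟨FairAllocation.maximinShare_le hpe hε0 (hf v) hv X σ,
        FairAllocation.mech_isEF1For hpe hε0 (hf v) hv X σ⟩
    · exact FairAllocation.proportional_in_expectation hn hε0 hε hpe (hf v) R v hv
  · have h := FairAllocation.runsMechIn_mechProg R
    simpa using h
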